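/- Let $0<q<1$ and let $M$ be the field of meromorphic functions on $\mathbb C$. Put $$F(\lambda)=\frac{q^{2(\lambda+1)}-q^{-2}}{q^{2(\lambda+1)}-1},\qquad G(\lambda)=\frac{(q^{2(\lambda+1)}-q^{2})(q^{2(\lambda+1)}-q^{-2})}{(q^{2(\lambda+1)}-1)^2},$$ $$H(\lambda,\mu)=\frac{(q-q^{-1})(q^{2(\lambda+\mu+2)}-1)}{(q^{2(\lambda+1)}-1)(q^{2(\mu+1)}-1)},\qquad I(\lambda,\mu)=\frac{(q-q^{-1})(q^{2(\mu+1)}-q^{2(\lambda+1)})}{(q^{2(\lambda+1)}-1)(q^{2(\mu+1)}-1)}.$$ Let $A=\mathcal F_R(\mathrm{SL}(2))$ be the complex unital algebra generated by $\alpha,\beta,\gamma,\delta$ and two commuting copies $\{f(\lambda)\}_{f\in M}$, $\{f(\mu)\}_{f\in M}$ of $M$, subject to $$\begin{aligned} &f(\lambda)\alpha=\alpha f(\lambda+1),\quad f(\mu)\alpha=\alpha f(\mu+1),\quad f(\lambda)\beta=\beta f(\lambda+1),\quad f(\mu)\beta=\beta f(\mu-1),\\ &f(\lambda)\gamma=\gamma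 f(\lambda-1),\quad f(\mu)\gamma=\gamma f(\mu+1),\quad f(\lambda)\delta=\delta f(\lambda-1),\quad f(\mu)\delta=\delta f(\mu-1),\\ &\alpha\beta=qF(\mu-1)\beta\alpha,\quad \alpha\gamma=qF(\lambda)\gamma\alpha,\quad \beta\delta=qF(\lambda)\delta\beta,\quad \gamma\delta=qF(\mu-1)\delta\gamma,\\ &\alpha\delta-\delta\alpha=H(\lambda,\mu)\gamma\beta,\quad G(\mu)\alpha\delta-G(\lambda)\delta\alpha=H(\lambda,\mu)\beta\gamma,\\ &\beta\gamma-G(\mu)\gamma\beta=I(\lambda,\mu)\delta\alpha,\quad \beta\gamma-G(\lambda)\gamma\beta=I(\lambda,\mu)\alpha\delta,\\ &\alpha\delta-qF(\lambda)\gamma\beta=1 . \end{aligned}$$ Grade $A=\sum_{m,n\in\mathbb Z}A_{mn}$ by $f(\lambda),f(\mu)\in A_{00}$, $\alpha\in A_{11}$, $\beta\in A_{1,-1}$, $\gamma\in A_{-1,1}$, $\delta\in A_{-1,-1}$. Let $A\,\widetilde\otimes\,A$ be the algebra $\sum_{m,n,p}A_{mn}\otimes_{\mathbb C}A_{np}$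 modulo the relations $f(\mu)a\otimes b=a\otimes f(\lambda)b$, and let $\Delta:A\to A\,\widetilde\otimes\,A$ be the algebra homomorphism with $\Delta(\alpha)=\alpha\otimes\alpha+\beta\otimes\gamma$, $\Delta(\beta)=\alpha\otimes\beta+\beta\otimes\delta$, $\Delta(\gamma)=\gamma\otimes\alpha+\delta\otimes\gamma$, $\Delta(\delta)=\gamma\otimes\beta+\delta\otimes\delta$, $\Delta(f(\lambda))=f(\lambda)\otimes1$, $\Delta(f(\mu))=1\otimes f(\mu)$. For $N\ge 0$ let $V_N$ be the corepresentation obtained by restricting $\Delta$ to $\sum_{k=0}^N M\,\gamma^{N-k}\alpha^k$, $M$ acting by multiplication by $f(\lambda)$. Then: (1) The element $$\Xi=q^{\lambda-\mu+1}+q^{\mu-\lambda-1}-q^{-(\lambda+\mu+2)}(1-q^{2(\lambda+2)})(1-q^{2\mu})\,\gamma\beta$$ is central in $A$. (2) For every $N\ge0$ there are unique elements $t^N_{kj}\in\sum_m A_{m,2j-N}$, $0\le k,j\le N$ (the matrix elements of $V_N$), with $$\Delta(\gamma^{N-k}\alpha^k)=\sum_{j=0}^N t^N_{kj}\otimes\gamma^{N-j}\alpha^j\qquad(0\le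 k\le N),$$ and for all $0\le k,j\le N$ $$t^N_{kj}=\begin{cases} \gamma^{j-k}\delta^{N-k-j}P_k,& k\le j,\ k+j\le N,\\ \gamma^{j-k}P_{N-j}\,\alpha^{k+j-N},& k\le j,\ N\le k+j,\\ \delta^{N-k-j}P_j\,\beta^{k-j},& j\le k,\ k+j\le N,\\ P_{N-k}\,\alpha^{k+j-N}\beta^{k-j},& j\le k,\ N\le k+j, \end{cases}$$ where $P_n=P_n^{N,k,j}\in A_{00}$ is given by $$\begin{split}P_n&=q^{n(\lambda-\mu+1+n+|N-k-j|)+j(j-N)}\frac{(q^2;q^2)_{N-n}}{(q^2;q^2)_j\,(q^2;q^2)_{N-j}\,(q^{2(\lambda+2)};q^2)_n\,(q^{2(-\mu+|N-k-j|)};q^2)_n}\\ &\quad\times p_n\bigl(\tfrac12\Xi;\,q^{\mu-\lambda+1+2|j-k|},\,q^{\lambda-\mu+1},\,q^{\lambda+\mu+3},\,q^{-\lambda-\mu-1+2|N-k-j|};\,q^2\bigr).\end{split}$$ Here $(x;p)_k=\prod_{i=0}^{k-1}(1-xp^i)$, $(x_1,\dots,x_r;p)_k=\prod_i(x_i;p)_k$,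 and $p_n$ is the Askey–Wilson polynomial $$p_n(x;a,b,c,d;p)=\frac{(ab,ac,ad;p)_n}{a^n}\sum_{k=0}^n\frac{(p^{-n},abcd\,p^{n-1};p)_k}{(p,ab,ac,ad;p)_k}\,p^k\prod_{i=0}^{k-1}\bigl(1-2ap^ix+a^2p^{2i}\bigr),$$ a polynomial in $x$ whose coefficients are here functions of $\lambda$ and $\mu$, written to the left of the powers of $\tfrac12\Xi$. -/

import Mathlib

open Filter Topology
open scoped TensorProduct
noncomputable section
namespace DynQG

/-- The algebra of functions `ℂ → ℂ` that are meromorphic at every point. -/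
def merAlg : Subalgebra ℂ (ℂ → ℂ) where
  carrier := {f | Meromorphic f}
  mul_mem' hf hg := Meromorphic.mul hf hg
  add_mem' hf hg := Meromorphic.add hf hg
  algebraMap_mem' c := Meromorphic.const (𝕜 := ℂ) c

/-- The functions that vanish on a punctured neighbourhood of every point. Two functions of
`merAlg` represent the same meromorphic function on `ℂ` (they differ only on a closed discrete set)
exactly when their difference is of this kind. -/
def merNull : Ideal merAlg where
  carrier := {f | ∀ x : ℂ, ∀ᶠ z in 𝓝[≠] x, (f : ℂ → ℂ) z = 0}
  zero_mem' := fun x => Eventually.of_forall fun z => rfl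
  add_mem' {f g} hf hg := fun x => by
    filter_upwards [hf x, hg x] with z h1 h2
    change (f : ℂ → ℂ) z + (g : ℂ → ℂ) z = 0
    rw [h1, h2, add_zero]
  smul_mem' c f hf := fun x => by
    filter_upwards [hf x] with z h1
    change (c : ℂ → ℂ) z * (f : ℂ → ℂ) z = 0
    rw [h1, mul_zero]

/-- A nonzero meromorphic function on `ℂ` has an inverse. -/
instance merNull_isMaximal : merNull.IsMaximal := by
  apply Ideal.Quotient.maximal_of_isField
  refine ⟨⟨0, 1, ?_⟩, fun a b => mul_comm a b, ?_⟩
  · intro h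
    have h1 : (1 : merAlg) ∈ merNull := by
      rw [← Ideal.Quotient.eq_zero_iff_mem]; simpa using h.symm
    have h2 : ∀ᶠ z in 𝓝[≠] (0 : ℂ), (1 : ℂ) = 0 := h1 0
    rw [eventually_const] at h2
    exact one_ne_zero h2
  · intro a ha
    obtain ⟨f, rfl⟩ := Ideal.Quotient.mk_surjective a
    have hf : Meromorphic (f : ℂ → ℂ) := f.2
    refine ⟨Ideal.Quotient.mk _ ⟨_, hf.inv⟩, ?_⟩
    rw [← map_mul, ← map_one (Ideal.Quotient.mk merNull), Ideal.Quotient.eq]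
    have hne : ¬ ∀ x : ℂ, ∀ᶠ z in 𝓝[≠] x, (f : ℂ → ℂ) z = 0 := fun h =>
      ha (Ideal.Quotient.eq_zero_iff_mem.2 h)
    push Not at hne
    obtain ⟨x0, hx0⟩ := hne
    have key := (hf.meromorphicOn (s := Set.univ)).exists_meromorphicOrderAt_ne_top_iff_forall
      isConnected_univ
    intro x
    have hx := key.1 ⟨⟨x0, trivial⟩, fun h => hx0 (by simpa using meromorphicOrderAt_eq_top_iff.1 h)⟩ ⟨x, trivial⟩
    have hx' : ∀ᶠ z in 𝓝[≠] x, (f : ℂ → ℂ) z ≠ 0 := by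
      rcases (hf x).eventually_eq_zero_or_eventually_ne_zero with h | h
      · exact absurd (meromorphicOrderAt_eq_top_iff.2 h) hx
      · exact h
    filter_upwards [hx'] with z hz
    change (f : ℂ → ℂ) z * ((f : ℂ → ℂ) z)⁻¹ - 1 = 0
    rw [mul_inv_cancel₀ hz, sub_self]

/-- The field of meromorphic functions on `ℂ`. -/
def Mer : Type := merAlg ⧸ merNull

/-- The field structure of `Mer`. -/
def Mer.field : Field Mer := Ideal.Quotient.field merNull

instance : Field Mer := Mer.field

/-- The meromorphic function represented by an element of `merAlg`. -/
def Mer.mk : merAlg →+* Mer := Ideal.Quotient.mk merNull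

theorem Mer.mk_eq_zero {f : merAlg} : Mer.mk f = 0 ↔ f ∈ merNull :=
  Ideal.Quotient.eq_zero_iff_mem

instance : Algebra ℂ Mer := (Mer.mk.comp (algebraMap ℂ merAlg)).toAlgebra

/-- The meromorphic function represented by `f`. -/
def Mer.of (f : ℂ → ℂ) (hf : Meromorphic f) : Mer := Mer.mk ⟨f, hf⟩

/-- The translation `f ↦ f (· + a)` of representatives. -/
def merAlgShift (a : ℂ) : merAlg →+* merAlg where
  toFun := fun f => ⟨fun z => (f : ℂ → ℂ) (z + a), fun x =>
    meromorphicAt_comp_add_const_iff_meromorphicAt.2 (f.2 (x + a))⟩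
  map_one' := rfl
  map_mul' := fun _ _ => rfl
  map_zero' := rfl
  map_add' := fun _ _ => rfl

theorem merAlgShift_mem (a : ℂ) (f : merAlg) (hf : f ∈ merNull) : merAlgShift a f ∈ merNull :=
  fun x => by
    have h : Tendsto (fun z : ℂ => z + a) (𝓝[≠] x) (𝓝[≠] (x + a)) := by
      refine tendsto_nhdsWithin_of_tendsto_nhds_of_eventually_within _
        ((continuous_add_const a).tendsto x |>.mono_left nhdsWithin_le_nhds) ?_
      filter_upwards [self_mem_nhdsWithin] with z hz
      simpa using hz
    exact h.eventually (hf (x + a))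

/-- The automorphism `(T_a f)(z) = f (z + a)` of the field of meromorphic functions. -/
def Mer.shift (a : ℂ) : Mer →ₐ[ℂ] Mer :=
  { (Ideal.Quotient.lift merNull (Mer.mk.comp (merAlgShift a)) (fun f hf =>
      Mer.mk_eq_zero.2 (merAlgShift_mem a f hf)) : Mer →+* Mer) with
    commutes' := fun _ => rfl }

/-- The function `q ^ (c * z + d) = exp ((c * z + d) * log q)` of the variable `z`. -/
def qexp (q : ℝ) (c d : ℤ) : Mer :=
  Mer.of (fun z => Complex.exp ((c * z + d) * Real.log q))
    (fun x => (by fun_prop : AnalyticAt ℂ _ x).meromorphicAt)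

theorem shift_qexp (q : ℝ) (c d a : ℤ) :
    Mer.shift a (qexp q c d) = qexp q c (d + c * a) := by
  refine congrArg Mer.mk (Subtype.ext (funext fun z => ?_))
  change Complex.exp _ = Complex.exp _
  congr 1; push_cast; ring

theorem qexp_const (q : ℝ) (hq : 0 < q) (d : ℤ) : qexp q 0 d = algebraMap ℂ Mer ((q : ℂ) ^ d) := by
  refine congrArg Mer.mk (Subtype.ext (funext fun z => ?_))
  change Complex.exp _ = (q : ℂ) ^ d
  rw [← Complex.cpow_intCast, Complex.cpow_def_of_ne_zero (by exact_mod_cast hq.ne'),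
    Complex.ofReal_log hq.le]
  congr 1; push_cast; ring

theorem qexp_mul (q : ℝ) (c d c' d' : ℤ) : qexp q c d * qexp q c' d' = qexp q (c + c') (d + d') := by
  refine congrArg Mer.mk (Subtype.ext (funext fun z => ?_))
  change Complex.exp _ * Complex.exp _ = Complex.exp _
  rw [← Complex.exp_add]
  congr 1; push_cast; ring

theorem qexp_sub_one_ne_zero (q : ℝ) (h0 : 0 < q) (h1 : q < 1) (d : ℤ) : qexp q 2 d - 1 ≠ 0 := by
  intro h
  have h2 := Mer.mk_eq_zero.1 h
  have h3 : ∀ᶠ z in 𝓝[≠] ((1 - d) / 2 : ℂ),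
      Complex.exp ((((2 : ℤ) : ℂ) * z + d) * Real.log q) - 1 = 0 := h2 ((1 - d) / 2)
  have h4 : ContinuousAt
      (fun z : ℂ => Complex.exp ((((2 : ℤ) : ℂ) * z + d) * Real.log q) - 1) ((1 - d) / 2) := by
    fun_prop
  have h5 := tendsto_nhds_unique (h4.tendsto.mono_left nhdsWithin_le_nhds)
    (tendsto_const_nhds.congr' (h3.mono fun z hz => hz.symm))
  have h6 : ((((2 : ℤ) : ℂ) * ((1 - d) / 2 : ℂ) + d) * Real.log q) = ((Real.log q : ℝ) : ℂ) := by
    push_cast; ring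
  rw [h6, ← Complex.ofReal_exp, Real.exp_log h0, sub_eq_zero] at h5
  exact h1.ne (by exact_mod_cast h5)

/-- The function `F(λ) = (q^{2(λ+1)} - q^{-2}) / (q^{2(λ+1)} - 1)`. -/
def funF (q : ℝ) : Mer :=
  (qexp q 2 2 - algebraMap ℂ Mer ((q : ℂ) ^ (-2 : ℤ))) / (qexp q 2 2 - 1)

/-- The function `G(λ) = (q^{2(λ+1)} - q^2) (q^{2(λ+1)} - q^{-2}) / (q^{2(λ+1)} - 1)^2`. -/
def funG (q : ℝ) : Mer :=
  (qexp q 2 2 - algebraMap ℂ Mer ((q : ℂ) ^ (2 : ℤ))) *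
    (qexp q 2 2 - algebraMap ℂ Mer ((q : ℂ) ^ (-2 : ℤ))) / (qexp q 2 2 - 1) ^ 2

/-- `H(λ, μ) = (q - q⁻¹) (q^{2(λ+μ+2)} - 1) / ((q^{2(λ+1)} - 1) (q^{2(μ+1)} - 1))`, where `x f` and
`y f` stand for `f(λ)` and `f(μ)`. -/
def funH (q : ℝ) {R : Type*} [Ring R] [Algebra ℂ R] (x y : Mer → R) : R :=
  ((q : ℂ) - (q : ℂ)⁻¹) • ((x (qexp q 2 2) * y (qexp q 2 2) - 1) *
    (x ((qexp q 2 2 - 1)⁻¹) * y ((qexp q 2 2 - 1)⁻¹)))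

/-- `I(λ, μ) = (q - q⁻¹) (q^{2(μ+1)} - q^{2(λ+1)}) / ((q^{2(λ+1)} - 1) (q^{2(μ+1)} - 1))`, where
`x f` and `y f` stand for `f(λ)` and `f(μ)`. -/
def funI (q : ℝ) {R : Type*} [Ring R] [Algebra ℂ R] (x y : Mer → R) : R :=
  ((q : ℂ) - (q : ℂ)⁻¹) • ((y (qexp q 2 2) - x (qexp q 2 2)) *
    (x ((qexp q 2 2 - 1)⁻¹) * y ((qexp q 2 2 - 1)⁻¹)))

theorem funF_eq (q : ℝ) (h0 : 0 < q) (h1 : q < 1) :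
    funF q = 1 + algebraMap ℂ Mer (1 - (q : ℂ) ^ (-2 : ℤ)) * (qexp q 2 2 - 1)⁻¹ := by
  have := qexp_sub_one_ne_zero q h0 h1 2
  rw [funF]; field_simp; simp

theorem funF_shift_inv_eq (q : ℝ) (h0 : 0 < q) (h1 : q < 1) :
    (Mer.shift (-1) (funF q))⁻¹ =
      1 + algebraMap ℂ Mer (1 - (q : ℂ) ^ (2 : ℤ)) * (qexp q 2 2 - 1)⁻¹ := by
  have h := qexp_sub_one_ne_zero q h0 h1 2
  have hq : algebraMap ℂ Mer ((q : ℂ) ^ (2 : ℤ)) * algebraMap ℂ Mer ((q : ℂ) ^ (-2 : ℤ)) = 1 := by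
    have : (q : ℂ) ≠ 0 := by exact_mod_cast h0.ne'
    rw [← map_mul, ← zpow_add₀ this]; simp
  have h2 : Mer.shift (-1) (qexp q 2 2) = algebraMap ℂ Mer ((q : ℂ) ^ (-2 : ℤ)) * qexp q 2 2 := by
    have := shift_qexp q 2 2 (-1)
    push_cast at this
    rw [this, ← qexp_const q h0, qexp_mul]
    norm_num
  rw [funF, map_div₀, map_sub, map_sub, map_one, h2, AlgHom.commutes, inv_div]
  have hb : algebraMap ℂ Mer ((q : ℂ) ^ (-2 : ℤ)) ≠ 0 := fun h => by
    rw [h, mul_zero] at hq; exact zero_ne_one hq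
  have h3 : algebraMap ℂ Mer ((q : ℂ) ^ (-2 : ℤ)) * qexp q 2 2 -
      algebraMap ℂ Mer ((q : ℂ) ^ (-2 : ℤ)) ≠ 0 := by
    rw [← mul_sub_one]; exact mul_ne_zero hb h
  rw [map_sub, map_one]
  generalize algebraMap ℂ Mer ((q : ℂ) ^ (2 : ℤ)) = a at *
  generalize algebraMap ℂ Mer ((q : ℂ) ^ (-2 : ℤ)) = b at *
  rw [div_eq_iff h3]
  field_simp
  linear_combination hq

theorem q_ne_zero (q : ℝ) (h0 : 0 < q) : (q : ℂ) ≠ 0 := by exact_mod_cast h0.ne'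

/-- `q F(λ)` -/
def cf (q : ℝ) : Mer := (q : ℂ) • funF q
/-- `q⁻¹ / F(λ - 1)` -/
def ce (q : ℝ) : Mer := (q : ℂ)⁻¹ • (Mer.shift (-1) (funF q))⁻¹

theorem cf_eq (q : ℝ) (h0 : 0 < q) (h1 : q < 1) :
    cf q = algebraMap ℂ Mer q + ((q : ℂ) - (q : ℂ)⁻¹) • (qexp q 2 2 - 1)⁻¹ := by
  have hq := q_ne_zero q h0
  rw [cf, funF_eq q h0 h1]
  have h : (q : ℂ) * (1 - (q : ℂ) ^ (-2 : ℤ)) = (q : ℂ) - (q : ℂ)⁻¹ := by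
    rw [zpow_neg, zpow_ofNat]; field_simp
  rw [smul_add, ← Algebra.smul_def, smul_smul, h, Algebra.algebraMap_eq_smul_one]

theorem ce_eq (q : ℝ) (h0 : 0 < q) (h1 : q < 1) :
    ce q = algebraMap ℂ Mer (q : ℂ)⁻¹ - ((q : ℂ) - (q : ℂ)⁻¹) • (qexp q 2 2 - 1)⁻¹ := by
  have hq := q_ne_zero q h0
  rw [ce, funF_shift_inv_eq q h0 h1]
  have h : (q : ℂ)⁻¹ * (1 - (q : ℂ) ^ (2 : ℤ)) = -((q : ℂ) - (q : ℂ)⁻¹) := by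
    rw [zpow_ofNat]; field_simp; ring
  rw [smul_add, ← Algebra.smul_def, smul_smul, h, Algebra.algebraMap_eq_smul_one, neg_smul]
  exact (sub_eq_add_neg _ _).symm

theorem cf_add_ce (q : ℝ) (h0 : 0 < q) (h1 : q < 1) :
    cf q + ce q = algebraMap ℂ Mer ((q : ℂ) + (q : ℂ)⁻¹) := by
  rw [cf_eq q h0 h1, ce_eq q h0 h1, map_add]; ring

theorem shift_funF_ne_zero (q : ℝ) (h0 : 0 < q) (h1 : q < 1) :
    Mer.shift (-1) (funF q) ≠ 0 := by
  have h2 : funF q ≠ 0 := by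
    rw [funF]
    refine div_ne_zero ?_ (qexp_sub_one_ne_zero q h0 h1 2)
    have h3 : qexp q 2 2 - algebraMap ℂ Mer ((q : ℂ) ^ (-2 : ℤ)) =
        algebraMap ℂ Mer ((q : ℂ) ^ (-2 : ℤ)) * (qexp q 2 4 - 1) := by
      rw [mul_sub_one, ← qexp_const q h0, qexp_mul]; norm_num
    rw [h3]
    refine mul_ne_zero ?_ (qexp_sub_one_ne_zero q h0 h1 4)
    rw [map_ne_zero_iff _ (algebraMap ℂ Mer).injective]
    exact zpow_ne_zero _ (q_ne_zero q h0)
  exact fun h => h2 ((map_eq_zero_iff _ (Mer.shift (-1)).toRingHom.injective).1 h)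

theorem funG_eq (q : ℝ) (h0 : 0 < q) (h1 : q < 1) : funG q = cf q * ce q := by
  have hq := q_ne_zero q h0
  have h3 := qexp_sub_one_ne_zero q h0 h1 2
  have h : cf q * ce q = funF q * (Mer.shift (-1) (funF q))⁻¹ := by
    rw [cf, ce, smul_mul_smul_comm, mul_inv_cancel₀ hq, one_smul]
  rw [h, funF_shift_inv_eq q h0 h1, funF, funG, map_sub, map_one]
  field_simp
  ring

theorem funH_eq (q : ℝ) (h0 : 0 < q) (h1 : q < 1) {R : Type*} [Ring R] [Algebra ℂ R]
    (x y : Mer →ₐ[ℂ] R) (hxy : ∀ f g, Commute (x f) (y g)) :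
    funH q x y = x (cf q) - y (ce q) := by
  have h3 := qexp_sub_one_ne_zero q h0 h1 2
  have huv : qexp q 2 2 * (qexp q 2 2 - 1)⁻¹ = 1 + (qexp q 2 2 - 1)⁻¹ := by field_simp; ring
  rw [funH, cf_eq q h0 h1, ce_eq q h0 h1]
  generalize qexp q 2 2 = u at *
  generalize (u - 1)⁻¹ = v at *
  have h4 : (x u * y u - 1) * (x v * y v) = 1 + x v + y v := by
    have : x u * y u * (x v * y v) = x (u * v) * y (u * v) := by
      rw [map_mul, map_mul, mul_assoc, ← mul_assoc (y u), ← (hxy v u).eq]; simp only [mul_assoc]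
    rw [sub_mul, this, huv, map_add, map_add, map_one, map_one]; noncomm_ring
  rw [h4]
  simp only [map_add, map_sub, map_smul, map_one, Algebra.algebraMap_eq_smul_one]
  module

theorem funI_eq (q : ℝ) (h0 : 0 < q) (h1 : q < 1) {R : Type*} [Ring R] [Algebra ℂ R]
    (x y : Mer →ₐ[ℂ] R) (hxy : ∀ f g, Commute (x f) (y g)) :
    funI q x y = x (cf q) - y (cf q) := by
  have h3 := qexp_sub_one_ne_zero q h0 h1 2
  have huv : qexp q 2 2 * (qexp q 2 2 - 1)⁻¹ = 1 + (qexp q 2 2 - 1)⁻¹ := by field_simp; ring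
  rw [funI, cf_eq q h0 h1]
  generalize qexp q 2 2 = u at *
  generalize (u - 1)⁻¹ = v at *
  have h4 : (y u - x u) * (x v * y v) = x v - y v := by
    have e1 : y u * (x v * y v) = x v * y (u * v) := by
      rw [map_mul, ← mul_assoc, ← (hxy v u).eq, mul_assoc]
    have e2 : x u * (x v * y v) = x (u * v) * y v := by rw [map_mul, mul_assoc]
    rw [sub_mul, e1, e2, huv, map_add, map_add, map_one, map_one]; noncomm_ring
  rw [h4]
  simp only [map_add, map_smul, map_one, Algebra.algebraMap_eq_smul_one]
  module

/-- A compact form of the quadratic and determinant relations, with `l`, `r` the two embeddings of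
the functions, `f` standing for `q F` and `e` for the function `q⁻¹ / F(· - 1)`. It is used only in
the verification that the coproduct respects the defining relations. -/
structure Good {M R : Type*} [CommRing M] [Ring R] (l r : M →+* R) (f e : M) (a b c d : R) :
    Prop where
  A1 : a * c = l f * (c * a)
  A2 : b * d = l f * (d * b)
  A3 : b * a = r e * (a * b)
  A4 : d * c = r e * (c * d)
  A5 : a * d = l f * (c * b) + 1
  A6 : b * c = l f * (d * a) - r f
  A7 : b * c = r e * (a * d) - l e
  A8 : d * a = r e * (c * b) + 1

section
variable {M R : Type*} [CommRing M] [Ring R] {l r : M →+* R} {f e s : M} {a b c d : R}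
theorem Good.ad1 (h : Good l r f e a b c d) : a * d - d * a = (l f - r e) * (c * b) := by
  rw [h.A5, h.A8]; noncomm_ring
theorem Good.ad2 (h : Good l r f e a b c d) (hlr : ∀ f g, Commute (l f) (r g)) (hs : f + e = s) (hs' : l s = r s) :
   r (f * e) * (a * d) - l (f * e) * (d * a) = (l f - r e) * (b * c) := by
  have k1 : l e = l s - l f := by rw [← map_sub, ← hs]; simp
  have k2 : r f = r s - r e := by rw [← map_sub, ← hs]; simp
  have e1 : (l f - r e) * (b * c) = l f * (b * c) - r e * (b * c) := by noncomm_ring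
  rw [e1]
  nth_rw 1 [h.A7]
  rw [h.A6]
  rw [mul_comm f e, map_mul, map_mul, h.A5, h.A8, k1, k2, hs']
  have c1 : l f * r e = r e * l f := hlr f e
  have c2 : l f * r s = r s * l f := hlr f s
  have c3 : r e * r s = r s * r e := by rw [← map_mul, ← map_mul, mul_comm]
  simp only [mul_sub, sub_mul, mul_add, mul_one, ← mul_assoc, c1, c2, c3]
  simp only [mul_assoc, c1]
  simp only [← mul_assoc, c1]
  abel_nf
theorem Good.bc1 (h : Good l r f e a b c d)  : b * c - r (f * e) * (c * b) = (l f - r f) * (d * a) := by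
  rw [h.A6, sub_mul, map_mul, mul_assoc, h.A8]; noncomm_ring
theorem Good.bc2 (h : Good l r f e a b c d) (hs : f + e = s) (hs' : l s = r s) : b * c - l (f * e) * (c * b) = (l f - r f) * (a * d) := by
  have k1 : l f = l s - l e := by rw [← map_sub, ← hs]; simp
  have k2 : r f = r s - r e := by rw [← map_sub, ← hs]; simp
  have : l f - r f = r e - l e := by rw [k1, k2, hs']; noncomm_ring
  rw [this, h.A7, sub_mul, mul_comm f e, map_mul, mul_assoc, h.A5]; noncomm_ring
theorem Good.mk' 
  (A1 : a * c = l f * (c * a))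
  (A2 : b * d = l f * (d * b))
  (A3 : b * a = r e * (a * b))
  (A4 : d * c = r e * (c * d))
  (A5 : a * d - l f * (c * b) = 1)
  (ad1 : a * d - d * a = (l f - r e) * (c * b))
  (bc1 : b * c - r (f * e) * (c * b) = (l f - r f) * (d * a))
  (bc2 : b * c - l (f * e) * (c * b) = (l f - r f) * (a * d)) (hs : f + e = s) (hs' : l s = r s)
  : Good l r f e a b c d := by
  have k1 : l f = l s - l e := by rw [← map_sub, ← hs]; simp
  have k2 : r f = r s - r e := by rw [← map_sub, ← hs]; simp
  have k : l f - r f = r e - l e := by rw [k1, k2, hs']; noncomm_ring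
  have A5' : a * d = l f * (c * b) + 1 := by rw [← A5]; noncomm_ring
  have A8 : d * a = r e * (c * b) + 1 := by
    have : d * a = a * d - (l f - r e) * (c * b) := by rw [← ad1]; noncomm_ring
    rw [this, A5']; noncomm_ring
  refine ⟨A1, A2, A3, A4, A5', ?_, ?_, A8⟩
  · have : b * c = (l f - r f) * (d * a) + r (f * e) * (c * b) := by rw [← bc1]; noncomm_ring
    have h2 : r f * (r e * (c * b)) = r f * (d * a) - r f := by rw [A8]; noncomm_ring
    rw [this, map_mul, mul_assoc, h2]; noncomm_ring
  · have : b * c = (l f - r f) * (a * d) + l (f * e) * (c * b) := by rw [← bc2]; noncomm_ring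
    have h2 : l e * (l f * (c * b)) = l e * (a * d) - l e := by rw [A5']; noncomm_ring
    rw [this, k, mul_comm f e, map_mul, mul_assoc, h2]; noncomm_ring

end

/-- The generators `α, β, γ, δ, f(λ), f(μ)`. -/
inductive Gen : Type
  | a | b | c | d
  | l (f : Mer)
  | r (f : Mer)

namespace Gen
/-- `α` in the free algebra. -/
def fa : FreeAlgebra ℂ Gen := FreeAlgebra.ι ℂ Gen.a
/-- `β` in the free algebra. -/
def fb : FreeAlgebra ℂ Gen := FreeAlgebra.ι ℂ Gen.b
/-- `γ` in the free algebra. -/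
def fc : FreeAlgebra ℂ Gen := FreeAlgebra.ι ℂ Gen.c
/-- `δ` in the free algebra. -/
def fd : FreeAlgebra ℂ Gen := FreeAlgebra.ι ℂ Gen.d
/-- `f(λ)` in the free algebra. -/
def fl (f : Mer) : FreeAlgebra ℂ Gen := FreeAlgebra.ι ℂ (Gen.l f)
/-- `f(μ)` in the free algebra. -/
def fr (f : Mer) : FreeAlgebra ℂ Gen := FreeAlgebra.ι ℂ (Gen.r f)
end Gen

open Gen in
/-- The defining relations of `F_R(SL(2))`. -/
inductive Rel (q : ℝ) : FreeAlgebra ℂ Gen → FreeAlgebra ℂ Gen → Prop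
  -- `f ↦ f(λ)` and `f ↦ f(μ)` are algebra homomorphisms with commuting images
  | l_const (z : ℂ) : Rel q (fl (algebraMap ℂ Mer z)) (algebraMap ℂ _ z)
  | l_add (f g : Mer) : Rel q (fl (f + g)) (fl f + fl g)
  | l_mul (f g : Mer) : Rel q (fl (f * g)) (fl f * fl g)
  | r_const (z : ℂ) : Rel q (fr (algebraMap ℂ Mer z)) (algebraMap ℂ _ z)
  | r_add (f g : Mer) : Rel q (fr (f + g)) (fr f + fr g)
  | r_mul (f g : Mer) : Rel q (fr (f * g)) (fr f * fr g)
  | lr_comm (f g : Mer) : Rel q (fl f * fr g) (fr g * fl f)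
  -- commutation of the dynamical variables with the generators
  | l_a (f : Mer) : Rel q (fl f * fa) (fa * fl (Mer.shift 1 f))
  | r_a (f : Mer) : Rel q (fr f * fa) (fa * fr (Mer.shift 1 f))
  | l_b (f : Mer) : Rel q (fl f * fb) (fb * fl (Mer.shift 1 f))
  | r_b (f : Mer) : Rel q (fr f * fb) (fb * fr (Mer.shift (-1) f))
  | l_c (f : Mer) : Rel q (fl f * fc) (fc * fl (Mer.shift (-1) f))
  | r_c (f : Mer) : Rel q (fr f * fc) (fc * fr (Mer.shift 1 f))
  | l_d (f : Mer) : Rel q (fl f * fd) (fd * fl (Mer.shift (-1) f))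
  | r_d (f : Mer) : Rel q (fr f * fd) (fd * fr (Mer.shift (-1) f))
  -- the quadratic relations
  | ab : Rel q (fa * fb) ((q : ℂ) • (fr (Mer.shift (-1) (funF q)) * (fb * fa)))
  | ac : Rel q (fa * fc) ((q : ℂ) • (fl (funF q) * (fc * fa)))
  | bd : Rel q (fb * fd) ((q : ℂ) • (fl (funF q) * (fd * fb)))
  | cd : Rel q (fc * fd) ((q : ℂ) • (fr (Mer.shift (-1) (funF q)) * (fd * fc)))
  | ad₁ : Rel q (fa * fd - fd * fa) (funH q fl fr * (fc * fb))
  | ad₂ : Rel q (fr (funG q) * (fa * fd) - fl (funG q) * (fd * fa)) (funH q fl fr * (fb * fc))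
  | bc₁ : Rel q (fb * fc - fr (funG q) * (fc * fb)) (funI q fl fr * (fd * fa))
  | bc₂ : Rel q (fb * fc - fl (funG q) * (fc * fb)) (funI q fl fr * (fa * fd))
  -- the determinant relation
  | det : Rel q (fa * fd - (q : ℂ) • (fl (funF q) * (fc * fb))) 1

/-- The algebra `F_R(SL(2))`: generated by `α, β, γ, δ` and two commuting copies `f(λ)`, `f(μ)` of
the field of meromorphic functions, subject to the relations `Rel`. -/
def FRSL2 (q : ℝ) : Type := RingQuot (Rel q)

/-- The ring structure of `FRSL2 q`. -/
def FRSL2.ring (q : ℝ) : Ring (FRSL2 q) := RingQuot.instRing (Rel q)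
instance (q : ℝ) : Ring (FRSL2 q) := FRSL2.ring q

/-- The algebra structure of `FRSL2 q`. -/
def FRSL2.algebra (q : ℝ) : Algebra ℂ (FRSL2 q) := RingQuot.instAlgebra (Rel q)
instance (q : ℝ) : Algebra ℂ (FRSL2 q) := FRSL2.algebra q


namespace FRSL2
variable (q : ℝ)

/-- The quotient map from the free algebra. -/
def proj : FreeAlgebra ℂ Gen →ₐ[ℂ] FRSL2 q := RingQuot.mkAlgHom ℂ (Rel q)

theorem proj_rel {q : ℝ} {x y : FreeAlgebra ℂ Gen} (h : Rel q x y) : proj q x = proj q y :=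
  RingQuot.mkAlgHom_rel ℂ h

/-- The generator `α`. -/
def α : FRSL2 q := proj q Gen.fa
/-- The generator `β`. -/
def β : FRSL2 q := proj q Gen.fb
/-- The generator `γ`. -/
def γ : FRSL2 q := proj q Gen.fc
/-- The generator `δ`. -/
def δ : FRSL2 q := proj q Gen.fd

/-- The left moment map `f ↦ f(λ)`. -/
def μl : Mer →ₐ[ℂ] FRSL2 q where
  toFun f := proj q (Gen.fl f)
  map_one' := by
    have := proj_rel (Rel.l_const (q := q) 1)
    simpa using this
  map_mul' f g := by rw [proj_rel (Rel.l_mul f g), map_mul]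
  map_zero' := by
    have := proj_rel (Rel.l_const (q := q) 0)
    simpa using this
  map_add' f g := by rw [proj_rel (Rel.l_add f g), map_add]
  commutes' z := by rw [proj_rel (Rel.l_const z), AlgHom.commutes]

/-- The right moment map `f ↦ f(μ)`. -/
def μr : Mer →ₐ[ℂ] FRSL2 q where
  toFun f := proj q (Gen.fr f)
  map_one' := by
    have := proj_rel (Rel.r_const (q := q) 1)
    simpa using this
  map_mul' f g := by rw [proj_rel (Rel.r_mul f g), map_mul]
  map_zero' := by
    have := proj_rel (Rel.r_const (q := q) 0)
    simpa using this
  map_add' f g := by rw [proj_rel (Rel.r_add f g), map_add]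
  commutes' z := by rw [proj_rel (Rel.r_const z), AlgHom.commutes]

theorem μl_μr_commute (f g : Mer) : Commute (μl q f) (μr q g) := by
  have := proj_rel (Rel.lr_comm (q := q) f g)
  rwa [map_mul, map_mul] at this

/-- The map `M ⊗ M → F_R(SL(2))`, `f ⊗ g ↦ f(λ) g(μ)`, which attaches to a function `h(λ, μ)` the
corresponding element. -/
def coef : Mer ⊗[ℂ] Mer →ₐ[ℂ] FRSL2 q :=
  Algebra.TensorProduct.lift (μl q) (μr q) (μl_μr_commute q)

/-- The elements of bidegree `(m, n)`: `α, β, γ, δ` have bidegrees `(1, 1)`, `(1, -1)`, `(-1, 1)`,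
`(-1, -1)`, and the functions `f(λ)`, `f(μ)` have bidegree `(0, 0)`. -/
inductive IsHomog : ℤ → ℤ → FRSL2 q → Prop
  | zero (m n : ℤ) : IsHomog m n 0
  | one : IsHomog 0 0 1
  | a : IsHomog 1 1 (α q)
  | b : IsHomog 1 (-1) (β q)
  | c : IsHomog (-1) 1 (γ q)
  | d : IsHomog (-1) (-1) (δ q)
  | l (f : Mer) : IsHomog 0 0 (μl q f)
  | r (f : Mer) : IsHomog 0 0 (μr q f)
  | add {m n : ℤ} {x y : FRSL2 q} : IsHomog m n x → IsHomog m n y → IsHomog m n (x + y)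
  | mul {m n m' n' : ℤ} {x y : FRSL2 q} : IsHomog m n x → IsHomog m' n' y →
      IsHomog (m + m') (n + n') (x * y)

/-- The component `A_{mn}` of bidegree `(m, n)` of `A = F_R(SL(2))`. -/
def grade (m n : ℤ) : Submodule ℂ (FRSL2 q) where
  carrier := {x | IsHomog q m n x}
  zero_mem' := .zero m n
  add_mem' := .add
  smul_mem' z x hx := by
    have := (IsHomog.l (algebraMap ℂ Mer z)).mul hx
    rwa [AlgHom.commutes, ← Algebra.smul_def, zero_add, zero_add] at this

theorem IsHomog.pow {q : ℝ} {m n : ℤ} {x : FRSL2 q} (h : IsHomog q m n x) (k : ℕ) :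
    IsHomog q (k * m) (k * n) (x ^ k) := by
  induction k with
  | zero => simpa using IsHomog.one
  | succ k ih =>
    have := ih.mul h
    rw [← pow_succ] at this
    convert this using 1 <;> push_cast <;> ring

/-- The sum over all `m` of the components `A_{mn}`. -/
def rightGrade (n : ℤ) : Submodule ℂ (FRSL2 q) := ⨆ m : ℤ, grade q m n

/-- The subalgebra `⊕ A_{mn} ⊗ A_{np}` of the complex algebra `A ⊗ A`. -/
def matched : Subalgebra ℂ (FRSL2 q ⊗[ℂ] FRSL2 q) :=
  Algebra.adjoin ℂ {x | ∃ m n p : ℤ, ∃ a ∈ grade q m n, ∃ b ∈ grade q n p, x = a ⊗ₜ[ℂ] b}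

variable {q} in
theorem tmul_mem_matched {n p : ℤ} {a b : FRSL2 q} (ha : a ∈ rightGrade q n)
    (hb : b ∈ grade q n p) : a ⊗ₜ[ℂ] b ∈ matched q := by
  refine Submodule.iSup_induction _ (motive := fun a => a ⊗ₜ[ℂ] b ∈ matched q) ha ?_ ?_ ?_
  · exact fun m x hx => Algebra.subset_adjoin ⟨m, n, p, x, hx, b, hb, rfl⟩
  · rw [TensorProduct.zero_tmul]; exact zero_mem _
  · intro x y hx hy
    rw [TensorProduct.add_tmul]; exact add_mem hx hy

variable {q} in
theorem hmem {m n p : ℤ} {a b : FRSL2 q} (ha : IsHomog q m n a)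
    (hb : IsHomog q n p b) : a ⊗ₜ[ℂ] b ∈ matched q :=
  Algebra.subset_adjoin ⟨m, n, p, a, ha, b, hb, rfl⟩

/-- The relation `f(μ) ⊗ 1 = 1 ⊗ f(λ)`. In `⊕ A_{mn} ⊗ A_{np}` one has
`(a ⊗ b) (f(μ) ⊗ 1 - 1 ⊗ f(λ)) = (g(μ) ⊗ 1 - 1 ⊗ g(λ)) (a ⊗ b)` with `g(z) = f(z - n)`, so the ideal
generated by these relations is the span of the elements `f(μ) a ⊗ b - a ⊗ f(λ) b`. -/
inductive MatRel : matched q → matched q → Prop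
  | mk (f : Mer) : MatRel ⟨μr q f ⊗ₜ 1, hmem (.r f) .one⟩ ⟨1 ⊗ₜ μl q f, hmem .one (.l f)⟩

/-- The matrix tensor product of `A` with itself: the algebra `⊕ A_{mn} ⊗ A_{np}` modulo
`f(μ) a ⊗ b = a ⊗ f(λ) b`. -/
def Mat : Type := RingQuot (MatRel q)

/-- The ring structure of `Mat q`. -/
def Mat.ring : Ring (Mat q) := RingQuot.instRing (MatRel q)
instance : Ring (Mat q) := Mat.ring q

/-- The algebra structure of `Mat q`. -/
def Mat.algebra : Algebra ℂ (Mat q) := RingQuot.instAlgebra (MatRel q)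
instance : Algebra ℂ (Mat q) := Mat.algebra q

/-- The quotient map onto the matrix tensor product. -/
def matProj : matched q →ₐ[ℂ] Mat q := RingQuot.mkAlgHom ℂ (MatRel q)

variable {q} in
/-- The element `a ⊗ b` of the matrix tensor product. -/
def mtmul (a b : FRSL2 q) (h : a ⊗ₜ[ℂ] b ∈ matched q) : Mat q := matProj q ⟨a ⊗ₜ b, h⟩

/-- Values of the coproduct on the generators. -/
def comulGen : Gen → Mat q
  | .a => mtmul (α q) (α q) (hmem .a .a) + mtmul (β q) (γ q) (hmem .b .c)
  | .b => mtmul (α q) (β q) (hmem .a .b) + mtmul (β q) (δ q) (hmem .b .d)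
  | .c => mtmul (γ q) (α q) (hmem .c .a) + mtmul (δ q) (γ q) (hmem .d .c)
  | .d => mtmul (γ q) (β q) (hmem .c .b) + mtmul (δ q) (δ q) (hmem .d .d)
  | .l f => mtmul (μl q f) 1 (hmem (.l f) .one)
  | .r f => mtmul 1 (μr q f) (hmem .one (.r f))


theorem good (h0 : 0 < q) (h1 : q < 1) :
    Good (μl q : Mer →+* FRSL2 q) (μr q : Mer →+* FRSL2 q) (cf q) (ce q)
      (α q) (β q) (γ q) (δ q) := by
  have hH : proj q (funH q Gen.fl Gen.fr) = μl q (cf q) - μr q (ce q) := by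
    rw [← funH_eq q h0 h1 _ _ (μl_μr_commute q)]
    simp only [funH, map_smul, map_mul, map_sub, map_one]; rfl
  have hI : proj q (funI q Gen.fl Gen.fr) = μl q (cf q) - μr q (cf q) := by
    rw [← funI_eq q h0 h1 _ _ (μl_μr_commute q)]
    simp only [funI, map_smul, map_mul, map_sub]; rfl
  have hF := shift_funF_ne_zero q h0 h1
  have hq := q_ne_zero q h0
  have hE : ∀ X Y : FRSL2 q, X = (q : ℂ) • (μr q (Mer.shift (-1) (funF q)) * Y) →
      Y = μr q (ce q) * X := by
    rintro X Y rfl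
    rw [ce, map_smul, smul_mul_smul_comm, inv_mul_cancel₀ hq, one_smul, ← mul_assoc, ← map_mul,
      inv_mul_cancel₀ hF, map_one, one_mul]
  refine Good.mk' (s := algebraMap ℂ Mer ((q : ℂ) + (q : ℂ)⁻¹)) ?_ ?_ ?_ ?_ ?_ ?_ ?_ ?_
    (cf_add_ce q h0 h1)
    (((μl q).commutes _).trans ((μr q).commutes _).symm)
  · have h := proj_rel (Rel.ac (q := q))
    simp only [map_smul, map_mul] at h
    rw [cf, AlgHom.coe_toRingHom, map_smul, smul_mul_assoc]; exact h
  · have h := proj_rel (Rel.bd (q := q))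
    simp only [map_smul, map_mul] at h
    rw [cf, AlgHom.coe_toRingHom, map_smul, smul_mul_assoc]; exact h
  · have h := proj_rel (Rel.ab (q := q))
    simp only [map_smul, map_mul] at h
    exact hE _ _ h
  · have h := proj_rel (Rel.cd (q := q))
    simp only [map_smul, map_mul] at h
    exact hE _ _ h
  · have h := proj_rel (Rel.det (q := q))
    simp only [map_smul, map_mul, map_sub, map_one] at h
    rw [cf, AlgHom.coe_toRingHom, map_smul, smul_mul_assoc]; exact h
  · have h := proj_rel (Rel.ad₁ (q := q))
    simp only [map_mul, map_sub] at h
    rw [hH] at h; exact h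
  · have h := proj_rel (Rel.bc₁ (q := q))
    simp only [map_mul, map_sub] at h
    rw [hI, funG_eq q h0 h1] at h; exact h
  · have h := proj_rel (Rel.bc₂ (q := q))
    simp only [map_mul, map_sub] at h
    rw [hI, funG_eq q h0 h1] at h; exact h


section Mat
variable {q}

theorem mtmul_add_left {a a' b : FRSL2 q} (h : a ⊗ₜ[ℂ] b ∈ matched q)
    (h' : a' ⊗ₜ[ℂ] b ∈ matched q) (h'' : (a + a') ⊗ₜ[ℂ] b ∈ matched q) :
    mtmul (a + a') b h'' = mtmul a b h + mtmul a' b h' := by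
  rw [mtmul, mtmul, mtmul, ← map_add]
  exact congrArg (matProj q) (Subtype.ext (TensorProduct.add_tmul _ _ _))

theorem mtmul_add_right {a b b' : FRSL2 q} (h : a ⊗ₜ[ℂ] b ∈ matched q)
    (h' : a ⊗ₜ[ℂ] b' ∈ matched q) (h'' : a ⊗ₜ[ℂ] (b + b') ∈ matched q) :
    mtmul a (b + b') h'' = mtmul a b h + mtmul a b' h' := by
  rw [mtmul, mtmul, mtmul, ← map_add]
  exact congrArg (matProj q) (Subtype.ext (TensorProduct.tmul_add _ _ _))

theorem mul_mem_matched {a b c d : FRSL2 q} (h : a ⊗ₜ[ℂ] b ∈ matched q)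
    (h' : c ⊗ₜ[ℂ] d ∈ matched q) : (a * c) ⊗ₜ[ℂ] (b * d) ∈ matched q := by
  rw [← Algebra.TensorProduct.tmul_mul_tmul]; exact mul_mem h h'

theorem mtmul_mul {a b c d : FRSL2 q} (h : a ⊗ₜ[ℂ] b ∈ matched q)
    (h' : c ⊗ₜ[ℂ] d ∈ matched q) :
    mtmul a b h * mtmul c d h' = mtmul (a * c) (b * d) (mul_mem_matched h h') := by
  rw [mtmul, mtmul, mtmul, ← map_mul]
  exact congrArg (matProj q) (Subtype.ext (Algebra.TensorProduct.tmul_mul_tmul _ _ _ _))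

theorem mtmul_congr {a b a' b' : FRSL2 q} (h : a ⊗ₜ[ℂ] b ∈ matched q) (ha : a = a')
    (hb : b = b') : mtmul a b h = mtmul a' b' (ha ▸ hb ▸ h) := by
  subst ha hb; rfl

theorem mtmul_one_one (h : (1 : FRSL2 q) ⊗ₜ[ℂ] (1 : FRSL2 q) ∈ matched q) :
    mtmul 1 1 h = (1 : Mat q) := (map_one (matProj q))

variable (q) in
/-- `f(λ) ⊗ 1` -/
def Xl : Mer →ₐ[ℂ] Mat q where
  toFun f := mtmul (μl q f) 1 (hmem (.l f) .one)
  map_one' := (mtmul_congr _ (map_one _) rfl).trans (mtmul_one_one _)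
  map_mul' f g := by
    rw [mtmul_mul]; exact mtmul_congr _ (map_mul _ _ _) (mul_one _).symm
  map_zero' := by
    have : (⟨μl q 0 ⊗ₜ 1, hmem (.l 0) .one⟩ : matched q) = 0 :=
      Subtype.ext (by simp)
    rw [mtmul, this, map_zero]
  map_add' f g := by
    rw [← mtmul_add_left _ _ (by rw [← map_add]; exact hmem (.l (f + g)) .one)]
    exact mtmul_congr _ (map_add _ _ _) rfl
  commutes' z := by
    rw [← AlgHom.commutes (matProj q)]
    exact congrArg (matProj q) (Subtype.ext
      ((congrArg (· ⊗ₜ[ℂ] (1 : FRSL2 q)) (AlgHom.commutes (μl q) z)).trans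
        (Algebra.TensorProduct.algebraMap_apply z).symm))

variable (q) in
/-- `1 ⊗ f(μ)` -/
def Zr : Mer →ₐ[ℂ] Mat q where
  toFun f := mtmul 1 (μr q f) (hmem .one (.r f))
  map_one' := (mtmul_congr _ rfl (map_one _)).trans (mtmul_one_one _)
  map_mul' f g := by
    rw [mtmul_mul]; exact mtmul_congr _ (mul_one _).symm (map_mul _ _ _)
  map_zero' := by
    have : (⟨1 ⊗ₜ μr q 0, hmem .one (.r 0)⟩ : matched q) = 0 :=
      Subtype.ext (by simp)
    rw [mtmul, this, map_zero]
  map_add' f g := by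
    rw [← mtmul_add_right _ _ (by rw [← map_add]; exact hmem .one (.r (f + g)))]
    exact mtmul_congr _ rfl (map_add _ _ _)
  commutes' z := by
    rw [← AlgHom.commutes (matProj q)]
    exact congrArg (matProj q) (Subtype.ext
      ((congrArg ((1 : FRSL2 q) ⊗ₜ[ℂ] ·) (AlgHom.commutes (μr q) z)).trans
        (Algebra.TensorProduct.algebraMap_apply' z).symm))

theorem Xl_Zr_commute (f g : Mer) : Commute (Xl q f) (Zr q g) := by
  change mtmul _ _ _ * mtmul _ _ _ = mtmul _ _ _ * mtmul _ _ _
  rw [mtmul_mul, mtmul_mul]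
  exact mtmul_congr _ (by rw [mul_one, one_mul]) (by rw [mul_one, one_mul])

open Classical in
/-- `a ⊗ b` if it makes sense and `0` otherwise -/
def pt (a b : FRSL2 q) : Mat q := if h : a ⊗ₜ[ℂ] b ∈ matched q then mtmul a b h else 0

theorem pt_eq {a b : FRSL2 q} (h : a ⊗ₜ[ℂ] b ∈ matched q) : mtmul a b h = pt a b := by
  rw [pt, dif_pos h]

theorem pt_mul {a b c d : FRSL2 q} (h : a ⊗ₜ[ℂ] b ∈ matched q)
    (h' : c ⊗ₜ[ℂ] d ∈ matched q) : pt a b * pt c d = pt (a * c) (b * d) := by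
  rw [← pt_eq h, ← pt_eq h', mtmul_mul, pt_eq]

theorem pt_add_left {a a' b : FRSL2 q} (h : a ⊗ₜ[ℂ] b ∈ matched q)
    (h' : a' ⊗ₜ[ℂ] b ∈ matched q) : pt (a + a') b = pt a b + pt a' b := by
  have h'' : (a + a') ⊗ₜ[ℂ] b ∈ matched q := by rw [TensorProduct.add_tmul]; exact add_mem h h'
  rw [← pt_eq h, ← pt_eq h', ← pt_eq h'', mtmul_add_left]

theorem pt_add_right {a b b' : FRSL2 q} (h : a ⊗ₜ[ℂ] b ∈ matched q)
    (h' : a ⊗ₜ[ℂ] b' ∈ matched q) : pt a (b + b') = pt a b + pt a b' := by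
  have h'' : a ⊗ₜ[ℂ] (b + b') ∈ matched q := by rw [TensorProduct.tmul_add]; exact add_mem h h'
  rw [← pt_eq h, ← pt_eq h', ← pt_eq h'', mtmul_add_right]

theorem pt_sub_left {a a' b : FRSL2 q} (h : a ⊗ₜ[ℂ] b ∈ matched q)
    (h' : a' ⊗ₜ[ℂ] b ∈ matched q) : pt (a - a') b = pt a b - pt a' b := by
  have h'' : (a - a') ⊗ₜ[ℂ] b ∈ matched q := by rw [TensorProduct.sub_tmul]; exact sub_mem h h'
  rw [eq_sub_iff_add_eq, ← pt_add_left h'' h', sub_add_cancel]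

theorem pt_sub_right {a b b' : FRSL2 q} (h : a ⊗ₜ[ℂ] b ∈ matched q)
    (h' : a ⊗ₜ[ℂ] b' ∈ matched q) : pt a (b - b') = pt a b - pt a b' := by
  have h'' : a ⊗ₜ[ℂ] (b - b') ∈ matched q := by rw [TensorProduct.tmul_sub]; exact sub_mem h h'
  rw [eq_sub_iff_add_eq, ← pt_add_right h'' h', sub_add_cancel]

theorem pt_one_one : pt (1 : FRSL2 q) 1 = 1 := by
  rw [← pt_eq (hmem .one .one), mtmul_one_one]

theorem pt_Xl (f : Mer) {a b : FRSL2 q} (h : a ⊗ₜ[ℂ] b ∈ matched q) :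
    pt (μl q f * a) b = Xl q f * pt a b := by
  have := pt_mul (hmem (.l f) .one : (μl q f) ⊗ₜ[ℂ] (1 : FRSL2 q) ∈ matched q) h
  rw [one_mul] at this
  rw [← this, ← pt_eq (hmem (.l f) .one)]; rfl

theorem pt_Zr (f : Mer) {a b : FRSL2 q} (h : a ⊗ₜ[ℂ] b ∈ matched q) :
    pt a (μr q f * b) = Zr q f * pt a b := by
  have := pt_mul (hmem .one (.r f) : (1 : FRSL2 q) ⊗ₜ[ℂ] (μr q f) ∈ matched q) h
  rw [one_mul] at this
  rw [← this, ← pt_eq (hmem .one (.r f))]; rfl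

theorem pt_swap (f : Mer) {a b : FRSL2 q} (h : a ⊗ₜ[ℂ] b ∈ matched q) :
    pt (μr q f * a) b = pt a (μl q f * b) := by
  have h1 := pt_mul (hmem (.r f) .one : (μr q f) ⊗ₜ[ℂ] (1 : FRSL2 q) ∈ matched q) h
  have h2 := pt_mul (hmem .one (.l f) : (1 : FRSL2 q) ⊗ₜ[ℂ] (μl q f) ∈ matched q) h
  rw [one_mul] at h1 h2
  rw [← h1, ← h2, ← pt_eq (hmem (.r f) .one), ← pt_eq (hmem .one (.l f))]
  congr 1
  exact RingQuot.mkAlgHom_rel ℂ (MatRel.mk f)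

theorem IsHomog.mul' {m n m' n' M N : ℤ} {x y : FRSL2 q} (hx : IsHomog q m n x)
    (hy : IsHomog q m' n' y) (h : m + m' = M) (h' : n + n' = N) : IsHomog q M N (x * y) := by
  subst h h'; exact hx.mul hy

theorem comulGen_a : comulGen q .a = pt (α q) (α q) + pt (β q) (γ q) := by
  simp only [← pt_eq (hmem .a .a), ← pt_eq (hmem .b .c)]; rfl
theorem comulGen_b : comulGen q .b = pt (α q) (β q) + pt (β q) (δ q) := by
  simp only [← pt_eq (hmem .a .b), ← pt_eq (hmem .b .d)]; rfl
theorem comulGen_c : comulGen q .c = pt (γ q) (α q) + pt (δ q) (γ q) := by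
  simp only [← pt_eq (hmem .c .a), ← pt_eq (hmem .d .c)]; rfl
theorem comulGen_d : comulGen q .d = pt (γ q) (β q) + pt (δ q) (δ q) := by
  simp only [← pt_eq (hmem .c .b), ← pt_eq (hmem .d .d)]; rfl

/-- The values of the coproduct on the generators satisfy the relations in compact form. -/
theorem good_comul (h0 : 0 < q) (h1 : q < 1) :
    Good (Xl q : Mer →+* Mat q) (Zr q : Mer →+* Mat q) (cf q) (ce q)
      (comulGen q .a) (comulGen q .b) (comulGen q .c) (comulGen q .d) := by
  have G := good q h0 h1
  rw [comulGen_a, comulGen_b, comulGen_c, comulGen_d]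
  obtain ⟨A1, A2, A3, A4, A5, A6, A7, A8⟩ := G
  simp only [AlgHom.coe_toRingHom] at A1 A2 A3 A4 A5 A6 A7 A8
  have m {m n p m' n' p' : ℤ} {a b c d : FRSL2 q} (ha : IsHomog q m n a) (hb : IsHomog q n p b)
      (hc : IsHomog q m' n' c) (hd : IsHomog q n' p' d) :
      pt a b * pt c d = pt (a * c) (b * d) := pt_mul (hmem ha hb) (hmem hc hd)
  have haa : IsHomog q 2 2 (α q * α q) := .mul' .a .a rfl rfl
  have hab : IsHomog q 2 0 (α q * β q) := .mul' .a .b rfl rfl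
  have hac : IsHomog q 0 2 (α q * γ q) := .mul' .a .c rfl rfl
  have had : IsHomog q 0 0 (α q * δ q) := .mul' .a .d rfl rfl
  have hba : IsHomog q 2 0 (β q * α q) := .mul' .b .a rfl rfl
  have hbb : IsHomog q 2 (-2) (β q * β q) := .mul' .b .b rfl rfl
  have hbc : IsHomog q 0 0 (β q * γ q) := .mul' .b .c rfl rfl
  have hbd : IsHomog q 0 (-2) (β q * δ q) := .mul' .b .d rfl rfl
  have hca : IsHomog q 0 2 (γ q * α q) := .mul' .c .a rfl rfl
  have hcb : IsHomog q 0 0 (γ q * β q) := .mul' .c .b rfl rfl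
  have hcc : IsHomog q (-2) 2 (γ q * γ q) := .mul' .c .c rfl rfl
  have hcd : IsHomog q (-2) 0 (γ q * δ q) := .mul' .c .d rfl rfl
  have hda : IsHomog q 0 0 (δ q * α q) := .mul' .d .a rfl rfl
  have hdb : IsHomog q 0 (-2) (δ q * β q) := .mul' .d .b rfl rfl
  have hdc : IsHomog q (-2) 0 (δ q * γ q) := .mul' .d .c rfl rfl
  have hdd : IsHomog q (-2) (-2) (δ q * δ q) := .mul' .d .d rfl rfl
  have hl {m n : ℤ} {b : FRSL2 q} (f : Mer) (hb : IsHomog q m n b) : IsHomog q m n (μl q f * b) :=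
    .mul' (.l f) hb (zero_add _) (zero_add _)
  have hr {m n : ℤ} {b : FRSL2 q} (f : Mer) (hb : IsHomog q m n b) : IsHomog q m n (μr q f * b) :=
    .mul' (.r f) hb (zero_add _) (zero_add _)
  have L1 {p : ℤ} {b : FRSL2 q} (hb : IsHomog q 2 p b) :
      pt (α q * γ q) b = Xl q (cf q) * pt (γ q * α q) b := by
    rw [A1, pt_Xl _ (hmem hca hb)]
  have L2 {p : ℤ} {b : FRSL2 q} (hb : IsHomog q (-2) p b) :
      pt (β q * δ q) b = Xl q (cf q) * pt (δ q * β q) b := by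
    rw [A2, pt_Xl _ (hmem hdb hb)]
  have L3 {p : ℤ} {b : FRSL2 q} (hb : IsHomog q 0 p b) :
      pt (α q * δ q) b = Xl q (cf q) * pt (γ q * β q) b + pt 1 b := by
    rw [A5, pt_add_left (hmem (hl _ hcb) hb) (hmem .one hb), pt_Xl _ (hmem hcb hb)]
  have L4 {p : ℤ} {b : FRSL2 q} (hb : IsHomog q 0 p b) :
      pt (β q * γ q) b = Xl q (cf q) * pt (δ q * α q) b - pt 1 (μl q (cf q) * b) := by
    rw [A6, pt_sub_left (hmem (hl _ hda) hb) (hmem (.r _) hb), pt_Xl _ (hmem hda hb),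
      ← pt_swap _ (hmem .one hb), mul_one]
  have R1 {p : ℤ} {a : FRSL2 q} (ha : IsHomog q p 2 a) :
      pt a (β q * α q) = Zr q (ce q) * pt a (α q * β q) := by
    rw [A3, pt_Zr _ (hmem ha hab)]
  have R2 {p : ℤ} {a : FRSL2 q} (ha : IsHomog q p (-2) a) :
      pt a (δ q * γ q) = Zr q (ce q) * pt a (γ q * δ q) := by
    rw [A4, pt_Zr _ (hmem ha hcd)]
  have R3 {p : ℤ} {a : FRSL2 q} (ha : IsHomog q p 0 a) :
      pt a (δ q * α q) = Zr q (ce q) * pt a (γ q * β q) + pt a 1 := by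
    rw [A8, pt_add_right (hmem ha (hr _ hcb)) (hmem ha .one), pt_Zr _ (hmem ha hcb)]
  have R4 {p : ℤ} {a : FRSL2 q} (ha : IsHomog q p 0 a) :
      pt a (β q * γ q) = Zr q (ce q) * pt a (α q * δ q) - pt (μr q (ce q) * a) 1 := by
    rw [A7, pt_sub_right (hmem ha (hr _ had)) (hmem ha (.l _)), pt_Zr _ (hmem ha had),
      pt_swap _ (hmem ha .one), mul_one]
  have P1 : pt (1 : FRSL2 q) (μr q (cf q)) = Zr q (cf q) := pt_eq _ |>.symm
  have P2 : pt (μl q (ce q)) (1 : FRSL2 q) = Xl q (ce q) := pt_eq _ |>.symm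
  constructor <;> simp only [AlgHom.coe_toRingHom, mul_add, add_mul]
  · rw [m .a .a .c .a, m .a .a .d .c, m .b .c .c .a, m .b .c .d .c,
      m .c .a .a .a, m .c .a .b .c, m .d .c .a .a, m .d .c .b .c,
      L1 haa, L2 hcc, L3 hac, L4 hca, ← A1]
    abel
  · rw [m .a .b .c .b, m .a .b .d .d, m .b .d .c .b, m .b .d .d .d,
      m .c .b .a .b, m .c .b .b .d, m .d .d .a .b, m .d .d .b .d,
      L1 hbb, L2 hdd, L3 hbd, L4 hdb, ← A2]
    abel
  · rw [m .a .b .a .a, m .a .b .b .c, m .b .d .a .a, m .b .d .b .c,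
      m .a .a .a .b, m .a .a .b .d, m .b .c .a .b, m .b .c .b .d,
      R1 haa, R2 hbb, R4 hab, R3 hba, ← A3]
    abel
  · rw [m .c .b .c .a, m .c .b .d .c, m .d .d .c .a, m .d .d .d .c,
      m .c .a .c .b, m .c .a .d .d, m .d .c .c .b, m .d .c .d .d,
      R1 hcc, R2 hdd, R4 hcd, R3 hdc, ← A4]
    abel
  · rw [m .a .a .c .b, m .a .a .d .d, m .b .c .c .b, m .b .c .d .d,
      m .c .a .a .b, m .c .a .b .d, m .d .c .a .b, m .d .c .b .d,
      L1 hab, L2 hcd, L3 had, L4 hcb, A5, pt_add_right (hmem .one (hl _ hcb)) (hmem .one .one),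
      pt_one_one]
    abel
  · rw [m .a .b .c .a, m .a .b .d .c, m .b .d .c .a, m .b .d .d .c,
      m .c .b .a .a, m .c .b .b .c, m .d .d .a .a, m .d .d .b .c,
      L1 hba, L2 hdc, L3 hbc, L4 hda, ← P1]
    have h : pt 1 (β q * γ q) = pt 1 (μl q (cf q) * (δ q * α q)) - pt 1 (μr q (cf q)) := by
      rw [A6, pt_sub_right (hmem .one (hl _ hda)) (hmem .one (.r _))]
    rw [h]
    abel
  · rw [m .a .b .c .a, m .a .b .d .c, m .b .d .c .a, m .b .d .d .c,
      m .a .a .c .b, m .a .a .d .d, m .b .c .c .b, m .b .c .d .d,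
      R1 hac, R2 hbd, R4 had, R3 hbc, ← P2]
    have h : pt (β q * γ q) 1 = pt (μr q (ce q) * (α q * δ q)) 1 - pt (μl q (ce q)) 1 := by
      rw [A7, pt_sub_left (hmem (hr _ had) .one) (hmem (.l _) .one)]
    rw [h]
    abel
  · rw [m .c .b .a .a, m .c .b .b .c, m .d .d .a .a, m .d .d .b .c,
      m .c .a .a .b, m .c .a .b .d, m .d .c .a .b, m .d .c .b .d,
      R1 hca, R2 hdb, R4 hcb, R3 hda]
    have h : pt (δ q * α q) 1 = pt (μr q (ce q) * (γ q * β q)) 1 + 1 := by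
      rw [A8, pt_add_left (hmem (hr _ hcb) .one) (hmem .one .one), pt_one_one]
    rw [h]
    abel

theorem Xl_mul_pt {f f' : Mer} {m n p : ℤ} {a b : FRSL2 q} (ha : IsHomog q m n a)
    (hb : IsHomog q n p b) (h : μl q f * a = a * μl q f') :
    Xl q f * pt a b = pt a b * Xl q f' := by
  have h1 : Xl q f' = pt (μl q f') 1 := pt_eq _
  rw [← pt_Xl _ (hmem ha hb), h, h1, pt_mul (hmem ha hb) (hmem (.l _) .one), mul_one]

theorem Zr_mul_pt {f f' : Mer} {m n p : ℤ} {a b : FRSL2 q} (ha : IsHomog q m n a)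
    (hb : IsHomog q n p b) (h : μr q f * b = b * μr q f') :
    Zr q f * pt a b = pt a b * Zr q f' := by
  have h1 : Zr q f' = pt 1 (μr q f') := pt_eq _
  rw [← pt_Zr _ (hmem ha hb), h, h1, pt_mul (hmem ha hb) (hmem .one (.r _)), mul_one]

variable (q) in
/-- The coproduct on the free algebra. -/
def comulFree : FreeAlgebra ℂ Gen →ₐ[ℂ] Mat q := FreeAlgebra.lift ℂ (comulGen q)

theorem comulFree_rel (h0 : 0 < q) (h1 : q < 1) {x y : FreeAlgebra ℂ Gen} (h : Rel q x y) :
    comulFree q x = comulFree q y := by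
  have G := good_comul h0 h1
  have hq := q_ne_zero q h0
  have va : comulFree q Gen.fa = comulGen q .a := FreeAlgebra.lift_ι_apply _ _
  have vb : comulFree q Gen.fb = comulGen q .b := FreeAlgebra.lift_ι_apply _ _
  have vc : comulFree q Gen.fc = comulGen q .c := FreeAlgebra.lift_ι_apply _ _
  have vd : comulFree q Gen.fd = comulGen q .d := FreeAlgebra.lift_ι_apply _ _
  have vl : ∀ f, comulFree q (Gen.fl f) = Xl q f := fun f => FreeAlgebra.lift_ι_apply _ _
  have vr : ∀ f, comulFree q (Gen.fr f) = Zr q f := fun f => FreeAlgebra.lift_ι_apply _ _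
  have hH : comulFree q (funH q Gen.fl Gen.fr) = Xl q (cf q) - Zr q (ce q) := by
    rw [← funH_eq q h0 h1 _ _ Xl_Zr_commute]
    simp only [funH, map_smul, map_mul, map_sub, map_one, vl, vr]
  have hI : comulFree q (funI q Gen.fl Gen.fr) = Xl q (cf q) - Zr q (cf q) := by
    rw [← funI_eq q h0 h1 _ _ Xl_Zr_commute]
    simp only [funI, map_smul, map_mul, map_sub, vl, vr]
  have hF := shift_funF_ne_zero q h0 h1
  have hs := cf_add_ce q h0 h1
  have hs' : (Xl q : Mer →+* Mat q) (algebraMap ℂ Mer ((q : ℂ) + (q : ℂ)⁻¹)) =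
      (Zr q : Mer →+* Mat q) (algebraMap ℂ Mer ((q : ℂ) + (q : ℂ)⁻¹)) :=
    ((Xl q).commutes _).trans ((Zr q).commutes _).symm
  have hf : ∀ Y : Mat q, (q : ℂ) • (Xl q (funF q) * Y) = Xl q (cf q) * Y := by
    intro Y; rw [cf, map_smul, smul_mul_assoc]
  have hE : ∀ V Y : Mat q, Y = Zr q (ce q) * V →
      V = (q : ℂ) • (Zr q (Mer.shift (-1) (funF q)) * Y) := by
    rintro V Y rfl
    rw [ce, map_smul, smul_mul_assoc, mul_smul_comm, smul_smul, mul_inv_cancel₀ hq, one_smul,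
      ← mul_assoc, ← map_mul, mul_inv_cancel₀ hF, map_one, one_mul]
  have r {x y : FreeAlgebra ℂ Gen} (h : Rel q x y) := proj_rel h
  induction h with
  | l_const z => rw [vl, AlgHom.commutes, AlgHom.commutes]
  | l_add f g => rw [map_add, vl, vl, vl, map_add]
  | l_mul f g => rw [map_mul, vl, vl, vl, map_mul]
  | r_const z => rw [vr, AlgHom.commutes, AlgHom.commutes]
  | r_add f g => rw [map_add, vr, vr, vr, map_add]
  | r_mul f g => rw [map_mul, vr, vr, vr, map_mul]
  | lr_comm f g => rw [map_mul, map_mul, vl, vr]; exact Xl_Zr_commute f g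
  | l_a f =>
    have h := r (Rel.l_a f); rw [map_mul, map_mul] at h
    have h' := r (Rel.l_b f); rw [map_mul, map_mul] at h'
    rw [map_mul, map_mul, vl, vl, va, comulGen_a, mul_add, add_mul, Xl_mul_pt .a .a h,
      Xl_mul_pt .b .c h']
  | l_b f =>
    have h := r (Rel.l_a f); rw [map_mul, map_mul] at h
    have h' := r (Rel.l_b f); rw [map_mul, map_mul] at h'
    rw [map_mul, map_mul, vl, vl, vb, comulGen_b, mul_add, add_mul, Xl_mul_pt .a .b h,
      Xl_mul_pt .b .d h']
  | l_c f =>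
    have h := r (Rel.l_c f); rw [map_mul, map_mul] at h
    have h' := r (Rel.l_d f); rw [map_mul, map_mul] at h'
    rw [map_mul, map_mul, vl, vl, vc, comulGen_c, mul_add, add_mul, Xl_mul_pt .c .a h,
      Xl_mul_pt .d .c h']
  | l_d f =>
    have h := r (Rel.l_c f); rw [map_mul, map_mul] at h
    have h' := r (Rel.l_d f); rw [map_mul, map_mul] at h'
    rw [map_mul, map_mul, vl, vl, vd, comulGen_d, mul_add, add_mul, Xl_mul_pt .c .b h,
      Xl_mul_pt .d .d h']
  | r_a f =>
    have h := r (Rel.r_a f); rw [map_mul, map_mul] at h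
    have h' := r (Rel.r_c f); rw [map_mul, map_mul] at h'
    rw [map_mul, map_mul, vr, vr, va, comulGen_a, mul_add, add_mul, Zr_mul_pt .a .a h,
      Zr_mul_pt .b .c h']
  | r_b f =>
    have h := r (Rel.r_b f); rw [map_mul, map_mul] at h
    have h' := r (Rel.r_d f); rw [map_mul, map_mul] at h'
    rw [map_mul, map_mul, vr, vr, vb, comulGen_b, mul_add, add_mul, Zr_mul_pt .a .b h,
      Zr_mul_pt .b .d h']
  | r_c f =>
    have h := r (Rel.r_a f); rw [map_mul, map_mul] at h
    have h' := r (Rel.r_c f); rw [map_mul, map_mul] at h'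
    rw [map_mul, map_mul, vr, vr, vc, comulGen_c, mul_add, add_mul, Zr_mul_pt .c .a h,
      Zr_mul_pt .d .c h']
  | r_d f =>
    have h := r (Rel.r_b f); rw [map_mul, map_mul] at h
    have h' := r (Rel.r_d f); rw [map_mul, map_mul] at h'
    rw [map_mul, map_mul, vr, vr, vd, comulGen_d, mul_add, add_mul, Zr_mul_pt .c .b h,
      Zr_mul_pt .d .d h']
  | ab => simp only [map_smul, map_mul, va, vb, vr]; exact hE _ _ G.A3
  | ac => simp only [map_smul, map_mul, va, vc, vl, hf]; exact G.A1
  | bd => simp only [map_smul, map_mul, vb, vd, vl, hf]; exact G.A2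
  | cd => simp only [map_smul, map_mul, vc, vd, vr]; exact hE _ _ G.A4
  | ad₁ => simp only [map_sub, map_mul, va, vb, vc, vd, hH]; exact G.ad1
  | ad₂ =>
    simp only [map_sub, map_mul, va, vb, vc, vd, vl, vr, hH, funG_eq q h0 h1]
    have := G.ad2 Xl_Zr_commute hs hs'
    simp only [map_mul] at this; exact this
  | bc₁ =>
    simp only [map_sub, map_mul, va, vb, vc, vd, vr, hI, funG_eq q h0 h1]
    have := G.bc1
    simp only [map_mul] at this; exact this
  | bc₂ =>
    simp only [map_sub, map_mul, va, vb, vc, vd, vl, hI, funG_eq q h0 h1]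
    have := G.bc2 hs hs'
    simp only [map_mul] at this; exact this
  | det =>
    simp only [map_sub, map_smul, map_mul, map_one, va, vb, vc, vd, vl, hf]
    rw [G.A5]; exact add_sub_cancel_left _ _

variable (q) in
/-- The coproduct `Δ`, the algebra homomorphism with the values `comulGen` on the generators. -/
def comul (h0 : 0 < q) (h1 : q < 1) : FRSL2 q →ₐ[ℂ] Mat q :=
  RingQuot.liftAlgHom ℂ ⟨comulFree q, fun _ _ h => comulFree_rel h0 h1 h⟩

end Mat

/-- The basis vector `γ^{N-k} α^k` of the corepresentation space `V_N`. -/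
def vec (N k : ℕ) : FRSL2 q := γ q ^ (N - k) * α q ^ k

theorem vec_mem (N : ℕ) (k : Fin (N + 1)) : vec q N k ∈ grade q (2 * ((k : ℕ) : ℤ) - N) N := by
  have h := (IsHomog.c (q := q)).pow (N - (k : ℕ))
  have h' := (IsHomog.a (q := q)).pow (k : ℕ)
  have hk : (k : ℕ) ≤ N := Nat.lt_succ_iff.1 k.2
  exact IsHomog.mul' h h' (by push_cast [hk]; ring) (by push_cast [hk]; ring)

/-- `t` is the family of matrix elements of the corepresentation `Δ|_{V_N}` on the span `V_N` of the
`γ^{N-k} α^k`, `0 ≤ k ≤ N`, over the functions `f(λ)`, with respect to this basis: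
`Δ(γ^{N-k} α^k) = ∑_j t_{kj} ⊗ γ^{N-j} α^j`, where the right-hand side lies in
`⊕ A_{mn} ⊗ (V_N)_n`. -/
structure IsMatrixElements (h0 : 0 < q) (h1 : q < 1) (N : ℕ)
    (t : Fin (N + 1) → Fin (N + 1) → FRSL2 q) : Prop where
  mem : ∀ k j : Fin (N + 1), t k j ∈ rightGrade q (2 * ((j : ℕ) : ℤ) - N)
  comul_eq : ∀ k : Fin (N + 1), comul q h0 h1 (vec q N k) =
    ∑ j : Fin (N + 1), mtmul (t k j) (vec q N j) (tmul_mem_matched (mem k j) (vec_mem q N j))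

/-- The function `q^{aλ + bμ + c}` of two variables. -/
def qexp₂ (a b c : ℤ) : Mer ⊗[ℂ] Mer := qexp q a c ⊗ₜ qexp q b 0

/-- `Ξ = q^{λ-μ+1} + q^{μ-λ-1} - q^{-(λ+μ+2)} (1 - q^{2(λ+2)}) (1 - q^{2μ}) γβ`. -/
def Ξ : FRSL2 q :=
  coef q (qexp₂ q 1 (-1) 1 + qexp₂ q (-1) 1 (-1)) -
    coef q (qexp₂ q (-1) (-1) (-2) * (1 - qexp₂ q 2 0 4) * (1 - qexp₂ q 0 2 0)) * (γ q * β q)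

end FRSL2

section AskeyWilson
variable {R : Type*} [CommRing R] [Algebra ℂ R]
open Polynomial Finset

/-- The `q`-shifted factorial `(a; p)_k`. -/
def qPoch (a : R) (p : ℂ) (k : ℕ) : R := ∏ j ∈ range k, (1 - p ^ j • a)

/-- The Askey-Wilson monomial `h_k(x, a; p) = ∏_{j<k} (1 - 2 a p^j x + a² p^{2j})`, a polynomial in
`x`; for `x = cos θ` it equals `(a e^{iθ}, a e^{-iθ}; p)_k`. -/
def awMonomial (a : R) (p : ℂ) (k : ℕ) : R[X] :=
  ∏ j ∈ range k, (1 - C ((2 * p ^ j) • a) * X + C (p ^ (2 * j) • a ^ 2))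

/-- The Askey-Wilson polynomial
`p_n(x; a, b, c, d; p) = (ab, ac, ad; p)_n / a^n * ₄φ₃(p^{-n}, abcd p^{n-1}, a e^{iθ}, a e^{-iθ};
ab, ac, ad; p, p)`, `x = cos θ`, with parameters in a commutative algebra in which `a` and the
denominators `(ab, ac, ad; p)_k`, `k ≤ n`, are invertible. The terms of the series with `k > n`
vanish because of the factor `(p^{-n}; p)_k`. -/
def askeyWilson (n : ℕ) (a b c d : R) (p : ℂ) : R[X] :=
  C (qPoch (a * b) p n * qPoch (a * c) p n * qPoch (a * d) p n * Ring.inverse (a ^ n)) *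
    ∑ k ∈ range (n + 1),
      C ((qPoch (p ^ (-(n : ℤ))) p k / qPoch p p k * p ^ k) •
        (qPoch (p ^ ((n : ℤ) - 1) • (a * b * c * d)) p k *
          Ring.inverse (qPoch (a * b) p k * qPoch (a * c) p k * qPoch (a * d) p k))) *
        awMonomial a p k

end AskeyWilson

namespace FRSL2
variable (q : ℝ)

/-- The polynomial `p_n(x; q^{μ-λ+1+2|j-k|}, q^{λ-μ+1}, q^{λ+μ+3}, q^{-λ-μ-1+2|N-k-j|}; q²)` in `x`
with coefficients functions of `λ` and `μ`. -/
def awPoly (n N k j : ℕ) : Polynomial (Mer ⊗[ℂ] Mer) :=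
  askeyWilson n
    (qexp₂ q (-1) 1 (1 + 2 * |(j : ℤ) - k|)) (qexp₂ q 1 (-1) 1) (qexp₂ q 1 1 3)
    (qexp₂ q (-1) (-1) (-1 + 2 * |(N : ℤ) - k - j|)) ((q : ℂ) ^ 2)

/-- The factor
`q^{n(λ-μ+1+n+|N-k-j|)+j(j-N)} (q²;q²)_{N-n} / ((q²;q²)_j (q²;q²)_{N-j}
(q^{2(λ+2)}, q^{2(-μ+|N-k-j|)}; q²)_n)`. -/
def prefactor (n N k j : ℕ) : Mer ⊗[ℂ] Mer :=
  qexp₂ q n (-n) (n * (1 + n + |(N : ℤ) - k - j|) + j * (j - N)) *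
    algebraMap ℂ _ (qPoch ((q : ℂ) ^ 2) ((q : ℂ) ^ 2) (N - n) /
      (qPoch ((q : ℂ) ^ 2) ((q : ℂ) ^ 2) j * qPoch ((q : ℂ) ^ 2) ((q : ℂ) ^ 2) (N - j))) *
    Ring.inverse (qPoch (qexp₂ q 2 0 4) ((q : ℂ) ^ 2) n *
      qPoch (qexp₂ q 0 (-2) (2 * |(N : ℤ) - k - j|)) ((q : ℂ) ^ 2) n)

/-- The element `P_n`: `prefactor` times the value of the polynomial `awPoly` at `Ξ / 2`. -/
def Pelt (n N k j : ℕ) : FRSL2 q :=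
  coef q (prefactor q n N k j) *
    (awPoly q n N k j).eval₂ (coef q : Mer ⊗[ℂ] Mer →+* FRSL2 q) ((1 / 2 : ℂ) • Ξ q)

end FRSL2
end DynQG
end

open DynQG DynQG.FRSL2

/-!
Write `[z] = q^z - q^{-z}`. The relations of `F_R(SL(2))` say that `αγ`, `βδ`, `βα`, `δγ` are
multiples of `γα`, `δβ`, `αβ`, `γδ` by quotients of brackets, and that
`[μ + 1] δα = [μ] γβ + [μ + 1]`. By the latter, `Ξ` is a function of `λ`, `μ` minus
`[λ + 2] [μ] γβ`, or another function minus `[λ + 2] [μ + 1] δα` (`Ξ_eq_γ_β`, `Ξ_eq_δ_α`). In the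
first form `Ξ` commutes with `α` and `δ`, in the second with `β` and `γ`, so it is central
(`Ξ_central`). It also follows that `γβ` and `δα` are values at `Ξ / 2` of polynomials with
coefficients functions of `λ` and `μ`, namely of multiples of the quadratic polynomials
`1 - 2ax + a²` with `a = q^{λ-μ+1}` and `a = q^{λ+μ+3}` (`Φ_cbPoly`, `Φ_daPoly`).

Multiplying `Δ(γ^{N-k} α^k)` by `Δ(α)` or `Δ(γ)` gives a recursion in `N` for the matrix elements,
which is taken as the definition of a family `matElt` (`isMatrixElements_matElt`). For the closed
form the outer powers of generators are split off in each of the four cases, and what remains is a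
recursion for polynomials in `Ξ`. It involves translations of `λ` and `μ`, under which the four
parameters of the Askey-Wilson polynomials are multiplied by powers of `q²`, and the quadratic
polynomials above. In each case it is a three-term contiguous relation for Askey-Wilson polynomials:

* `k ≤ j`, `k + j ≤ N`: `awQ_contiguous_bc`;
* `k ≤ j`, `N ≤ k + j`: `awQ_contiguous_bd`;
* `j ≤ k`, `k + j ≤ N`: `awQ_contiguous_ac`;
* `j ≤ k`, `N ≤ k + j`: `awQ_contiguous_ad`.

These relations are proved by comparing coefficients in a basis of products
`∏ (1 - 2 a p^j x + a² p^{2j})`. The induction that combines the cases is `matElt_eq`; its boundary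
case `k = 0` is the Pascal rule for `q`-binomial coefficients.

Uniqueness needs linear independence of the vectors `γ^{N-j} α^j` over the functions of `λ`, in the
second factor of the matrix tensor product. It comes from a representation `rep` on sequences of
meromorphic functions, in which these vectors move one and the same vector into different
components, and from the fact that the kernel of the projection onto the matrix tensor product lies
in the span of the elements `f(μ) a ⊗ b - a ⊗ f(λ) b` (`mem_balanced_of_matProj_eq_zero`).
-/

noncomputable section
namespace DynQG

/-! ### Contiguous relations of Askey-Wilson sums -/

section Contiguous
open Finset
variable {S : Type*} [CommRing S]

/-- The `p`-shifted factorial `(a; p)_k`; unlike in `qPoch`, the base lies in the ring itself. -/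
def poch (a p : S) (k : ℕ) : S := ∏ j ∈ range k, (1 - p ^ j * a)

@[simp] theorem poch_zero (a p : S) : poch a p 0 = 1 := rfl

theorem poch_succ (a p : S) (k : ℕ) : poch a p (k + 1) = poch a p k * (1 - p ^ k * a) :=
  prod_range_succ _ _

theorem poch_succ' (a p : S) (k : ℕ) : poch a p (k + 1) = (1 - a) * poch (p * a) p k := by
  rw [poch, prod_range_succ', mul_comm, poch]
  congr 1
  · simp
  · exact prod_congr rfl fun j _ => by ring

/-- The factor `1 - 2ax + a²`; for `x = cos θ` it equals `(1 - a e^{iθ}) (1 - a e^{-iθ})`. -/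
def awFactor (x a : S) : S := 1 - 2 * a * x + a ^ 2

/-- The product `h_k(x, a) = ∏_{j<k} (1 - 2 a p^j x + a² p^{2j})`. -/
def awBasis (p x a : S) (k : ℕ) : S := ∏ j ∈ range k, awFactor x (p ^ j * a)

@[simp] theorem awBasis_zero (p x a : S) : awBasis p x a 0 = 1 := rfl

theorem awBasis_succ (p x a : S) (k : ℕ) :
    awBasis p x a (k + 1) = awBasis p x a k * awFactor x (p ^ k * a) :=
  prod_range_succ _ _

theorem awBasis_succ' (p x a : S) (k : ℕ) :
    awBasis p x a (k + 1) = awFactor x a * awBasis p x (p * a) k := by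
  rw [awBasis, prod_range_succ', mul_comm, awBasis]
  congr 1
  · simp
  · exact prod_congr rfl fun j _ => by rw [pow_succ]; ring_nf

/-- The term `s_k (e; p)_k (ab p^k, ac p^k, ad p^k; p)_{n-k} h_k(x, a)`. Here the denominators
`(ab, ac, ad; p)_k` of the Askey-Wilson series are cancelled against the factor `(ab, ac, ad; p)_n`
in front of it, so that no division is needed. -/
def awTerm (p : S) (s : ℕ → S) (n : ℕ) (e a b c d x : S) (k : ℕ) : S :=
  s k * poch e p k * poch (p ^ k * (a * b)) p (n - k) * poch (p ^ k * (a * c)) p (n - k) *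
    poch (p ^ k * (a * d)) p (n - k) * awBasis p x a k

/-- The sum of the `awTerm`s. For `e = abcd p^{n-1}` and `s_k = (p^{-n}; p)_k p^k / (p; p)_k` it is
`a^n p_n(x; a, b, c, d; p)`. -/
def awSum (p : S) (s : ℕ → S) (n : ℕ) (e a b c d x : S) : S :=
  ∑ k ∈ range (n + 1), awTerm p s n e a b c d x k

/-- Collecting the coefficients of a basis: each term `T (k + 1)` is the part `U (k + 1)` of one
summand plus the part `V k` of the preceding one. -/
theorem sum_shift {n : ℕ} {T U V : ℕ → S} (h0 : T 0 = U 0)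
    (h : ∀ k m, n = k + 1 + m → T (k + 1) = U (k + 1) + V k) (hl : T (n + 1) = V n) :
    ∑ k ∈ range (n + 2), T k = ∑ k ∈ range (n + 1), (U k + V k) := by
  rw [sum_range_succ, sum_range_succ', h0, hl, sum_add_distrib, sum_range_succ' U,
    sum_range_succ V, sum_congr rfl fun k hk => h k (n - (k + 1)) (by
      have := mem_range.1 hk; omega), sum_add_distrib]
  ring

variable {p : S} {t : ℕ → S} {n : ℕ}

/-- The expansion of `(1 - 2bx + b²) h_k(x, a)` in the polynomials `h_k(x, a)`. -/
theorem mul_awFactor_mul_awBasis (p x a b : S) (k : ℕ) :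
    p ^ k * (a * awFactor x b * awBasis p x a k) = b * awBasis p x a (k + 1) +
      (p ^ k * a - b) * (1 - p ^ k * (a * b)) * awBasis p x a k := by
  rw [awBasis_succ, awFactor, awFactor]
  ring

/-- The expansion of `h_{k+1}(x, a)` in the polynomials `h_k(x, pa)`. -/
theorem awBasis_eq (p x a : S) (k : ℕ) :
    p ^ (k + 1) * awBasis p x a (k + 1) = awBasis p x (p * a) (k + 1) +
      (p ^ (k + 1) - 1) * (1 - p ^ (k + 1) * a ^ 2) * awBasis p x (p * a) k := by
  rw [awBasis_succ', awBasis_succ, awFactor, awFactor]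
  ring

theorem poch_mul_last (y : S) (m : ℕ) :
    poch y p m * (1 - p ^ m * y) = (1 - y) * poch (p * y) p m := by
  rw [← poch_succ, poch_succ']

/-- A relation between `p_{n+1}(x; a, b, c, d)`, `p_n(x; a, pb, c, d)` and `p_n(x; a, b, pc, d)`,
proved by comparing coefficients of `h_k(x, a)`. The sequence `t` parametrizes the coefficients of
both degrees: `s_k` is `(p^{n+1} - 1) p^k t_k` in degree `n + 1` and `(p^{n+1} - p^k) p^k t_k` in
degree `n`. -/
theorem awSum_contiguous_bc (a b c d x e : S)
    (ht : ∀ k, (p * p ^ n - p ^ k) * t k = p ^ n * (1 - p ^ (k + 1)) * p * t (k + 1))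
    (he : e = p ^ n * (a * b * c * d)) :
    (c - b) * awSum p (fun k => (p * p ^ n - 1) * p ^ k * t k) (n + 1) e a b c d x =
      a * ((1 - p ^ n * (c * d)) * (1 - p ^ n * (a * c)) * awFactor x b *
          awSum p (fun k => (p * p ^ n - p ^ k) * p ^ k * t k) n e a (p * b) c d x -
        (1 - p ^ n * (a * b)) * (1 - p ^ n * (b * d)) * awFactor x c *
          awSum p (fun k => (p * p ^ n - p ^ k) * p ^ k * t k) n e a b (p * c) d x) := by
  set U : ℕ → S := fun k => (c - b) * ((p * p ^ n - p ^ k) * t k * poch e p k *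
    poch (p ^ k * (a * d)) p (n - k) * (1 - p ^ (n + k) * (a * d)) *
    poch (p ^ k * (a * b)) p (n + 1 - k) * poch (p ^ k * (a * c)) p (n + 1 - k) *
    awBasis p x a k) with hU
  set V : ℕ → S := fun k => -((c - b) * ((p * p ^ n - p ^ k) * t k * poch e p (k + 1) *
    poch (p ^ k * (a * d)) p (n - k) *
    poch (p ^ (k + 1) * (a * b)) p (n - k) * poch (p ^ (k + 1) * (a * c)) p (n - k) *
    awBasis p x a (k + 1))) with hV
  rw [awSum, mul_sum, sum_shift (U := U) (V := V), awSum, awSum, mul_sum, mul_sum,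
    ← sum_sub_distrib, mul_sum]
  · refine sum_congr rfl fun k hk => ?_
    obtain ⟨m, rfl⟩ := Nat.exists_eq_add_of_le (Nat.lt_succ_iff.1 (mem_range.1 hk))
    have e1 : p ^ k * (a * (p * b)) = p * (p ^ k * (a * b)) := by ring
    have e2 : p ^ k * (a * (p * c)) = p * (p ^ k * (a * c)) := by ring
    have e3 : p ^ (k + 1) * (a * b) = p * (p ^ k * (a * b)) := by ring
    have e4 : p ^ (k + 1) * (a * c) = p * (p ^ k * (a * c)) := by ring
    simp only [hU, hV, awTerm, e1, e2, e3, e4, show k + m - k = m by omega,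
      show k + m + 1 - k = m + 1 by omega, poch_succ' (p ^ k * (a * b)),
      poch_succ' (p ^ k * (a * c)), poch_succ e]
    have hB := poch_mul_last (p := p) (p ^ k * (a * b)) m
    have hC := poch_mul_last (p := p) (p ^ k * (a * c)) m
    have hb := mul_awFactor_mul_awBasis p x a b k
    have hc := mul_awFactor_mul_awBasis p x a c k
    generalize poch (p ^ k * (a * b)) p m = B at *
    generalize poch (p * (p ^ k * (a * b))) p m = B' at *
    generalize poch (p ^ k * (a * c)) p m = C at *
    generalize poch (p * (p ^ k * (a * c))) p m = C' at *
    generalize poch (p ^ k * (a * d)) p m = D at *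
    generalize poch e p k = E at *
    generalize awBasis p x a k = h at *
    generalize awBasis p x a (k + 1) = h' at *
    generalize awFactor x b = fb at *
    generalize awFactor x c = fc at *
    have hB' : (1 - p ^ (k + m) * (a * b)) * B = (1 - p ^ k * (a * b)) * B' := by
      rw [← hB]; ring
    have hC' : (1 - p ^ (k + m) * (a * c)) * C = (1 - p ^ k * (a * c)) * C' := by
      rw [← hC]; ring
    clear hB hC
    rw [he]
    simp only [pow_add] at *
    generalize p ^ k = K at *
    generalize p ^ m = M at *
    linear_combination
      -((p * (K * M) - K) * K * t k * E * D) * (a * (1 - K * M * (c * d)) * fb * B' * h * hC'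
        - a * (1 - K * M * (b * d)) * fc * C' * h * hB')
      - ((p * (K * M) - K) * t k * E * D) * ((1 - K * M * (c * d)) * B' * (1 - K * (a * c)) * C' *
        hb
        - (1 - K * M * (b * d)) * C' * (1 - K * (a * b)) * B' * hc)
  · simp only [hU, awTerm, Nat.sub_zero, poch_succ (p ^ 0 * (a * d))]
    ring
  · rintro k m rfl
    simp only [hU, hV, awTerm, show k + 1 + m + 1 - (k + 1) = m + 1 by omega,
      show k + 1 + m - (k + 1) = m by omega, show k + 1 + m - k = m + 1 by omega]
    have e3 : p ^ (k + 1) * (a * d) = p * (p ^ k * (a * d)) := by ring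
    rw [e3, poch_succ (p * (p ^ k * (a * d))), poch_succ' (p ^ k * (a * d))]
    have := ht k
    linear_combination ((c - b) * poch e p (k + 1) * poch (p ^ (k + 1) * (a * b)) p (m + 1) *
      poch (p ^ (k + 1) * (a * c)) p (m + 1) * poch (p * (p ^ k * (a * d))) p m *
      awBasis p x a (k + 1) * (1 - p ^ k * (a * d))) * this
  · simp only [hV, awTerm, Nat.sub_self, poch_zero]
    linear_combination ((c - b) * poch e p (n + 1) * awBasis p x a (n + 1)) * ht n

/-- A relation between `p_{n+1}(x; a, b, c, pd)`, `p_{n+1}(x; a, b, c, d)` and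
`p_n(x; a, pb, c, pd)`, proved by comparing coefficients of `h_k(x, a)`; for `t` see
`awSum_contiguous_bc`. -/
theorem awSum_contiguous_bd (a b c d x e : S)
    (ht : ∀ k, (p * p ^ n - p ^ k) * t k = p ^ n * (1 - p ^ (k + 1)) * p * t (k + 1))
    (he : e = p ^ n * (a * b * c * d)) :
    (1 - b * d) * awSum p (fun k => (p * p ^ n - 1) * p ^ k * t k) (n + 1) (p * e) a b c (p * d) x -
      (1 - p * p ^ n * (b * d)) *
        awSum p (fun k => (p * p ^ n - 1) * p ^ k * t k) (n + 1) e a b c d x =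
      a * d * (1 - p * p ^ n) * (1 - p ^ n * (a * c)) * awFactor x b *
        awSum p (fun k => (p * p ^ n - p ^ k) * p ^ k * t k) n (p * e) a (p * b) c (p * d) x := by
  set U : ℕ → S := fun k => d * (1 - p * p ^ n) * (p * p ^ n - p ^ k) * t k * poch (p * e) p k *
    poch (p ^ k * (a * (p * d))) p (n - k) *
    poch (p ^ k * (a * b)) p (n + 1 - k) * poch (p ^ k * (a * c)) p (n + 1 - k) *
    ((p ^ k * a - b) * awBasis p x a k) with hU
  set V : ℕ → S := fun k => d * (1 - p * p ^ n) * (p * p ^ n - p ^ k) * t k * poch (p * e) p k *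
    poch (p ^ k * (a * (p * d))) p (n - k) *
    poch (p ^ (k + 1) * (a * b)) p (n - k) * poch (p ^ k * (a * c)) p (n + 1 - k) *
    (b * awBasis p x a (k + 1)) with hV
  rw [awSum, mul_sum, awSum, mul_sum, ← sum_sub_distrib, sum_shift (U := U) (V := V), awSum,
    mul_sum]
  · refine sum_congr rfl fun k hk => ?_
    obtain ⟨m, rfl⟩ := Nat.exists_eq_add_of_le (Nat.lt_succ_iff.1 (mem_range.1 hk))
    have e1 : p ^ k * (a * (p * b)) = p * (p ^ k * (a * b)) := by ring
    have e3 : p ^ (k + 1) * (a * b) = p * (p ^ k * (a * b)) := by ring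
    simp only [hU, hV, awTerm, e1, e3, show k + m - k = m by omega,
      show k + m + 1 - k = m + 1 by omega, poch_succ' (p ^ k * (a * b)),
      poch_succ (p ^ k * (a * c))]
    have hb := mul_awFactor_mul_awBasis p x a b k
    generalize poch (p * (p ^ k * (a * b))) p m = B' at *
    generalize poch (p ^ k * (a * c)) p m = C at *
    generalize poch (p ^ k * (a * (p * d))) p m = D at *
    generalize poch (p * e) p k = E at *
    generalize awBasis p x a k = h at *
    generalize awBasis p x a (k + 1) = h' at *
    generalize awFactor x b = fb at *
    simp only [pow_add] at *
    generalize p ^ k = K at *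
    generalize p ^ m = M at *
    linear_combination -(d * (1 - p * (K * M)) * (1 - K * M * (a * c)) * (p * (K * M) - K) * t k *
      E * B' * C * D) * hb
  · simp only [hU, awTerm, Nat.sub_zero, poch_succ (p ^ 0 * (a * (p * d))),
      poch_succ' (p ^ 0 * (a * d))]
    have e3 : p ^ 0 * (a * (p * d)) = p * (p ^ 0 * (a * d)) := by ring
    rw [e3]
    simp only [poch_zero]
    ring
  · rintro k m rfl
    have e1 : p ^ k * (a * (p * d)) = p ^ (k + 1) * (a * d) := by ring
    have e2 : p ^ (k + 1) * (a * (p * d)) = p * (p ^ (k + 1) * (a * d)) := by ring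
    have e3 : p ^ (k + 1) * (a * c) = p * (p ^ k * (a * c)) := by ring
    simp only [hU, hV, awTerm, show k + 1 + m + 1 - (k + 1) = m + 1 by omega,
      show k + 1 + m - (k + 1) = m by omega, show k + 1 + m - k = m + 1 by omega,
      show k + 1 + m + 1 - k = m + 1 + 1 by omega, e1, e2, e3, poch_succ' e,
      poch_succ (p * e), poch_succ' (p ^ k * (a * c)),
      poch_succ (p * (p ^ (k + 1) * (a * d))), poch_succ' (p ^ (k + 1) * (a * d))]
    have := ht k
    generalize poch (p ^ (k + 1) * (a * b)) p (m + 1) = B at *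
    generalize poch (p * (p ^ k * (a * c))) p (m + 1) = C at *
    generalize poch (p * (p ^ (k + 1) * (a * d))) p m = D at *
    generalize poch (p * e) p k = E at *
    generalize awBasis p x a (k + 1) = h' at *
    rw [he]
    linear_combination (-(d * (1 - p * p ^ (k + 1 + m)) * E * B * D * b * h' *
      (1 - p ^ (k + 1) * (a * d)) * (1 - p ^ k * (a * c)) * C)) * this
  · have e3 : p ^ (n + 1) * (a * c) = p * (p ^ n * (a * c)) := by ring
    simp only [hV, awTerm, Nat.sub_self, poch_zero, show n + 1 - n = 0 + 1 by omega, poch_succ' e,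
      poch_succ (p * e), poch_succ (p ^ n * (a * c))]
    have := ht n
    generalize poch (p * e) p n = E at *
    generalize awBasis p x a (n + 1) = h' at *
    rw [he]
    linear_combination (-(d * (1 - p * p ^ n) * E * b * h' * (1 - p ^ n * (a * c)))) * this

/-- A relation between `p_{n+1}(x; pa, b, c, d)`, `p_{n+1}(x; a, b, c, d)` and
`p_n(x; pa, b, pc, d)`, proved by comparing coefficients of `h_k(x, pa)`; for `t` see
`awSum_contiguous_bc`. -/
theorem awSum_contiguous_ac (a b c d x e : S)
    (ht : ∀ k, (p * p ^ n - p ^ k) * t k = p ^ n * (1 - p ^ (k + 1)) * p * t (k + 1))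
    (he : e = p ^ n * (a * b * c * d)) :
    (1 - a * c) * awSum p (fun k => (p * p ^ n - 1) * p ^ k * t k) (n + 1) (p * e) (p * a) b c d x -
      p ^ (n + 1) * (1 - p * p ^ n * (a * c)) *
        awSum p (fun k => (p * p ^ n - 1) * p ^ k * t k) (n + 1) e a b c d x =
      p * a ^ 2 * (1 - p * p ^ n) * (1 - p ^ n * (b * d)) * awFactor x c *
        awSum p (fun k => (p * p ^ n - p ^ k) * p ^ k * t k) n (p * e) (p * a) b (p * c) d x := by
  set X : ℕ → S := fun k => p ^ (n + 1) * (p * p ^ n - 1) * t k * poch e p k *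
    poch (p ^ k * (a * b)) p (n + 1 - k) * poch (p ^ k * (a * c)) p (n + 2 - k) *
    poch (p ^ k * (a * d)) p (n + 1 - k) with hX
  set Z : ℕ → S := fun k => X (k + 1) * ((p ^ (k + 1) - 1) * (1 - p ^ (k + 1) * a ^ 2) *
    awBasis p x (p * a) k) with hZ
  set U : ℕ → S := fun k => a * (1 - p * p ^ n) * (1 - p ^ n * (b * d)) *
    (p * p ^ n - p ^ k) * t k * poch (p * e) p k *
    poch (p * (p ^ k * (a * b))) p (n - k) * poch (p * (p ^ k * (a * c))) p (n + 1 - k) *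
    poch (p * (p ^ k * (a * d))) p (n - k) *
    ((p ^ k * (p * a) - c) * awBasis p x (p * a) k) with hU
  set V : ℕ → S := fun k => a * (1 - p * p ^ n) * (1 - p ^ n * (b * d)) *
    (p * p ^ n - p ^ k) * t k * poch (p * e) p k *
    poch (p ^ (k + 1) * (a * b)) p (n - k) * poch (p * (p ^ (k + 1) * (a * c))) p (n - k) *
    poch (p ^ (k + 1) * (a * d)) p (n - k) *
    (c * awBasis p x (p * a) (k + 1)) with hV
  set T : ℕ → S := fun k => (1 - a * c) *
      awTerm p (fun k => (p * p ^ n - 1) * p ^ k * t k) (n + 1) (p * e) (p * a) b c d x k -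
    X k * awBasis p x (p * a) k with hT
  -- only the second sum is not yet expanded in `h_k(x, pa)`; `Z` collects the lower terms
  have hsum : p ^ (n + 1) * (1 - p * p ^ n * (a * c)) *
        awSum p (fun k => (p * p ^ n - 1) * p ^ k * t k) (n + 1) e a b c d x =
      ∑ k ∈ range (n + 2), X k * awBasis p x (p * a) k + ∑ k ∈ range (n + 1), Z k := by
    have h0 : ∑ k ∈ range (n + 1), Z k = ∑ k ∈ range (n + 2), X k *
        ((p ^ k - 1) * (1 - p ^ k * a ^ 2) * awBasis p x (p * a) (k - 1)) := by
      rw [sum_range_succ' _ (n + 1)]; simp [hZ]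
    rw [h0, ← sum_add_distrib, awSum, mul_sum]
    refine sum_congr rfl fun k hk => ?_
    obtain ⟨m, hm⟩ := Nat.exists_eq_add_of_le (Nat.lt_succ_iff.1 (mem_range.1 hk))
    have hbasis : p ^ k * awBasis p x a k = awBasis p x (p * a) k +
        (p ^ k - 1) * (1 - p ^ k * a ^ 2) * awBasis p x (p * a) (k - 1) := by
      cases k with
      | zero => simp
      | succ k => rw [awBasis_eq]; simp
    have hP : p * p ^ n = p ^ k * p ^ m := by rw [← pow_succ', hm, pow_add]
    simp only [hX, awTerm, hP, show n + 1 - k = m by omega, show n + 2 - k = m + 1 by omega,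
      poch_succ (p ^ k * (a * c))]
    linear_combination (p ^ (n + 1) * (1 - p ^ k * p ^ m * (a * c)) * (p ^ k * p ^ m - 1) * t k *
      poch e p k * poch (p ^ k * (a * b)) p m * poch (p ^ k * (a * c)) p m *
      poch (p ^ k * (a * d)) p m) * hbasis
  have hsum' : ∑ k ∈ range (n + 2), T k =
      ∑ k ∈ range (n + 1), ((U k + Z k) + V k) := by
    refine sum_shift ?_ ?_ ?_
    · have := ht 0
      have e1 (y : S) : p ^ 0 * (p * a * y) = p * (p ^ 0 * (a * y)) := by ring
      have e2 (y : S) : p ^ (0 + 1) * (a * y) = p * (p ^ 0 * (a * y)) := by ring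
      simp only [hT, hU, hZ, hX, awTerm, Nat.sub_zero, e1, e2, show n + 1 - (0 + 1) = n by omega,
        show n + 2 - (0 + 1) = n + 1 by omega, show n + 2 = n + 1 + 1 by omega,
        poch_succ' (p ^ 0 * (a * b)), poch_succ' (p ^ 0 * (a * c)), poch_succ' (p ^ 0 * (a * d)),
        poch_succ (p * (p ^ 0 * (a * b))), poch_succ (p * (p ^ 0 * (a * d))), poch_zero,
        awBasis_zero, poch_succ e]
      generalize poch (p * (p ^ 0 * (a * b))) p n = B at *
      generalize poch (p * (p ^ 0 * (a * c))) p (n + 1) = C at *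
      generalize poch (p * (p ^ 0 * (a * d))) p n = D at *
      rw [he]
      linear_combination (-((p * p ^ n - 1) * (1 - p * a ^ 2) * B * C * D *
        (1 - p ^ n * (a * b * c * d)))) * this
    · rintro k m rfl
      have h1 := ht k
      have h2 := ht (k + 1)
      have e1 (y : S) : p ^ (k + 1) * (p * a * y) = p * (p ^ (k + 1) * (a * y)) := by ring
      have e2 (y : S) : p ^ (k + 1 + 1) * (a * y) = p * (p ^ (k + 1) * (a * y)) := by ring
      simp only [hT, hU, hZ, hV, hX, awTerm, e1, e2, show k + 1 + m + 1 - (k + 1) = m + 1 by omega,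
        show k + 1 + m + 1 - (k + 1 + 1) = m by omega,
        show k + 1 + m + 2 - (k + 1) = m + 1 + 1 by omega,
        show k + 1 + m + 2 - (k + 1 + 1) = m + 1 by omega,
        show k + 1 + m - (k + 1) = m by omega, show k + 1 + m - k = m + 1 by omega,
        poch_succ' (p ^ (k + 1) * (a * b)), poch_succ' (p ^ (k + 1) * (a * c)),
        poch_succ' (p ^ (k + 1) * (a * d)),
        poch_succ (p * (p ^ (k + 1) * (a * b))), poch_succ (p * (p ^ (k + 1) * (a * d))),
        poch_succ' e, poch_succ (p * e)]
      generalize poch (p * (p ^ (k + 1) * (a * b))) p m = B at *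
      generalize poch (p * (p ^ (k + 1) * (a * c))) p (m + 1) = C at *
      generalize poch (p * (p ^ (k + 1) * (a * d))) p m = D at *
      generalize poch (p * e) p k = E at *
      generalize awBasis p x (p * a) (k + 1) = g at *
      rw [he]
      linear_combination (-(a * (1 - p * p ^ (k + 1 + m)) * (1 - p ^ (k + 1 + m) * (b * d)) * E *
        (1 - p ^ (k + 1) * (a * b)) * B * C * (1 - p ^ (k + 1) * (a * d)) * D * c * g)) * h1 -
        ((p * p ^ (k + 1 + m) - 1) * (1 - p * p ^ (k + 1) * a ^ 2) * B * C * D * g *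
          (1 - p ^ (k + 1 + m) * (a * b * c * d)) * E *
          (1 - p ^ k * (p * (p ^ (k + 1 + m) * (a * b * c * d))))) * h2
    · have h1 := ht n
      have e1 (y : S) : p ^ (n + 1) * (p * a * y) = p * (p ^ (n + 1) * (a * y)) := by ring
      simp only [hT, hV, hX, awTerm, Nat.sub_self, poch_zero, show n + 2 - (n + 1) = 0 + 1 by omega,
        poch_succ (p ^ (n + 1) * (a * c)), poch_succ' e, poch_succ (p * e)]
      generalize poch (p * e) p n = E at *
      generalize awBasis p x (p * a) (n + 1) = g at *
      rw [he]
      linear_combination (-(a * (1 - p * p ^ n) * (1 - p ^ n * (b * d)) * E * c * g)) * h1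
  rw [hsum, awSum, mul_sum, ← sub_sub, ← sum_sub_distrib, hsum', sub_eq_iff_eq_add,
    ← sum_congr rfl fun k _ => (add_right_comm (U k) (V k) (Z k)), sum_add_distrib, awSum, mul_sum]
  congr 1
  refine sum_congr rfl fun k hk => ?_
  obtain ⟨m, rfl⟩ := Nat.exists_eq_add_of_le (Nat.lt_succ_iff.1 (mem_range.1 hk))
  have hb := mul_awFactor_mul_awBasis p x (p * a) c k
  have e1 (y : S) : p ^ k * (p * a * y) = p * (p ^ k * (a * y)) := by ring
  have e2 (y : S) : p ^ (k + 1) * (a * y) = p * (p ^ k * (a * y)) := by ring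
  have e3 : p ^ k * (p * a * (p * c)) = p * (p * (p ^ k * (a * c))) := by ring
  simp only [hU, hV, awTerm, e3, e1, e2, show k + m - k = m by omega,
    show k + m + 1 - k = m + 1 by omega, poch_succ' (p * (p ^ k * (a * c)))]
  rw [e1] at hb
  linear_combination (-(a * (1 - p * p ^ (k + m)) * (1 - p ^ (k + m) * (b * d)) *
    (p * p ^ (k + m) - p ^ k) * t k * poch (p * e) p k * poch (p * (p ^ k * (a * b))) p m *
    poch (p * (p * (p ^ k * (a * c)))) p m * poch (p * (p ^ k * (a * d))) p m)) * hb

/-- A relation between `p_n(x; pa, b, c, pd)`, `p_n(x; pa, b, c, d)` and `p_n(x; a, b, c, pd)`,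
proved by comparing coefficients of `h_k(x, pa)`. All three have the same degree, and
`t_k = s_k / p^k`. -/
theorem awSum_contiguous_ad (a b c d x e : S)
    (ht : ∀ k, (p ^ n - p ^ k) * t k = p ^ n * (1 - p ^ (k + 1)) * t (k + 1))
    (he : e = p ^ n * (a * b * c * d)) :
    (a - d) * (1 - e) *
        awSum p (fun k => p ^ k * t k) n (p * e) (p * a) b c (p * d) x =
      a * (1 - p ^ n * (c * d)) * (1 - p ^ n * (b * d)) *
        awSum p (fun k => p ^ k * t k) n e (p * a) b c d x -
      d * p ^ n * (1 - p ^ n * (a * b)) * (1 - p ^ n * (a * c)) *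
        awSum p (fun k => p ^ k * t k) n e a b c (p * d) x := by
  set X : ℕ → S := fun k => d * p ^ n * t k * poch e p k *
    poch (p ^ k * (a * b)) p (n + 1 - k) * poch (p ^ k * (a * c)) p (n + 1 - k) *
    poch (p ^ k * (a * (p * d))) p (n - k) with hX
  set Z : ℕ → S := fun k => X (k + 1) * ((p ^ (k + 1) - 1) * (1 - p ^ (k + 1) * a ^ 2) *
    awBasis p x (p * a) k) with hZ
  have hsum : d * p ^ n * (1 - p ^ n * (a * b)) * (1 - p ^ n * (a * c)) *
        awSum p (fun k => p ^ k * t k) n e a b c (p * d) x =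
      ∑ k ∈ range (n + 1), X k * awBasis p x (p * a) k + ∑ k ∈ range n, Z k := by
    have h0 : ∑ k ∈ range n, Z k = ∑ k ∈ range (n + 1), X k *
        ((p ^ k - 1) * (1 - p ^ k * a ^ 2) * awBasis p x (p * a) (k - 1)) := by
      rw [sum_range_succ' _ n]; simp [hZ]
    rw [h0, ← sum_add_distrib, awSum, mul_sum]
    refine sum_congr rfl fun k hk => ?_
    obtain ⟨m, rfl⟩ := Nat.exists_eq_add_of_le (Nat.lt_succ_iff.1 (mem_range.1 hk))
    have hbasis : p ^ k * awBasis p x a k = awBasis p x (p * a) k +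
        (p ^ k - 1) * (1 - p ^ k * a ^ 2) * awBasis p x (p * a) (k - 1) := by
      cases k with
      | zero => simp
      | succ k => rw [awBasis_eq]; simp
    simp only [hX, awTerm, show k + m - k = m by omega, show k + m + 1 - k = m + 1 by omega,
      poch_succ (p ^ k * (a * c)), poch_succ (p ^ k * (a * b))]
    linear_combination (d * p ^ (k + m) * (1 - p ^ (k + m) * (a * b)) *
      (1 - p ^ (k + m) * (a * c)) * t k *
      poch e p k * poch (p ^ k * (a * b)) p m * poch (p ^ k * (a * c)) p m *
      poch (p ^ k * (a * (p * d))) p m) * hbasis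
  set Y : ℕ → S := fun k => (a - d) * (1 - e) *
    awTerm p (fun k => p ^ k * t k) n (p * e) (p * a) b c (p * d) x k with hY
  set Y' : ℕ → S := fun k => a * (1 - p ^ n * (c * d)) * (1 - p ^ n * (b * d)) *
    awTerm p (fun k => p ^ k * t k) n e (p * a) b c d x k with hY'
  have hlast : Y n = Y' n - X n * awBasis p x (p * a) n := by
    have hE := poch_mul_last (p := p) e n
    simp only [hY, hY', hX, awTerm, Nat.sub_self, poch_zero, show n + 1 - n = 0 + 1 by omega,
      poch_succ (p ^ n * (a * b)), poch_succ (p ^ n * (a * c))]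
    have h1 : (1 - e) * poch (p * e) p n = poch e p n * (1 - p ^ n * (p ^ n * (a * b * c *
      d))) := by
      rw [← hE, ← he]
    linear_combination (a - d) * p ^ n * t n * awBasis p x (p * a) n * h1
  have hmid : ∀ k ∈ range n, Y k = Y' k - (X k * awBasis p x (p * a) k + Z k) := by
    intro k hk
    obtain ⟨m, rfl⟩ := Nat.exists_eq_add_of_lt (mem_range.1 hk)
    have e1 (y : S) : p ^ k * (p * a * y) = p * (p ^ k * (a * y)) := by ring
    have e2 (y : S) : p ^ (k + 1) * (a * y) = p * (p ^ k * (a * y)) := by ring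
    have e3 (y : S) : p ^ k * (a * (p * y)) = p * (p ^ k * (a * y)) := by ring
    have h1 := ht k
    have hE := poch_mul_last (p := p) e k
    simp only [hY, hY', hX, hZ, awTerm, e1, e2, e3, show k + m + 1 - k = m + 1 by omega,
      show k + m + 1 + 1 - k = m + 1 + 1 by omega,
      show k + m + 1 + 1 - (k + 1) = m + 1 by omega,
      show k + m + 1 - (k + 1) = m by omega, poch_succ' (p ^ k * (a * b)),
      poch_succ' (p ^ k * (a * c)), poch_succ' (p * (p ^ k * (a * d))),
      poch_succ (p * (p * (p ^ k * (a * d)))), poch_succ e]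
    generalize poch (p * (p ^ k * (a * b))) p (m + 1) = B at *
    generalize poch (p * (p ^ k * (a * c))) p (m + 1) = C at *
    generalize poch (p * (p * (p ^ k * (a * d)))) p m = D at *
    generalize poch (p * e) p k = E at *
    generalize poch e p k = E' at *
    generalize awBasis p x (p * a) k = g at *
    have h2 : (1 - e) * E = E' * (1 - p ^ k * (p ^ (k + m + 1) * (a * b * c * d))) := by
      rw [← hE, he]
    rw [he] at h2 ⊢
    linear_combination (a - d) * p ^ k * t k * B * C * D * g *
        (1 - p ^ m * (p * (p * (p ^ k * (a * d))))) * h2 +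
      d * B * C * D * g * E' * (1 - p * p ^ k * a ^ 2) *
        (1 - p ^ k * (p ^ (k + m + 1) * (a * b * c * d))) * h1
  rw [hsum, awSum, awSum, mul_sum, mul_sum, sum_range_succ, sum_range_succ, sum_range_succ]
  change ∑ k ∈ range n, Y k + Y n = ∑ k ∈ range n, Y' k + Y' n - _
  rw [sum_congr rfl hmid, hlast, sum_sub_distrib, sum_add_distrib]
  ring

end Contiguous

/-! ### Units among the coefficient functions -/

section Functions
variable {q : ℝ}

theorem qexp_zero_zero (q : ℝ) : qexp q 0 0 = 1 := by
  refine congrArg Mer.mk (Subtype.ext (funext fun z => ?_))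
  change Complex.exp _ = 1
  simp

theorem qexp_ne_zero (q : ℝ) (c d : ℤ) : qexp q c d ≠ 0 := by
  have h : qexp q c d * qexp q (-c) (-d) = 1 := by
    rw [qexp_mul, add_neg_cancel, add_neg_cancel, qexp_zero_zero]
  exact left_ne_zero_of_mul_eq_one h

theorem one_sub_qexp_ne_zero (h0 : 0 < q) (h1 : q < 1) {m : ℤ} (hm : m = 2 ∨ m = -2) (d : ℤ) :
    1 - qexp q m d ≠ 0 := by
  rcases hm with rfl | rfl
  · rw [← neg_sub]; exact neg_ne_zero.2 (qexp_sub_one_ne_zero q h0 h1 d)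
  · have : 1 - qexp q (-2) d = qexp q (-2) d * (qexp q 2 (-d) - 1) := by
      rw [mul_sub, qexp_mul, mul_one]; simp [qexp_zero_zero]
    rw [this]
    exact mul_ne_zero (qexp_ne_zero _ _ _) (qexp_sub_one_ne_zero q h0 h1 _)

variable (q) in
/-- The function `q^{z+d} - q^{-z-d}`. -/
def brk (d : ℤ) : Mer := qexp q 1 d - qexp q (-1) (-d)

theorem brk_ne_zero (h0 : 0 < q) (h1 : q < 1) (d : ℤ) : brk q d ≠ 0 := by
  have : brk q d = qexp q (-1) (-d) * (qexp q 2 (2 * d) - 1) := by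
    rw [brk, mul_sub, qexp_mul, mul_one]; congr 2; ring
  rw [this]
  exact mul_ne_zero (qexp_ne_zero _ _ _) (qexp_sub_one_ne_zero q h0 h1 _)

theorem shift_brk (q : ℝ) (a d : ℤ) : Mer.shift a (brk q d) = brk q (d + a) := by
  rw [brk, map_sub, shift_qexp, shift_qexp, brk]; congr 2 <;> ring

/-- With `[z] = q^z - q^{-z}`, `q F(z) = [z + 2] / [z + 1]`. -/
theorem cf_eq_brk (h0 : 0 < q) (h1 : q < 1) : cf q = brk q 2 / brk q 1 := by
  have h := brk_ne_zero h0 h1 1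
  have h2 := qexp_sub_one_ne_zero q h0 h1 2
  have hq : (algebraMap ℂ Mer (q : ℂ)) = qexp q 0 1 := by rw [qexp_const q h0, zpow_one]
  rw [cf, funF, Algebra.smul_def, hq, ← qexp_const q h0, eq_div_iff h, mul_div_assoc',
    div_mul_eq_mul_div,
    div_eq_iff h2, brk, brk]
  simp only [mul_sub, sub_mul, qexp_mul, mul_one]
  norm_num

/-- With `[z] = q^z - q^{-z}`, `q⁻¹ / F(z - 1) = [z] / [z + 1]`. -/
theorem ce_eq_brk (h0 : 0 < q) (h1 : q < 1) : ce q = brk q 0 / brk q 1 := by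
  have h := brk_ne_zero h0 h1 1
  have h' := brk_ne_zero h0 h1 0
  have hq : algebraMap ℂ Mer ((q : ℂ)⁻¹) = qexp q 0 (-1) := by rw [qexp_const q h0, zpow_neg_one]
  have e : Mer.shift (-1) (funF q) = qexp q 0 (-1) * (brk q 1 / brk q 0) := by
    have h3 : funF q = qexp q 0 (-1) * cf q := by
      rw [cf, ← hq, ← Algebra.smul_def, smul_smul, inv_mul_cancel₀ (q_ne_zero q h0), one_smul]
    have h4 := shift_qexp q 0 (-1) (-1)
    have h5 := shift_brk q (-1) 2
    have h6 := shift_brk q (-1) 1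
    push_cast at h4 h5 h6
    rw [h3, cf_eq_brk h0 h1, map_mul, map_div₀, h4, h5, h6]
  have hz := qexp_ne_zero q 0 (-1)
  rw [ce, e, Algebra.smul_def, hq]
  field_simp

theorem qexp₂_mul (q : ℝ) (a b c a' b' c' : ℤ) : FRSL2.qexp₂ q a b c * FRSL2.qexp₂ q a' b' c' =
    FRSL2.qexp₂ q (a + a') (b + b') (c + c') := by
  rw [FRSL2.qexp₂, FRSL2.qexp₂, FRSL2.qexp₂, Algebra.TensorProduct.tmul_mul_tmul, qexp_mul,
    qexp_mul, add_zero]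

theorem algebraMap_zpow_eq (h0 : 0 < q) (d : ℤ) :
    algebraMap ℂ (Mer ⊗[ℂ] Mer) ((q : ℂ) ^ d) = FRSL2.qexp₂ q 0 0 d := by
  rw [FRSL2.qexp₂, qexp_zero_zero, qexp_const q h0, Algebra.TensorProduct.algebraMap_apply]

theorem qexp₂_zero (q : ℝ) : FRSL2.qexp₂ q 0 0 0 = 1 := by
  rw [FRSL2.qexp₂, qexp_zero_zero]; rfl

theorem qexp₂_pow (q : ℝ) (a b c : ℤ) (n : ℕ) :
    FRSL2.qexp₂ q a b c ^ n = FRSL2.qexp₂ q (n * a) (n * b) (n * c) := by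
  induction n with
  | zero => simp [qexp₂_zero]
  | succ n ih => rw [pow_succ, ih, qexp₂_mul]; push_cast; congr 1 <;> ring

theorem isUnit_qexp₂ (q : ℝ) (a b c : ℤ) : IsUnit (FRSL2.qexp₂ q a b c) :=
  IsUnit.of_mul_eq_one (FRSL2.qexp₂ q (-a) (-b) (-c)) (by rw [qexp₂_mul]; simp [qexp₂_zero])

theorem isUnit_tmul_one {f : Mer} (hf : f ≠ 0) : IsUnit (f ⊗ₜ[ℂ] (1 : Mer)) :=
  (IsUnit.mk0 f hf).map (Algebra.TensorProduct.includeLeft : Mer →ₐ[ℂ] Mer ⊗[ℂ] Mer)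

theorem isUnit_one_tmul {f : Mer} (hf : f ≠ 0) : IsUnit ((1 : Mer) ⊗ₜ[ℂ] f) :=
  (IsUnit.mk0 f hf).map (Algebra.TensorProduct.includeRight : Mer →ₐ[ℂ] Mer ⊗[ℂ] Mer)

variable (q) in
/-- The function `q^{λ+d} - q^{-λ-d}` of two variables. -/
def brkL (d : ℤ) : Mer ⊗[ℂ] Mer := brk q d ⊗ₜ 1

variable (q) in
/-- The function `q^{μ+d} - q^{-μ-d}` of two variables. -/
def brkR (d : ℤ) : Mer ⊗[ℂ] Mer := 1 ⊗ₜ brk q d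

theorem isUnit_brkL (h0 : 0 < q) (h1 : q < 1) (d : ℤ) : IsUnit (brkL q d) :=
  isUnit_tmul_one (brk_ne_zero h0 h1 d)

theorem isUnit_brkR (h0 : 0 < q) (h1 : q < 1) (d : ℤ) : IsUnit (brkR q d) :=
  isUnit_one_tmul (brk_ne_zero h0 h1 d)

theorem brkL_eq (q : ℝ) (d : ℤ) : brkL q d = FRSL2.qexp₂ q 1 0 d - FRSL2.qexp₂ q (-1) 0 (-d) := by
  rw [brkL, brk, TensorProduct.sub_tmul, FRSL2.qexp₂, FRSL2.qexp₂, qexp_zero_zero]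

theorem qexp₂_eq_one_tmul (h0 : 0 < q) (b c : ℤ) : FRSL2.qexp₂ q 0 b c = 1 ⊗ₜ qexp q b c := by
  rw [FRSL2.qexp₂, qexp_const q h0, Algebra.algebraMap_eq_smul_one, TensorProduct.smul_tmul,
    Algebra.smul_def, ← qexp_const q h0, qexp_mul, zero_add, add_zero]

theorem brkR_eq (h0 : 0 < q) (d : ℤ) :
    brkR q d = FRSL2.qexp₂ q 0 1 d - FRSL2.qexp₂ q 0 (-1) (-d) := by
  rw [brkR, brk, TensorProduct.tmul_sub, qexp₂_eq_one_tmul h0, qexp₂_eq_one_tmul h0]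

theorem isUnit_one_sub_qexp₂_left (h0 : 0 < q) (h1 : q < 1) {m : ℤ} (hm : m = 2 ∨ m = -2) (d : ℤ) :
    IsUnit (1 - FRSL2.qexp₂ q m 0 d) := by
  have : 1 - FRSL2.qexp₂ q m 0 d = (1 - qexp q m d) ⊗ₜ 1 := by
    rw [TensorProduct.sub_tmul, FRSL2.qexp₂, qexp_zero_zero]; rfl
  rw [this]
  exact isUnit_tmul_one (one_sub_qexp_ne_zero h0 h1 hm d)

theorem isUnit_one_sub_qexp₂_right (h0 : 0 < q) (h1 : q < 1) {m : ℤ} (hm : m = 2 ∨ m = -2)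
    (d : ℤ) : IsUnit (1 - FRSL2.qexp₂ q 0 m d) := by
  have : 1 - FRSL2.qexp₂ q 0 m d = 1 ⊗ₜ (1 - qexp q m d) := by
    rw [TensorProduct.tmul_sub, qexp₂_eq_one_tmul h0]; rfl
  rw [this]
  exact isUnit_one_tmul (one_sub_qexp_ne_zero h0 h1 hm d)

end Functions

/-! ### The Askey-Wilson polynomials without denominators -/

section Spec
open Polynomial Finset

theorem map_poch {S S' : Type*} [CommRing S] [CommRing S'] (f : S →+* S') (a p : S) (k : ℕ) :
    f (poch a p k) = poch (f a) (f p) k := by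
  simp [poch, map_prod]

theorem poch_add {S : Type*} [CommRing S] (a p : S) (k m : ℕ) :
    poch a p (k + m) = poch a p k * poch (p ^ k * a) p m := by
  rw [poch, prod_range_add, poch, poch]
  congr 1
  exact prod_congr rfl fun j _ => by rw [pow_add]; ring

variable {R : Type*} [CommRing R] [Algebra ℂ R]

theorem qPoch_eq_poch (a : R) (p : ℂ) (k : ℕ) : qPoch a p k = poch a (algebraMap ℂ R p) k :=
  prod_congr rfl fun j _ => by rw [Algebra.smul_def, map_pow]

theorem awMonomial_eq_awBasis (a : R) (p : ℂ) (k : ℕ) :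
    awMonomial a p k = awBasis (algebraMap ℂ R[X] p) X (C a) k := by
  refine prod_congr rfl fun j _ => ?_
  rw [awFactor, Algebra.smul_def, Algebra.smul_def, C_mul, C_mul, ← Polynomial.algebraMap_apply,
    ← Polynomial.algebraMap_apply, map_mul, map_pow, map_pow, C_pow, map_ofNat]
  ring

/-- The coefficient `(p^{-n}; p)_k p^k / (p; p)_k` of the Askey-Wilson series. -/
def awRow (p : ℂ) (n k : ℕ) : ℂ := poch (p ^ (-(n : ℤ))) p k / poch p p k * p ^ k

/-- The polynomial `a^n p_n` in division-free form. -/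
theorem askeyWilson_eq_awSum (n : ℕ) {a b c d : R} (p : ℂ) (ha : IsUnit a)
    (hab : IsUnit (poch (a * b) (algebraMap ℂ R p) n))
    (hac : IsUnit (poch (a * c) (algebraMap ℂ R p) n))
    (had : IsUnit (poch (a * d) (algebraMap ℂ R p) n)) :
    C (a ^ n) * askeyWilson n a b c d p =
      awSum (algebraMap ℂ R[X] p) (fun k => algebraMap ℂ R[X] (awRow p n k)) n
        (C (algebraMap ℂ R (p ^ ((n : ℤ) - 1)) * (a * b * c * d))) (C a) (C b) (C c) (C d) X := by
  have hinv : a ^ n * Ring.inverse (a ^ n) = 1 := Ring.mul_inverse_cancel _ (ha.pow n)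
  rw [askeyWilson, ← mul_assoc, ← C_mul, awSum, mul_sum]
  refine sum_congr rfl fun k hk => ?_
  obtain ⟨m, rfl⟩ := Nat.exists_eq_add_of_le (Nat.lt_succ_iff.1 (mem_range.1 hk))
  have e (y : R) : poch (algebraMap ℂ R[X] p ^ k * C y) (algebraMap ℂ R[X] p) m =
      C (poch (algebraMap ℂ R p ^ k * y) (algebraMap ℂ R p) m) := by
    rw [map_poch, C_mul, C_pow]; rfl
  have e' (y : R) : poch (C y) (algebraMap ℂ R[X] p) k = C (poch y (algebraMap ℂ R p) k) := by
    rw [map_poch]; rfl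
  rw [awTerm, awMonomial_eq_awBasis, Nat.add_sub_cancel_left, ← C_mul, ← C_mul, ← C_mul, e, e, e,
    e', ← mul_assoc, ← C_mul, Polynomial.algebraMap_apply (awRow p (k + m) k), ← C_mul, ← C_mul,
      ← C_mul, ← C_mul]
  congr 2
  simp only [qPoch_eq_poch, poch_add _ _ k m, Algebra.smul_def] at *
  have hx := Ring.mul_inverse_cancel (poch (a * b) (algebraMap ℂ R p) k *
    poch (a * c) (algebraMap ℂ R p) k * poch (a * d) (algebraMap ℂ R p) k)
    (((isUnit_of_mul_isUnit_left hab).mul (isUnit_of_mul_isUnit_left hac)).mul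
      (isUnit_of_mul_isUnit_left had))
  generalize Ring.inverse (poch (a * b) (algebraMap ℂ R p) k *
    poch (a * c) (algebraMap ℂ R p) k * poch (a * d) (algebraMap ℂ R p) k) = x at *
  have hr : poch (p ^ (-((k + m : ℕ) : ℤ))) ((algebraMap ℂ ℂ) p) k / poch p ((algebraMap ℂ ℂ) p) k *
    p ^ k
    = awRow p (k + m) k := rfl
  rw [hr]
  generalize Ring.inverse (a ^ (k + m)) = y at *
  linear_combination (algebraMap ℂ R (awRow p (k + m) k)) *
    poch (algebraMap ℂ R (p ^ (((k + m : ℕ) : ℤ) - 1)) * (a * b * c * d)) (algebraMap ℂ R p) k *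
    poch (algebraMap ℂ R p ^ k * (a * b)) (algebraMap ℂ R p) m *
    poch (algebraMap ℂ R p ^ k * (a * c)) (algebraMap ℂ R p) m *
    poch (algebraMap ℂ R p ^ k * (a * d)) (algebraMap ℂ R p) m *
    (a ^ (k + m) * y * hx + hinv)

variable {p : ℂ}

theorem poch_self_ne_zero (hp : ∀ k : ℕ, p ^ (k + 1) ≠ 1) (k : ℕ) : poch p p k ≠ 0 :=
  prod_ne_zero_iff.2 fun j _ => by
    rw [← pow_succ]; exact sub_ne_zero.2 (hp j).symm

/-- The quotients `awRow p (n + 1) k / (p^k (p^{n+1} - 1))`, in terms of which consecutive rows of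
coefficients are polynomial. -/
def awRowQuot (p : ℂ) (n k : ℕ) : ℂ := awRow p (n + 1) k / (p ^ k * (p ^ (n + 1) - 1))

theorem awRow_succ_eq (hp0 : p ≠ 0) (hp : ∀ k : ℕ, p ^ (k + 1) ≠ 1) (n k : ℕ) :
    awRow p (n + 1) k = (p * p ^ n - 1) * p ^ k * awRowQuot p n k := by
  have h1 := sub_ne_zero.2 (hp n)
  have h2 := pow_ne_zero k hp0
  rw [awRowQuot, ← pow_succ']
  field_simp

theorem awRow_eq (hp0 : p ≠ 0) (hp : ∀ k : ℕ, p ^ (k + 1) ≠ 1) (n k : ℕ) :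
    awRow p n k = (p * p ^ n - p ^ k) * p ^ k * awRowQuot p n k := by
  have h1 := sub_ne_zero.2 (hp n)
  have h2 := pow_ne_zero k hp0
  have h3 := pow_ne_zero (n + 1) hp0
  have h4 := poch_mul_last (p := p) (p ^ (-((n + 1 : ℕ) : ℤ))) k
  have h5 : p * p ^ (-((n + 1 : ℕ) : ℤ)) = p ^ (-(n : ℤ)) := by
    rw [← zpow_one_add₀ hp0]; congr 1; push_cast; ring
  have h6 := poch_self_ne_zero hp k
  rw [h5] at h4
  rw [awRowQuot, awRow, awRow]
  have h7 : p ^ (n + 1) * p ^ (-((n + 1 : ℕ) : ℤ)) = 1 := by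
    rw [zpow_neg, zpow_natCast, mul_inv_cancel₀ h3]
  have h8 : (p * p ^ n - p ^ k) * poch (p ^ (-((n + 1 : ℕ) : ℤ))) p k =
      (p ^ (n + 1) - 1) * poch (p ^ (-(n : ℤ))) p k := by
    linear_combination p ^ (n + 1) * h4 +
      (poch (p ^ (-((n + 1 : ℕ) : ℤ))) p k * p ^ k - poch (p ^ (-(n : ℤ))) p k) * h7
  generalize poch (p ^ (-((n + 1 : ℕ) : ℤ))) p k = u at *
  generalize poch (p ^ (-(n : ℤ))) p k = v at *
  field_simp
  linear_combination -h8

/-- The ratio of consecutive coefficients of the Askey-Wilson series. -/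
theorem awRow_succ_right (hp0 : p ≠ 0) (hp : ∀ k : ℕ, p ^ (k + 1) ≠ 1) (n k : ℕ) :
    p ^ n * (1 - p ^ (k + 1)) * awRow p n (k + 1) = p * (p ^ n - p ^ k) * awRow p n k := by
  have h1 := sub_ne_zero.2 (hp k).symm
  have h2 := pow_ne_zero n hp0
  have h6 := poch_self_ne_zero hp k
  rw [pow_succ] at h1
  rw [awRow, awRow, poch_succ, poch_succ, zpow_neg, zpow_natCast]
  field_simp
  ring

theorem awRowQuot_succ (hp0 : p ≠ 0) (hp : ∀ k : ℕ, p ^ (k + 1) ≠ 1) (n k : ℕ) :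
    (p * p ^ n - p ^ k) * awRowQuot p n k =
      p ^ n * (1 - p ^ (k + 1)) * p * awRowQuot p n (k + 1) := by
  have h1 := sub_ne_zero.2 (hp n)
  have h2 := pow_ne_zero k hp0
  have h := awRow_succ_right hp0 hp (n + 1) k
  rw [awRowQuot, awRowQuot, mul_div_assoc', mul_div_assoc', div_eq_div_iff (mul_ne_zero h2 h1)
    (mul_ne_zero (pow_ne_zero _ hp0) h1)]
  linear_combination -(p ^ k * (p ^ (n + 1) - 1)) * h

end Spec

/-! ### Contiguous relations of Askey-Wilson polynomials -/

section Polys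
open Polynomial Finset

variable {S : Type*} [CommRing S] [Algebra ℂ S]

/-- The sum `a^n p_n(x; a, b, c, d; p)`, polynomial in all its arguments. -/
def awQ (p : ℂ) (n : ℕ) (a b c d x : S) : S :=
  awSum (algebraMap ℂ S p) (fun k => algebraMap ℂ S (awRow p n k)) n
    (algebraMap ℂ S (p ^ ((n : ℤ) - 1)) * (a * b * c * d)) a b c d x

variable {p : ℂ}

theorem algebraMap_zpow_sub_one_mul (hp0 : p ≠ 0) (n : ℕ) (y : S) :
    algebraMap ℂ S (p ^ ((n : ℤ) - 1)) * (algebraMap ℂ S p * y) = algebraMap ℂ S p ^ n * y := by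
  rw [← mul_assoc, ← map_mul, ← zpow_add_one₀ hp0, sub_add_cancel, zpow_natCast, map_pow]

theorem awQ_contiguous_bc (hp0 : p ≠ 0) (hp : ∀ k : ℕ, p ^ (k + 1) ≠ 1) (n : ℕ)
    (a b c d x : S) {P : S} (hP : P = algebraMap ℂ S p) :
    (c - b) * awQ p (n + 1) a b c d x =
      a * ((1 - P ^ n * (c * d)) * (1 - P ^ n * (a * c)) * awFactor x b *
          awQ p n a (P * b) c d x -
        (1 - P ^ n * (a * b)) * (1 - P ^ n * (b * d)) * awFactor x c *
          awQ p n a b (P * c) d x) := by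
  have h := awSum_contiguous_bc (p := P) (t := fun k => algebraMap ℂ S (awRowQuot p n k)) (n := n)
    a b c d x _ (fun k => by
      have := congrArg (algebraMap ℂ S) (awRowQuot_succ hp0 hp n k)
      simpa [hP] using this) rfl
  have e1 := algebraMap_zpow_sub_one_mul hp0 (n + 1) (S := S)
  have e0 := algebraMap_zpow_sub_one_mul hp0 n (S := S)
  have r1 (k : ℕ) := congrArg (algebraMap ℂ S) (awRow_succ_eq hp0 hp n k)
  have r0 (k : ℕ) := congrArg (algebraMap ℂ S) (awRow_eq hp0 hp n k)
  simp only [map_mul, map_sub, map_one, map_pow] at r1 r0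
  subst hP
  simp only [awQ, r1, r0, show a * (algebraMap ℂ S p * b) * c * d =
    algebraMap ℂ S p * (a * b * c * d) by ring, show a * b * (algebraMap ℂ S p * c) * d =
    algebraMap ℂ S p * (a * b * c * d) by ring, e0]
  rw [show ((n + 1 : ℕ) : ℤ) - 1 = n by push_cast; ring, zpow_natCast, map_pow]
  exact h

theorem awQ_contiguous_bd (hp0 : p ≠ 0) (hp : ∀ k : ℕ, p ^ (k + 1) ≠ 1) (n : ℕ)
    (a b c d x : S) {P : S} (hP : P = algebraMap ℂ S p) :
    (1 - b * d) * awQ p (n + 1) a b c (P * d) x -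
      (1 - P * P ^ n * (b * d)) * awQ p (n + 1) a b c d x =
      a * d * (1 - P * P ^ n) * (1 - P ^ n * (a * c)) * awFactor x b *
        awQ p n a (P * b) c (P * d) x := by
  have h := awSum_contiguous_bd (p := P) (t := fun k => algebraMap ℂ S (awRowQuot p n k)) (n := n)
    a b c d x _ (fun k => by
      have := congrArg (algebraMap ℂ S) (awRowQuot_succ hp0 hp n k)
      simpa [hP] using this) rfl
  have e0 := algebraMap_zpow_sub_one_mul hp0 n (S := S)
  have r1 (k : ℕ) := congrArg (algebraMap ℂ S) (awRow_succ_eq hp0 hp n k)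
  have r0 (k : ℕ) := congrArg (algebraMap ℂ S) (awRow_eq hp0 hp n k)
  simp only [map_mul, map_sub, map_one, map_pow] at r1 r0
  subst hP
  simp only [awQ, r1, r0, show a * (algebraMap ℂ S p * b) * c * (algebraMap ℂ S p * d) =
    algebraMap ℂ S p * (algebraMap ℂ S p * (a * b * c * d)) by ring, e0]
  rw [show ((n + 1 : ℕ) : ℤ) - 1 = n by push_cast; ring, zpow_natCast, map_pow,
    show a * b * c * (algebraMap ℂ S p * d) = algebraMap ℂ S p * (a * b * c * d) by ring,
    mul_left_comm (algebraMap ℂ S p ^ n)]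
  exact h

theorem awQ_contiguous_ac (hp0 : p ≠ 0) (hp : ∀ k : ℕ, p ^ (k + 1) ≠ 1) (n : ℕ)
    (a b c d x : S) {P : S} (hP : P = algebraMap ℂ S p) :
    (1 - a * c) * awQ p (n + 1) (P * a) b c d x -
      P ^ (n + 1) * (1 - P * P ^ n * (a * c)) * awQ p (n + 1) a b c d x =
      P * a ^ 2 * (1 - P * P ^ n) * (1 - P ^ n * (b * d)) * awFactor x c *
        awQ p n (P * a) b (P * c) d x := by
  have h := awSum_contiguous_ac (p := P) (t := fun k => algebraMap ℂ S (awRowQuot p n k)) (n := n)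
    a b c d x _ (fun k => by
      have := congrArg (algebraMap ℂ S) (awRowQuot_succ hp0 hp n k)
      simpa [hP] using this) rfl
  have e0 := algebraMap_zpow_sub_one_mul hp0 n (S := S)
  have r1 (k : ℕ) := congrArg (algebraMap ℂ S) (awRow_succ_eq hp0 hp n k)
  have r0 (k : ℕ) := congrArg (algebraMap ℂ S) (awRow_eq hp0 hp n k)
  simp only [map_mul, map_sub, map_one, map_pow] at r1 r0
  subst hP
  simp only [awQ, r1, r0, show algebraMap ℂ S p * a * b * (algebraMap ℂ S p * c) * d =
    algebraMap ℂ S p * (algebraMap ℂ S p * (a * b * c * d)) by ring, e0]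
  rw [show ((n + 1 : ℕ) : ℤ) - 1 = n by push_cast; ring, zpow_natCast, map_pow,
    show algebraMap ℂ S p * a * b * c * d = algebraMap ℂ S p * (a * b * c * d) by ring,
    mul_left_comm (algebraMap ℂ S p ^ n)]
  exact h

theorem awQ_contiguous_ad (hp0 : p ≠ 0) (hp : ∀ k : ℕ, p ^ (k + 1) ≠ 1) (n : ℕ)
    (a b c d x : S) {P : S} (hP : P = algebraMap ℂ S p) :
    (a - d) * (1 - P ^ n * (a * b * c * d)) * awQ p n (P * a) b c (P * d) x =
      a * (1 - P ^ n * (c * d)) * (1 - P ^ n * (b * d)) * awQ p n (P * a) b c d x -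
      d * P ^ n * (1 - P ^ n * (a * b)) * (1 - P ^ n * (a * c)) * awQ p n a b c (P * d) x := by
  have hr (k : ℕ) : algebraMap ℂ S (awRow p n k) = P ^ k *
    algebraMap ℂ S (awRow p n k / p ^ k) := by
    rw [hP, ← map_pow, ← map_mul, mul_div_cancel₀ _ (pow_ne_zero k hp0)]
  have h := awSum_contiguous_ad (p := P) (t := fun k => algebraMap ℂ S (awRow p n k / p ^ k))
    (n := n) a b c d x _ (fun k => by
      have : (p ^ n - p ^ k) * (awRow p n k / p ^ k) =
          p ^ n * (1 - p ^ (k + 1)) * (awRow p n (k + 1) / p ^ (k + 1)) := by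
        have h1 := awRow_succ_right hp0 hp n k
        have h2 := pow_ne_zero k hp0
        rw [mul_div_assoc', mul_div_assoc', div_eq_div_iff h2 (pow_ne_zero _ hp0)]
        linear_combination -p ^ k * h1
      have := congrArg (algebraMap ℂ S) this
      simpa [hP] using this) rfl
  have e0 := algebraMap_zpow_sub_one_mul hp0 n (S := S)
  subst hP
  simp only [awQ, show algebraMap ℂ S p * a * b * c * (algebraMap ℂ S p * d) =
    algebraMap ℂ S p * (algebraMap ℂ S p * (a * b * c * d)) by ring,
    show a * b * c * (algebraMap ℂ S p * d) = algebraMap ℂ S p * (a * b * c * d) by ring,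
    show algebraMap ℂ S p * a * b * c * d = algebraMap ℂ S p * (a * b * c * d) by ring, e0]
  simp only [hr]
  rw [mul_left_comm (algebraMap ℂ S p ^ n) (algebraMap ℂ S p)]
  exact h

end Polys

/-! ### The polynomials representing `P_n` -/

section Coefficients
open Polynomial Finset

variable {q : ℝ}

theorem q_sq_ne_zero (h0 : 0 < q) : (q : ℂ) ^ 2 ≠ 0 := pow_ne_zero 2 (q_ne_zero q h0)

theorem q_sq_pow_ne_one (h0 : 0 < q) (h1 : q < 1) (k : ℕ) : ((q : ℂ) ^ 2) ^ (k + 1) ≠ 1 := by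
  rw [← pow_mul]
  exact_mod_cast (pow_lt_one₀ h0.le h1 (by omega)).ne

theorem algebraMap_pow_eq (h0 : 0 < q) (n : ℕ) :
    algebraMap ℂ (Mer ⊗[ℂ] Mer) ((q : ℂ) ^ 2) ^ n = FRSL2.qexp₂ q 0 0 (2 * n) := by
  rw [← map_pow, ← pow_mul, ← zpow_natCast, algebraMap_zpow_eq h0]; push_cast; rfl

theorem isUnit_poch {S : Type*} [CommRing S] {a p : S} {n : ℕ}
    (h : ∀ k < n, IsUnit (1 - p ^ k * a)) : IsUnit (poch a p n) := by
  induction n with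
  | zero => simp
  | succ n ih =>
    rw [poch_succ]
    exact (ih fun k hk => h k (by omega)).mul (h n (by omega))

theorem isUnit_poch_left (h0 : 0 < q) (h1 : q < 1) {m : ℤ} (hm : m = 2 ∨ m = -2) (d : ℤ) (n : ℕ) :
    IsUnit (poch (FRSL2.qexp₂ q m 0 d) (algebraMap ℂ (Mer ⊗[ℂ] Mer) ((q : ℂ) ^ 2)) n) :=
  isUnit_poch fun k _ => by
    rw [algebraMap_pow_eq h0, qexp₂_mul, zero_add, zero_add]
    exact isUnit_one_sub_qexp₂_left h0 h1 hm _

theorem isUnit_poch_right (h0 : 0 < q) (h1 : q < 1) {m : ℤ} (hm : m = 2 ∨ m = -2) (d : ℤ) (n : ℕ) :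
    IsUnit (poch (FRSL2.qexp₂ q 0 m d) (algebraMap ℂ (Mer ⊗[ℂ] Mer) ((q : ℂ) ^ 2)) n) :=
  isUnit_poch fun k _ => by
    rw [algebraMap_pow_eq h0, qexp₂_mul, zero_add, zero_add]
    exact isUnit_one_sub_qexp₂_right h0 h1 hm _

theorem isUnit_one_sub_const (h0 : 0 < q) (h1 : q < 1) (n : ℕ) :
    IsUnit (1 - FRSL2.qexp₂ q 0 0 (2 * (n + 1))) := by
  have : FRSL2.qexp₂ q 0 0 (2 * (n + 1)) =
      algebraMap ℂ (Mer ⊗[ℂ] Mer) (((q : ℂ) ^ 2) ^ (n + 1)) := by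
    rw [map_pow, algebraMap_pow_eq h0]; push_cast; rfl
  rw [this, ← map_one (algebraMap ℂ (Mer ⊗[ℂ] Mer)), ← map_sub]
  exact (IsUnit.mk0 _ (sub_ne_zero.2 (q_sq_pow_ne_one h0 h1 n).symm)).map _

theorem isUnit_poch_const (h0 : 0 < q) (h1 : q < 1) (s n : ℕ) :
    IsUnit (poch (FRSL2.qexp₂ q 0 0 (2 * (s + 1))) (algebraMap ℂ (Mer ⊗[ℂ] Mer) ((q : ℂ) ^ 2)) n) :=
  isUnit_poch fun k _ => by
    rw [algebraMap_pow_eq h0, qexp₂_mul, zero_add]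
    have := isUnit_one_sub_const h0 h1 (s + k)
    convert this using 3
    push_cast; ring

variable (q) in
/-- The polynomial in `x` whose value at `Ξ / 2` is `P_n`. -/
def pPoly (n N k j : ℕ) : (Mer ⊗[ℂ] Mer)[X] :=
  C (FRSL2.prefactor q n N k j) * FRSL2.awPoly q n N k j

variable (q) in
/-- The first Askey-Wilson parameter `q^{μ-λ+1+2s}`. -/
def pa (s : ℤ) : Mer ⊗[ℂ] Mer := FRSL2.qexp₂ q (-1) 1 (1 + 2 * s)
variable (q) in
/-- The second Askey-Wilson parameter `q^{λ-μ+1}`. -/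
def pb : Mer ⊗[ℂ] Mer := FRSL2.qexp₂ q 1 (-1) 1
variable (q) in
/-- The third Askey-Wilson parameter `q^{λ+μ+3}`. -/
def pc : Mer ⊗[ℂ] Mer := FRSL2.qexp₂ q 1 1 3
variable (q) in
/-- The fourth Askey-Wilson parameter `q^{-λ-μ-1+2r}`. -/
def pd (r : ℤ) : Mer ⊗[ℂ] Mer := FRSL2.qexp₂ q (-1) (-1) (-1 + 2 * r)

variable (q) in
/-- The constant `q^{n(n+r)+j(j-N)} (q²;q²)_{N-n} / ((q²;q²)_j (q²;q²)_{N-j})`. -/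
def pConst (n N j r : ℕ) : ℂ :=
  (q : ℂ) ^ ((n * (n + r) + j * (j - N) : ℤ)) *
    (poch ((q : ℂ) ^ 2) ((q : ℂ) ^ 2) (N - n) /
      (poch ((q : ℂ) ^ 2) ((q : ℂ) ^ 2) j * poch ((q : ℂ) ^ 2) ((q : ℂ) ^ 2) (N - j)))

/-- The polynomial `pPoly` cleared of the denominators `(bc, bd; q²)_n` and `a^n`. These are units,
so that identities between the `pPoly` can be checked on the right-hand sides. -/
theorem pPoly_spec (h0 : 0 < q) (h1 : q < 1) (n N k j s r : ℕ) (hs : |(j : ℤ) - k| = s)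
    (hr : |(N : ℤ) - k - j| = r) {P : (Mer ⊗[ℂ] Mer)[X]} (hP : P = algebraMap ℂ _ ((q : ℂ) ^ 2)) :
    poch (C (pb q) * C (pc q)) P n * poch (C (pb q) * C (pd q r)) P n * C (pa q s) ^ n *
        pPoly q n N k j =
      algebraMap ℂ _ (pConst q n N j r) * C (pb q) ^ n *
        awQ ((q : ℂ) ^ 2) n (C (pa q s)) (C (pb q)) (C (pc q)) (C (pd q r)) X := by
  set p' := algebraMap ℂ (Mer ⊗[ℂ] Mer) ((q : ℂ) ^ 2) with hp'
  have hab : pa q s * pb q = FRSL2.qexp₂ q 0 0 (2 * (s + 1)) := by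
    rw [pa, pb, qexp₂_mul]; congr 1; ring
  have hac : pa q s * pc q = FRSL2.qexp₂ q 0 2 (4 + 2 * s) := by
    rw [pa, pc, qexp₂_mul]; congr 1; ring
  have had : pa q s * pd q r = FRSL2.qexp₂ q (-2) 0 (2 * s + 2 * r) := by
    rw [pa, pd, qexp₂_mul]; congr 1; ring
  have hbc : pb q * pc q = FRSL2.qexp₂ q 2 0 4 := by
    rw [pb, pc, qexp₂_mul]; congr 1
  have hbd : pb q * pd q r = FRSL2.qexp₂ q 0 (-2) (2 * r) := by
    rw [pb, pd, qexp₂_mul]; congr 1; ring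
  have hQ := askeyWilson_eq_awSum n (a := pa q s) (b := pb q) (c := pc q) (d := pd q r)
    ((q : ℂ) ^ 2) (isUnit_qexp₂ _ _ _ _) (hab ▸ isUnit_poch_const h0 h1 s n)
    (hac ▸ isUnit_poch_right h0 h1 (.inl rfl) _ n) (had ▸ isUnit_poch_left h0 h1 (.inr rfl) _ n)
  have hu := Ring.mul_inverse_cancel _
    ((isUnit_poch_left h0 h1 (.inl rfl) 4 n).mul (isUnit_poch_right h0 h1 (.inr rfl) (2 * r) n))
  have e (y z : Mer ⊗[ℂ] Mer) : poch (C y * C z) P n = C (poch (y * z) p' n) := by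
    rw [map_poch, C_mul, hP]; rfl
  have hpre : FRSL2.qexp₂ q n (-n) (n * (1 + n + r) + j * (j - N)) =
      algebraMap ℂ _ ((q : ℂ) ^ ((n * (n + r) + j * (j - N) : ℤ))) * pb q ^ n := by
    rw [pb, qexp₂_pow, algebraMap_zpow_eq h0, qexp₂_mul]; congr 1 <;> ring
  rw [pPoly, FRSL2.awPoly, FRSL2.prefactor, hs, hr, e, e, hbc, hbd, hpre]
  simp only [qPoch_eq_poch]
  change _ * (_ * askeyWilson n (pa q s) (pb q) (pc q) (pd q r) _) = _ * awSum _ _ _ _ _ _ _ _ _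
  rw [show algebraMap ℂ (Mer ⊗[ℂ] Mer)[X] (((q : ℂ) ^ 2) ^ ((n : ℤ) - 1)) *
    (C (pa q s) * C (pb q) * C (pc q) * C (pd q r)) =
      C (algebraMap ℂ _ (((q : ℂ) ^ 2) ^ ((n : ℤ) - 1)) *
      (pa q s * pb q * pc q * pd q r)) by simp only [C_mul]; rfl, ← hQ]
  rw [Polynomial.algebraMap_apply, pConst, ← C_pow, ← C_pow, ← C_mul, ← C_mul, ← C_mul, ← mul_assoc,
    ← C_mul,
    ← mul_assoc (C _) (C _) (askeyWilson _ _ _ _ _ _), ← C_mul]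
  congr 2
  rw [map_mul]
  simp only [Algebra.algebraMap_self, RingHom.id_apply]
  linear_combination (pa q s ^ n * pb q ^ n * algebraMap ℂ _ ((q : ℂ) ^ ((n * (n + r) + j *
    (j - N) : ℤ))) *
    algebraMap ℂ _ (poch ((q : ℂ) ^ 2) ((q : ℂ) ^ 2) (N - n) /
      (poch ((q : ℂ) ^ 2) ((q : ℂ) ^ 2) j * poch ((q : ℂ) ^ 2) ((q : ℂ) ^ 2) (N - j)))) * hu

end Coefficients

/-! ### Normalized contiguous relations

A contiguous relation `hR` between values `Q` of `awQ` becomes a recursion between values `W` of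
`pPoly`: the hypotheses `hW` clear the denominators of the `W`, the `hκ` compare their constant
factors, the others identify the coefficients of the recursion, and `hU` provides the unit by which
the conclusion is multiplied to make it a consequence of `hR`. -/

section Cancel
variable {S : Type*} [CommRing S]

theorem recurrence_of_contiguous_bc {a b c d L M1 M0 Mr Mj pj v X1 X2 D A B Pn fb fc DA CB
      W W1 W2 Q Q1 Q2 κ κ1 κ2 : S}
    (hR : (c - b) * Q = a * ((1 - Pn * (c * d)) * (1 - Pn * (a * c)) * fb * Q2 -
      (1 - Pn * (a * b)) * (1 - Pn * (b * d)) * fc * Q1))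
    (hW : X1 * X2 * D * (a * A) * W = κ * (b * B) * Q)
    (hW1 : X2 * D * A * W1 = κ1 * B * (1 - Pn * (b * d)) * Q1)
    (hW2 : D * A * W2 = κ2 * (Pn * B) * Q2)
    (hκ1 : κ1 = κ * (1 - Pn * (a * b))) (hκ2 : v * κ2 * Pn = pj * κ * (1 - Pn * (c * d)))
    (hi : X2 * c * pj * Mj = -v * b * (1 - Pn * (a * c)) * Mr)
    (hii : b * c * L * M1 = -X1 * (c - b))
    (hDA : c * L * M1 * DA = fc) (hCB : b * L * M0 * CB = fb)
    (hU : IsUnit (b * c * L * pj * X2 * D * a * A)) :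
    M1 * Mr * W = M1 * Mr * DA * W1 + Mj * M0 * CB * W2 := by
  refine hU.mul_left_cancel ?_
  linear_combination (Mr * pj * X2 * D * a * A * W) * hii - (c - b) * Mr * pj * hW
    - (Mr * pj * κ * b * B) * hR - (b * Mr * pj * X2 * D * a * A * W1) * hDA
    - b * Mr * fc * pj * a * hW1 - b * Mr * fc * pj * a * B * (1 - Pn * (b * d)) * Q1 * hκ1
    - c * Mj * pj * X2 * D * a * A * W2 * hCB - c * fb * Mj * pj * X2 * a * hW2
    - fb * a * κ2 * Pn * B * Q2 * hi + b * (1 - Pn * (a * c)) * Mr * fb * a * B * Q2 * hκ2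

theorem recurrence_of_contiguous_bd {a b c d P L M0 Ma Mr Mk v X1 Y0 Y1 D A B Pn fb CB
      W W1 W2 Q Q1 Q2 κ κ1 κ2 : S}
    (hR : Y0 * Q - (1 - P * Pn * (b * d)) * Q1 =
      a * d * (1 - P * Pn) * (1 - Pn * (a * c)) * fb * Q2)
    (hW : X1 * Y1 * D * (a * A) * W = κ * (b * B) * Q)
    (hW1 : X1 * Y0 * Y1 * D * (a * A) * W1 = κ1 * (b * B) * (1 - P * Pn * (b * d)) * Q1)
    (hW2 : D * A * W2 = κ2 * (Pn * B) * Q2)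
    (hκ1 : κ1 = κ) (hκ2 : a * b * c * d * κ * (1 - P * Pn) = v * κ2)
    (hi : a * c * Pn * Mk * X1 * Y0 * Y1 = b * v * (1 - Pn * (a * c)) * L * Ma * Mr)
    (hCB : b * L * M0 * CB = fb)
    (hU : IsUnit (a * c * Pn * X1 * Y0 * Y1 * D * a * A)) :
    Ma * Mr * W = Ma * Mr * W1 + Mk * M0 * CB * W2 := by
  refine hU.mul_left_cancel ?_
  linear_combination Ma * Mr * a * c * Pn * Y0 * hW - Ma * Mr * a * c * Pn * hW1
    - Ma * Mr * a * c * Pn * b * B * (1 - P * Pn * (b * d)) * Q1 * hκ1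
    + Ma * Mr * a * c * Pn * κ * b * B * hR
    - M0 * CB * W2 * D * a * A * hi - v * (1 - Pn * (a * c)) * Ma * Mr * D * a * A * W2 * hCB
    - v * (1 - Pn * (a * c)) * Ma * Mr * fb * a * hW2
    + Ma * Mr * (1 - Pn * (a * c)) * fb * a * Pn * B * Q2 * hκ2

theorem recurrence_of_contiguous_ac {a b c d P L M1 Ms Mn v w X1 D A A' B Pm P1 fc DA
      W W1 W2 Q Q1 Q2 κ κ1 κ2 : S}
    (hR : (1 - a * c) * Q - P1 * (1 - P1 * (a * c)) * Q2 =
      P * a ^ 2 * (1 - P1) * (1 - Pm * (b * d)) * fc * Q1)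
    (hW : X1 * D * (P * a * A) * W = κ * (b * B) * Q)
    (hW1 : D * A * W1 = κ1 * B * (1 - Pm * (b * d)) * Q1)
    (hW2 : X1 * D * A' * W2 = κ2 * (b * B) * Q2)
    (hA : P * a * A = P1 * A') (hv : v * v = a * b)
    (hκ1 : κ1 = κ * v * (1 - P1)) (hκ2 : κ2 = w * κ)
    (hi : v * c * L * Ms = X1 * (1 - a * c)) (hii : w * v * c * L * Mn = X1 * (1 - P1 * (a * c)))
    (hDA : c * L * M1 * DA = fc)
    (hU : IsUnit (w * v * c * L * D * P * a * A)) :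
    Ms * W = M1 * DA * W1 + Mn * W2 := by
  refine hU.mul_left_cancel ?_
  linear_combination (w * D * P * a * A * W) * hi + w * (1 - a * c) * hW + w * κ * b * B * hR
    - (w * v * D * P * a * A * W1) * hDA - w * v * fc * P * a * hW1
    - w * v * fc * P * a * B * (1 - Pm * (b * d)) * Q1 * hκ1
    - w * P * a * fc * B * (1 - Pm * (b * d)) * Q1 * κ * (1 - P1) * hv
    - D * P * a * A * W2 * hii - X1 * (1 - P1 * (a * c)) * D * W2 * hA
    - (1 - P1 * (a * c)) * P1 * hW2 - (1 - P1 * (a * c)) * P1 * b * B * Q2 * hκ2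

theorem recurrence_of_contiguous_ad {a b c d Ms Mr Mn u v w D A A' B Pn
      W W1 W2 Q Q1 Q2 κ κ1 κ2 : S}
    (hR : (a - d) * (1 - Pn * (a * b * c * d)) * Q =
      a * (1 - Pn * (c * d)) * (1 - Pn * (b * d)) * Q1 -
      d * Pn * (1 - Pn * (a * b)) * (1 - Pn * (a * c)) * Q2)
    (hW : D * A * W = κ * B * Q)
    (hW1 : (1 - b * d) * D * A * W1 = κ1 * B * (1 - Pn * (b * d)) * Q1)
    (hW2 : D * A' * W2 = κ2 * B * Q2) (hA : A = Pn * A')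
    (hκ1 : κ1 * (1 - Pn * (a * b * c * d)) = v * κ * (1 - Pn * (c * d)))
    (hκ2 : w * κ2 * (1 - Pn * (a * b * c * d)) = c * d * Pn * κ * (1 - Pn * (a * b)))
    (hs : a * Ms = u * (a - d)) (hr : v * Mr = u * (1 - b * d))
    (hn : a * c * Pn * Mn = -u * w * (1 - Pn * (a * c)))
    (hU : IsUnit (a * v * c * Pn * (1 - Pn * (a * b * c * d)) * D * A)) :
    Ms * W = Mr * W1 + Mn * W2 := by
  refine hU.mul_left_cancel ?_
  set G := 1 - Pn * (a * b * c * d) with hG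
  linear_combination (v * c * Pn * G * D * A * W) * hs + v * c * Pn * u * (a - d) * G * hW
    + v * c * Pn * u * κ * B * hR - (a * c * Pn * G * D * A * W1) * hr - a * c * Pn * u * G * hW1
    - a * c * Pn * u * B * (1 - Pn * (b * d)) * Q1 * hκ1
    - (v * G * D * A * W2) * hn + v * G * u * w * (1 - Pn * (a * c)) * D * W2 * hA
    + v * G * u * w * (1 - Pn * (a * c)) * Pn * hW2 + v * u * (1 - Pn * (a * c)) * Pn * B * Q2 * hκ2

end Cancel

/-! ### Constants and coefficient functions of the four recursions

The four cases of the closed form are named after the monomials that occur in them: `γδ` for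
`k ≤ j`, `k + j ≤ N`, `γα` for `k ≤ j`, `N ≤ k + j`, `δβ` for `j ≤ k`, `k + j ≤ N`, and `αβ` for
`j ≤ k`, `N ≤ k + j`. Throughout, `s = |j - k|` and `r = |N - k - j|`. -/

section Constants
variable {q : ℝ}

theorem pConst_eq {n N j r x y : ℕ} (hx : N = x + n) (hy : N = y + j) :
    pConst q n N j r = (q : ℂ) ^ ((n * (n + r) - j * y : ℤ)) *
      (poch ((q : ℂ) ^ 2) ((q : ℂ) ^ 2) x /
        (poch ((q : ℂ) ^ 2) ((q : ℂ) ^ 2) j * poch ((q : ℂ) ^ 2) ((q : ℂ) ^ 2) y)) := by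
  rw [pConst, show N - n = x by omega, show N - j = y by omega]
  congr 2
  subst hy
  push_cast
  ring

theorem pConst_γδ_left (h0 : 0 < q) (h1 : q < 1) (n r j : ℕ) :
    pConst q n (n + r + j + 1) j (r + 1) =
      pConst q (n + 1) (n + r + j + 1 + 1) (j + 1) r * (1 - ((q : ℂ) ^ 2) ^ (j + 1)) := by
  have hF := poch_self_ne_zero (q_sq_pow_ne_one h0 h1)
  have hj := hF (j + 1)
  rw [poch_succ, ← pow_succ] at hj
  have hj1 := left_ne_zero_of_mul hj
  have hj2 := right_ne_zero_of_mul hj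
  rw [pConst_eq (x := r + j + 1) (y := n + r + 1) (by ring) (by ring),
    pConst_eq (x := r + j + 1) (y := n + r + 1) (by ring) (by ring), poch_succ _ _ j, ← pow_succ]
  have e : ((n * (n + (r + 1 : ℕ)) - j * (n + r + 1 : ℕ) : ℤ)) =
    ((n + 1 : ℕ) * ((n + 1 : ℕ) + r) - (j + 1 : ℕ) * (n + r + 1 : ℕ) : ℤ) := by push_cast; ring
  have hy := hF (n + r + 1)
  rw [e]
  generalize (q : ℂ) ^ (((n + 1 : ℕ) * ((n + 1 : ℕ) + r) - (j + 1 : ℕ) * (n + r + 1 : ℕ) : ℤ)) = z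
  field_simp

theorem pConst_γδ_right (h0 : 0 < q) (h1 : q < 1) (n r j : ℕ) :
    (q : ℂ) ^ (1 + j + r) * pConst q n (n + r + j) j r * ((q : ℂ) ^ 2) ^ n =
      ((q : ℂ) ^ 2) ^ j * pConst q (n + 1) (n + r + j + 1) j r *
        (1 - ((q : ℂ) ^ 2) ^ (n + r + 1)) := by
  have hq := q_ne_zero q h0
  have hF := poch_self_ne_zero (q_sq_pow_ne_one h0 h1)
  have hj := hF (n + r + 1)
  rw [poch_succ, ← pow_succ] at hj
  have hj1 := left_ne_zero_of_mul hj
  have hj2 := right_ne_zero_of_mul hj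
  rw [pConst_eq (x := r + j) (y := n + r) (by ring) (by ring),
    pConst_eq (x := r + j) (y := n + r + 1) (by ring) (by ring), poch_succ _ _ (n + r), ← pow_succ]
  have e : (q : ℂ) ^ (1 + j + r) * (q : ℂ) ^ ((n * (n + r) - j * (n + r : ℕ) : ℤ)) *
      ((q : ℂ) ^ 2) ^ n = ((q : ℂ) ^ 2) ^ j *
      (q : ℂ) ^ (((n + 1 : ℕ) * ((n + 1 : ℕ) + r) - j * (n + r + 1 : ℕ) : ℤ)) := by
    simp only [← zpow_natCast, ← zpow_mul, ← zpow_add₀ hq]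
    congr 1; push_cast; ring
  have hy := hF j
  rw [mul_right_comm, ← mul_assoc, mul_right_comm ((q : ℂ) ^ (1 + j + r)), e]
  generalize (q : ℂ) ^ (((n + 1 : ℕ) * ((n + 1 : ℕ) + r) - j * (n + r + 1 : ℕ) : ℤ)) = z
  field_simp

theorem pConst_γα_left (h0 : 0 < q) (h1 : q < 1) (n r s : ℕ) :
    pConst q (n + 1) (n + (r + n + s + 2)) (r + n + s + 1) r =
      pConst q (n + 1) (n + (r + n + s + 2) + 1) (r + n + s + 2) (r + 1) := by
  have hF := poch_self_ne_zero (q_sq_pow_ne_one h0 h1)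
  rw [pConst_eq (x := r + n + s + 1) (y := n + 1) (by ring) (by ring),
    pConst_eq (x := r + n + s + 2) (y := n + 1) (by ring) (by ring)]
  have e : (((n + 1 : ℕ) * ((n + 1 : ℕ) + r) - (r + n + s + 1 : ℕ) * (n + 1 : ℕ) : ℤ)) =
    ((n + 1 : ℕ) * ((n + 1 : ℕ) + (r + 1 : ℕ)) - (r + n + s + 2 : ℕ) * (n + 1 : ℕ) : ℤ) := by
    push_cast; ring
  have h2 := hF (r + n + s + 1)
  have h3 := hF (r + n + s + 2)
  have h4 := hF (n + 1)
  rw [e]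
  congr 1
  field_simp

theorem pConst_γα_right (h0 : 0 < q) (h1 : q < 1) (n r s : ℕ) :
    ((q : ℂ) ^ 2) ^ (s + 2 + r) *
        pConst q (n + 1) (n + (r + n + s + 2) + 1) (r + n + s + 2) (r + 1) *
        (1 - ((q : ℂ) ^ 2) ^ (n + 1)) =
      (q : ℂ) ^ (n + s + 4 + 2 * r) * pConst q n (n + (r + n + s + 2)) (r + n + s + 2) (r + 1) := by
  have hq := q_ne_zero q h0
  have hF := poch_self_ne_zero (q_sq_pow_ne_one h0 h1)
  have hj := hF (n + 1)
  rw [poch_succ, ← pow_succ] at hj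
  have hj1 := left_ne_zero_of_mul hj
  have hj2 := right_ne_zero_of_mul hj
  rw [pConst_eq (x := r + n + s + 2) (y := n + 1) (by ring) (by ring),
    pConst_eq (x := r + n + s + 2) (y := n) (by ring) (by ring), poch_succ _ _ n, ← pow_succ]
  have e : ((q : ℂ) ^ 2) ^ (s + 2 + r) *
      (q : ℂ) ^ ((n + 1 : ℕ) * ((n + 1 : ℕ) + (r + 1 : ℕ)) - (r + n + s + 2 : ℕ) * (n +
        1 : ℕ) : ℤ) =
      (q : ℂ) ^ (n + s + 4 + 2 * r) *
        (q : ℂ) ^ ((n * (n + (r + 1 : ℕ)) - (r + n + s + 2 : ℕ) * n : ℤ)) := by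
    simp only [← zpow_natCast, ← zpow_mul, ← zpow_add₀ hq]
    congr 1; push_cast; ring
  have h3 := hF (r + n + s + 2)
  rw [← mul_assoc, e, ← mul_assoc ((q : ℂ) ^ (n + s + 4 + 2 * r))]
  generalize (q : ℂ) ^ (n + s + 4 + 2 * r) *
        (q : ℂ) ^ ((n * (n + (r + 1 : ℕ)) - (r + n + s + 2 : ℕ) * n : ℤ)) = z
  field_simp

theorem pConst_δβ_left (h0 : 0 < q) (h1 : q < 1) (m r s : ℕ) :
    pConst q m (2 * m + s + r + 2) m (r + 1) =
      pConst q (m + 1) (2 * m + s + r + 2 + 1) (m + 1) r * (q : ℂ) ^ (s + 1) *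
        (1 - ((q : ℂ) ^ 2) ^ (m + 1)) := by
  have hq := q_ne_zero q h0
  have hF := poch_self_ne_zero (q_sq_pow_ne_one h0 h1)
  have hj := hF (m + 1)
  rw [poch_succ, ← pow_succ] at hj
  have hj1 := left_ne_zero_of_mul hj
  have hj2 := right_ne_zero_of_mul hj
  rw [pConst_eq (x := m + s + r + 2) (y := m + s + r + 2) (by ring) (by ring),
    pConst_eq (x := m + s + r + 2) (y := m + s + r + 2) (by ring) (by ring), poch_succ _ _ m,
    ← pow_succ]
  have e : (q : ℂ) ^ ((m * (m + (r + 1 : ℕ)) - m * (m + s + r + 2 : ℕ) : ℤ)) =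
      (q : ℂ) ^ (((m + 1 : ℕ) * ((m + 1 : ℕ) + r) - (m + 1 : ℕ) * (m + s + r + 2 : ℕ) : ℤ)) *
        (q : ℂ) ^ (s + 1) := by
    simp only [← zpow_natCast, ← zpow_add₀ hq]
    congr 1; push_cast; ring
  have h3 := hF (m + s + r + 2)
  rw [e, mul_right_comm _ _ ((q : ℂ) ^ (s + 1))]
  generalize (q : ℂ) ^ (((m + 1 : ℕ) * ((m + 1 : ℕ) + r) - (m + 1 : ℕ) * (m + s + r + 2 : ℕ) : ℤ)) *
        (q : ℂ) ^ (s + 1) = z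
  field_simp

theorem pConst_δβ_right (h0 : 0 < q) (h1 : q < 1) (n r s : ℕ) :
    pConst q n (2 * n + s + r) n r = (q : ℂ) ^ n * pConst q n (2 * n + s + r + 1) n r := by
  have hq := q_ne_zero q h0
  have hF := poch_self_ne_zero (q_sq_pow_ne_one h0 h1)
  rw [pConst_eq (x := n + s + r) (y := n + s + r) (by ring) (by ring),
    pConst_eq (x := n + s + r + 1) (y := n + s + r + 1) (by ring) (by ring)]
  have e : (q : ℂ) ^ ((n * (n + r) - n * (n + s + r : ℕ) : ℤ)) = (q : ℂ) ^ n *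
      (q : ℂ) ^ ((n * (n + r) - n * (n + s + r + 1 : ℕ) : ℤ)) := by
    simp only [← zpow_natCast, ← zpow_add₀ hq]
    congr 1; push_cast; ring
  have h3 := hF (n + s + r)
  have h4 := hF (n + s + r + 1)
  have h5 := hF n
  rw [e, mul_assoc]
  congr 2
  field_simp

theorem pConst_αβ_left (h0 : 0 < q) (h1 : q < 1) (n r s : ℕ) :
    pConst q n (2 * n + s + r + 1) (n + r) r * (1 - ((q : ℂ) ^ 2) ^ (n + s + r + 2)) =
      (q : ℂ) ^ (s + 1) * pConst q n (2 * n + s + r + 1 + 1) (n + r + 1) (r + 1) *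
        (1 - ((q : ℂ) ^ 2) ^ (n + r + 1)) := by
  have hq := q_ne_zero q h0
  have hF := poch_self_ne_zero (q_sq_pow_ne_one h0 h1)
  have hj := hF (n + r + 1)
  rw [poch_succ, ← pow_succ] at hj
  have hj1 := left_ne_zero_of_mul hj
  have hj2 := right_ne_zero_of_mul hj
  rw [pConst_eq (x := n + s + r + 1) (y := n + s + 1) (by ring) (by ring),
    pConst_eq (x := n + s + r + 1 + 1) (y := n + s + 1) (by ring) (by ring), poch_succ _ _ (n + r),
    poch_succ _ _ (n + s + r + 1), ← pow_succ, ← pow_succ]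
  have e : (q : ℂ) ^ ((n * (n + r) - (n + r : ℕ) * (n + s + 1 : ℕ) : ℤ)) = (q : ℂ) ^ (s + 1) *
      (q : ℂ) ^ ((n * (n + (r + 1 : ℕ)) - (n + r + 1 : ℕ) * (n + s + 1 : ℕ) : ℤ)) := by
    simp only [← zpow_natCast, ← zpow_add₀ hq]
    congr 1; push_cast; ring
  have h3 := hF (n + s + 1)
  rw [e, ← mul_assoc]
  generalize (q : ℂ) ^ (s + 1) *
      (q : ℂ) ^ ((n * (n + (r + 1 : ℕ)) - (n + r + 1 : ℕ) * (n + s + 1 : ℕ) : ℤ)) = z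
  field_simp

theorem pConst_αβ_right (h0 : 0 < q) (h1 : q < 1) (n r s : ℕ) :
    (q : ℂ) ^ (n + 1 + r) * pConst q n (2 * n + s + r + 1) (n + r + 1) (r + 1) *
        (1 - ((q : ℂ) ^ 2) ^ (n + s + r + 2)) =
      ((q : ℂ) ^ 2) ^ (n + r + 1) * pConst q n (2 * n + s + r + 1 + 1) (n + r + 1) (r + 1) *
        (1 - ((q : ℂ) ^ 2) ^ (n + s + 1)) := by
  have hq := q_ne_zero q h0
  have hF := poch_self_ne_zero (q_sq_pow_ne_one h0 h1)
  have hj := hF (n + s + 1)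
  rw [poch_succ, ← pow_succ] at hj
  have hj1 := left_ne_zero_of_mul hj
  have hj2 := right_ne_zero_of_mul hj
  rw [pConst_eq (x := n + s + r + 1) (y := n + s) (by ring) (by ring),
    pConst_eq (x := n + s + r + 1 + 1) (y := n + s + 1) (by ring) (by ring), poch_succ _ _ (n + s),
    poch_succ _ _ (n + s + r + 1), ← pow_succ, ← pow_succ]
  have e : (q : ℂ) ^ (n + 1 + r) *
      (q : ℂ) ^ ((n * (n + (r + 1 : ℕ)) - (n + r + 1 : ℕ) * (n + s : ℕ) : ℤ)) =
      ((q : ℂ) ^ 2) ^ (n + r + 1) *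
      (q : ℂ) ^ ((n * (n + (r + 1 : ℕ)) - (n + r + 1 : ℕ) * (n + s + 1 : ℕ) : ℤ)) := by
    simp only [← zpow_natCast, ← zpow_mul, ← zpow_add₀ hq]
    congr 1; push_cast; ring
  have h3 := hF (n + r + 1)
  rw [← mul_assoc, e, ← mul_assoc]
  generalize ((q : ℂ) ^ 2) ^ (n + r + 1) *
      (q : ℂ) ^ ((n * (n + (r + 1 : ℕ)) - (n + r + 1 : ℕ) * (n + s + 1 : ℕ) : ℤ)) = z
  field_simp

end Constants

section Functions
open FRSL2
variable {q : ℝ}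

theorem brk_γδ_left (h0 : 0 < q) :
    pb q * pc q * brkL q 2 * brkR q 1 = -(1 - pb q * pc q) * (pc q - pb q) := by
  simp only [brkL_eq, brkR_eq h0, pb, pc, mul_sub, sub_mul, qexp₂_mul, one_mul, neg_sub]
  ring_nf

theorem brk_γδ_right (h0 : 0 < q) (n s r j : ℕ) (hj : j = n + 1 + s) :
    (1 - pb q * pd q r) * pc q * algebraMap ℂ _ ((q : ℂ) ^ 2) ^ j * brkR q (1 + j) =
      -algebraMap ℂ _ ((q : ℂ) ^ (1 + j + r)) * pb q *
        (1 - algebraMap ℂ _ ((q : ℂ) ^ 2) ^ n * (pa q s * pc q)) * brkR q (-r) := by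
  subst hj
  rw [algebraMap_pow_eq h0, algebraMap_pow_eq h0, ← zpow_natCast, algebraMap_zpow_eq h0]
  simp only [brkR_eq h0, pa, pb, pc, pd, mul_sub, sub_mul, qexp₂_mul, one_mul, neg_mul, mul_one]
  push_cast
  ring_nf

theorem pa_mul_pb (q : ℝ) (s : ℤ) : pa q s * pb q = qexp₂ q 0 0 (2 * (s + 1)) := by
  rw [pa, pb, qexp₂_mul]; congr 1; ring

theorem pc_mul_pd (q : ℝ) (r : ℤ) : pc q * pd q r = qexp₂ q 0 0 (2 * (r + 1)) := by
  rw [pc, pd, qexp₂_mul]; congr 1; ring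

theorem brk_γα (h0 : 0 < q) (n s r : ℕ) :
    pa q s * pc q * algebraMap ℂ _ ((q : ℂ) ^ 2) ^ n * brkR q (n + s + 2) * (1 - pb q * pc q) *
        (1 - pb q * pd q r) * (1 - algebraMap ℂ _ ((q : ℂ) ^ 2) * (pb q * pd q r)) =
      pb q * algebraMap ℂ _ ((q : ℂ) ^ (n + s + 4 + 2 * r)) *
        (1 - algebraMap ℂ _ ((q : ℂ) ^ 2) ^ n * (pa q s * pc q)) * brkL q 2 * brkR q (-r) *
        brkR q (-r - 1) := by
  have e : algebraMap ℂ (Mer ⊗[ℂ] Mer) ((q : ℂ) ^ 2) = qexp₂ q 0 0 2 := by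
    have := algebraMap_pow_eq h0 1; simpa using this
  rw [algebraMap_pow_eq h0, e, ← zpow_natCast, algebraMap_zpow_eq h0]
  simp only [brkL_eq, brkR_eq h0, pa, pb, pc, pd, mul_sub, sub_mul, qexp₂_mul, neg_sub, mul_one]
  push_cast
  ring_nf

theorem brk_δβ_sub (h0 : 0 < q) (s : ℕ) :
    algebraMap ℂ _ ((q : ℂ) ^ (s + 1)) * pc q * brkL q 2 * brkR q (s + 2) =
      (1 - pb q * pc q) * (1 - pa q s * pc q) := by
  rw [← zpow_natCast, algebraMap_zpow_eq h0]
  simp only [brkL_eq, brkR_eq h0, pa, pb, pc, mul_sub, sub_mul, qexp₂_mul, one_mul, mul_one]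
  push_cast
  ring_nf
  simp only [qexp₂_zero]; ring

theorem brk_δβ_right (h0 : 0 < q) (n s : ℕ) :
    algebraMap ℂ _ ((q : ℂ) ^ n) * algebraMap ℂ _ ((q : ℂ) ^ (s + 1)) * pc q * brkL q 2 *
        brkR q (2 + n + s) =
      (1 - pb q * pc q) * (1 - algebraMap ℂ _ ((q : ℂ) ^ 2) ^ n * (pa q s * pc q)) := by
  rw [algebraMap_pow_eq h0, ← zpow_natCast, ← zpow_natCast, algebraMap_zpow_eq h0,
    algebraMap_zpow_eq h0]
  simp only [brkL_eq, brkR_eq h0, pa, pb, pc, mul_sub, sub_mul, qexp₂_mul, one_mul, mul_one]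
  push_cast
  ring_nf
  simp only [qexp₂_zero]; ring

theorem brk_αβ_sub (h0 : 0 < q) (s r : ℕ) :
    pa q s * brkR q (s + 1 - r) = qexp₂ q 0 1 (s + 1 - r) * (pa q s - pd q r) := by
  simp only [brkR_eq h0, pa, pd, mul_sub, qexp₂_mul, neg_sub]
  push_cast
  ring_nf

theorem brk_αβ_left (h0 : 0 < q) (s r : ℕ) :
    algebraMap ℂ _ ((q : ℂ) ^ (s + 1)) * brkR q (-r) =
      qexp₂ q 0 1 (s + 1 - r) * (1 - pb q * pd q r) := by
  rw [← zpow_natCast, algebraMap_zpow_eq h0]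
  simp only [brkR_eq h0, pb, pd, mul_sub, qexp₂_mul, mul_one]
  push_cast
  ring_nf

theorem brk_αβ_right (h0 : 0 < q) (n s r : ℕ) :
    pa q s * pc q * algebraMap ℂ _ ((q : ℂ) ^ 2) ^ n * brkR q (2 + n + s) =
      -qexp₂ q 0 1 (s + 1 - r) * algebraMap ℂ _ ((q : ℂ) ^ (n + 1 + r)) *
        (1 - algebraMap ℂ _ ((q : ℂ) ^ 2) ^ n * (pa q s * pc q)) := by
  rw [algebraMap_pow_eq h0, ← zpow_natCast, algebraMap_zpow_eq h0]
  simp only [brkR_eq h0, pa, pc, mul_sub, qexp₂_mul, neg_mul,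
    mul_one]
  push_cast
  ring_nf

end Functions

/-! ### Translation of the dynamical variables -/

section Shift
open FRSL2 Polynomial
variable {q : ℝ}

/-- The automorphism `h(λ, μ) ↦ h(λ + i, μ + j)` of the functions of two variables. -/
def sft (i j : ℤ) : Mer ⊗[ℂ] Mer →ₐ[ℂ] Mer ⊗[ℂ] Mer :=
  Algebra.TensorProduct.map (Mer.shift i) (Mer.shift j)

theorem sft_tmul (i j : ℤ) (f g : Mer) : sft i j (f ⊗ₜ g) = Mer.shift i f ⊗ₜ Mer.shift j g :=
  Algebra.TensorProduct.map_tmul _ _ _ _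

theorem sft_qexp₂ (h0 : 0 < q) (i j a b c : ℤ) :
    sft i j (qexp₂ q a b c) = qexp₂ q a b (c + a * i + b * j) := by
  have e : qexp₂ q a b (c + a * i + b * j) = qexp₂ q a 0 (c + a * i) * qexp₂ q 0 b (b * j) := by
    rw [qexp₂_mul, add_zero, zero_add]
  rw [e, qexp₂_eq_one_tmul h0, qexp₂, sft_tmul, shift_qexp, shift_qexp, qexp₂,
    Algebra.TensorProduct.tmul_mul_tmul, qexp_zero_zero, one_mul, mul_one, zero_add]

/-- The automorphism `h(λ, μ) ↦ h(λ + i, μ + j)` of the coefficients of a polynomial. -/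
def sftP (i j : ℤ) : (Mer ⊗[ℂ] Mer)[X] →ₐ[ℂ] (Mer ⊗[ℂ] Mer)[X] := Polynomial.mapAlgHom (sft i j)

theorem sftP_C (i j : ℤ) (f : Mer ⊗[ℂ] Mer) : sftP i j (C f) = C (sft i j f) :=
  Polynomial.map_C _

theorem sftP_X (i j : ℤ) : sftP i j X = X := Polynomial.map_X _

theorem algHom_map_poch {S S' : Type*} [CommRing S] [Algebra ℂ S] [CommRing S'] [Algebra ℂ S']
    (f : S →ₐ[ℂ] S') (a p : S) (k : ℕ) : f (poch a p k) = poch (f a) (f p) k :=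
  map_poch (f : S →+* S') a p k

theorem map_awQ {S S' : Type*} [CommRing S] [Algebra ℂ S] [CommRing S'] [Algebra ℂ S']
    (f : S →ₐ[ℂ] S') (p : ℂ) (n : ℕ) (a b c d x : S) :
    f (awQ p n a b c d x) = awQ p n (f a) (f b) (f c) (f d) (f x) := by
  have h2 : f 2 = 2 := map_ofNat f 2
  simp [awQ, awSum, awTerm, awBasis, awFactor, algHom_map_poch, map_prod, h2]

end Shift

/-! ### Recursions for the polynomials representing `P_n` -/

section Recurrences
open FRSL2 Polynomial
variable {q : ℝ}

theorem sftP_algebraMap (i j : ℤ) (z : ℂ) :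
    sftP i j (algebraMap ℂ (Mer ⊗[ℂ] Mer)[X] z) = algebraMap ℂ _ z := AlgHom.commutes _ _

theorem qexp₂_const (h0 : 0 < q) (a b c : ℤ) :
    algebraMap ℂ (Mer ⊗[ℂ] Mer) ((q : ℂ) ^ 2) * qexp₂ q a b c = qexp₂ q a b (c + 2) := by
  have := algebraMap_pow_eq h0 1
  rw [pow_one] at this
  rw [this, qexp₂_mul]; congr 1 <;> push_cast <;> ring

theorem pa_succ (h0 : 0 < q) (s : ℤ) :
    pa q (s + 1) = algebraMap ℂ (Mer ⊗[ℂ] Mer) ((q : ℂ) ^ 2) * pa q s := by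
  rw [pa, pa, qexp₂_const h0]; congr 1; ring

theorem pd_succ (h0 : 0 < q) (r : ℤ) :
    pd q (r + 1) = algebraMap ℂ (Mer ⊗[ℂ] Mer) ((q : ℂ) ^ 2) * pd q r := by
  rw [pd, pd, qexp₂_const h0]; congr 1; ring

theorem sft_one_one_pa (h0 : 0 < q) (s : ℤ) : sft 1 1 (pa q s) = pa q s := by
  rw [pa, sft_qexp₂ h0]; congr 1; ring

theorem sft_one_one_pb (h0 : 0 < q) : sft 1 1 (pb q) = pb q := by
  rw [pb, sft_qexp₂ h0]; congr 1

theorem sft_one_one_pc (h0 : 0 < q) :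
    sft 1 1 (pc q) = algebraMap ℂ (Mer ⊗[ℂ] Mer) ((q : ℂ) ^ 2) * pc q := by
  rw [pc, sft_qexp₂ h0, qexp₂_const h0]; congr 1

theorem sft_one_one_pd (h0 : 0 < q) (r : ℤ) : sft 1 1 (pd q (r + 1)) = pd q r := by
  rw [pd, pd, sft_qexp₂ h0]; congr 1; ring

theorem sft_one_neg_one_pa (h0 : 0 < q) (s : ℤ) : sft 1 (-1) (pa q (s + 1)) = pa q s := by
  rw [pa, pa, sft_qexp₂ h0]; congr 1; ring

theorem sft_one_neg_one_pb (h0 : 0 < q) :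
    sft 1 (-1) (pb q) = algebraMap ℂ (Mer ⊗[ℂ] Mer) ((q : ℂ) ^ 2) * pb q := by
  rw [pb, sft_qexp₂ h0, qexp₂_const h0]; congr 1

theorem sft_one_neg_one_pc (h0 : 0 < q) : sft 1 (-1) (pc q) = pc q := by
  rw [pc, sft_qexp₂ h0]; congr 1

theorem sft_one_neg_one_pd (h0 : 0 < q) (r : ℤ) : sft 1 (-1) (pd q r) = pd q r := by
  rw [pd, sft_qexp₂ h0]; congr 1; ring

/-- The form of `pPoly_spec` after the translation that moving past `α` causes. -/
theorem sftP_one_one_pPoly_spec (h0 : 0 < q) (h1 : q < 1) (n N k j s r : ℕ)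
    (hs : |(j : ℤ) - k| = s) (hr : |(N : ℤ) - k - j| = r + 1) {P : (Mer ⊗[ℂ] Mer)[X]}
    (hP : P = algebraMap ℂ _ ((q : ℂ) ^ 2)) :
    poch (C (pb q) * (P * C (pc q))) P n * poch (C (pb q) * C (pd q r)) P n * C (pa q s) ^ n *
        sftP 1 1 (pPoly q n N k j) =
      algebraMap ℂ _ (pConst q n N j (r + 1)) * C (pb q) ^ n *
        awQ ((q : ℂ) ^ 2) n (C (pa q s)) (C (pb q)) (P * C (pc q)) (C (pd q r)) X := by
  have h := congrArg (sftP 1 1) (pPoly_spec h0 h1 n N k j s (r + 1) hs (by push_cast; exact hr) hP)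
  have hP' : sftP 1 1 P = P := by rw [hP, sftP_algebraMap]
  simp only [map_mul (sftP 1 1), algHom_map_poch, hP', map_pow (sftP 1 1), sftP_algebraMap, map_awQ,
    sftP_C,
    sftP_X] at h
  push_cast at h
  rw [sft_one_one_pa h0, sft_one_one_pb h0, sft_one_one_pc h0, sft_one_one_pd h0, C_mul] at h
  subst hP
  exact h

/-- The form of `pPoly_spec` after the translation that moving past `β` causes. -/
theorem sftP_one_neg_one_pPoly_spec (h0 : 0 < q) (h1 : q < 1) (n N k j s r : ℕ)
    (hs : |(j : ℤ) - k| = s + 1) (hr : |(N : ℤ) - k - j| = r) {P : (Mer ⊗[ℂ] Mer)[X]}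
    (hP : P = algebraMap ℂ _ ((q : ℂ) ^ 2)) :
    poch (P * C (pb q) * C (pc q)) P n * poch (P * C (pb q) * C (pd q r)) P n * C (pa q s) ^ n *
        sftP 1 (-1) (pPoly q n N k j) =
      algebraMap ℂ _ (pConst q n N j r) * (P * C (pb q)) ^ n *
        awQ ((q : ℂ) ^ 2) n (C (pa q s)) (P * C (pb q)) (C (pc q)) (C (pd q r)) X := by
  have h := congrArg (sftP 1 (-1)) (pPoly_spec h0 h1 n N k j (s +
    1) r (by push_cast; exact hs) hr hP)
  have hP' : sftP 1 (-1) P = P := by rw [hP, sftP_algebraMap]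
  simp only [map_mul (sftP 1 (-1)), algHom_map_poch, hP', map_pow (sftP 1 (-1)), sftP_algebraMap,
    map_awQ, sftP_C,
    sftP_X] at h
  push_cast at h
  rw [sft_one_neg_one_pa h0, sft_one_neg_one_pb h0, sft_one_neg_one_pc h0, sft_one_neg_one_pd h0,
    C_mul] at h
  subst hP
  exact h

theorem isUnit_pa (q : ℝ) (s : ℤ) : IsUnit (pa q s) := isUnit_qexp₂ _ _ _ _
theorem isUnit_pb (q : ℝ) : IsUnit (pb q) := isUnit_qexp₂ _ _ _ _
theorem isUnit_pc (q : ℝ) : IsUnit (pc q) := isUnit_qexp₂ _ _ _ _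

variable (q) in
/-- The polynomial in `x` whose value at `Ξ / 2` is `δα`. -/
def daPoly : (Mer ⊗[ℂ] Mer)[X] :=
  C (Ring.inverse (pc q * brkL q 2 * brkR q 1)) * awFactor X (C (pc q))

variable (q) in
/-- The polynomial in `x` whose value at `Ξ / 2` is `γβ`. -/
def cbPoly : (Mer ⊗[ℂ] Mer)[X] :=
  C (Ring.inverse (pb q * brkL q 2 * brkR q 0)) * awFactor X (C (pb q))

theorem daPoly_spec (h0 : 0 < q) (h1 : q < 1) :
    C (pc q) * C (brkL q 2) * C (brkR q 1) * daPoly q = awFactor X (C (pc q)) := by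
  rw [daPoly, ← mul_assoc, ← C_mul, ← C_mul, ← C_mul, Ring.mul_inverse_cancel _
    (((isUnit_pc q).mul (isUnit_brkL h0 h1 _)).mul (isUnit_brkR h0 h1 _)), C_1, one_mul]

theorem cbPoly_spec (h0 : 0 < q) (h1 : q < 1) :
    C (pb q) * C (brkL q 2) * C (brkR q 0) * cbPoly q = awFactor X (C (pb q)) := by
  rw [cbPoly, ← mul_assoc, ← C_mul, ← C_mul, ← C_mul, Ring.mul_inverse_cancel _
    (((isUnit_pb q).mul (isUnit_brkL h0 h1 _)).mul (isUnit_brkR h0 h1 _)), C_1, one_mul]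

theorem isUnit_const (h0 : 0 < q) (n : ℕ) : IsUnit (algebraMap ℂ (Mer ⊗[ℂ] Mer)[X] ((q : ℂ) ^ n)) :=
  (IsUnit.mk0 _ (pow_ne_zero n (q_ne_zero q h0))).map _

theorem isUnit_poch_C {a : Mer ⊗[ℂ] Mer} {n : ℕ} {P : (Mer ⊗[ℂ] Mer)[X]}
    (hP : P = algebraMap ℂ _ ((q : ℂ) ^ 2))
    (h : IsUnit (poch a (algebraMap ℂ (Mer ⊗[ℂ] Mer) ((q : ℂ) ^ 2)) n)) : IsUnit (poch (C a) P n)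
      := by
  have := h.map (C : Mer ⊗[ℂ] Mer →+* (Mer ⊗[ℂ] Mer)[X])
  rw [map_poch] at this
  rw [hP]; exact this

theorem isUnit_poch_pb_pc (h0 : 0 < q) (h1 : q < 1) (n : ℕ) {P : (Mer ⊗[ℂ] Mer)[X]}
    (hP : P = algebraMap ℂ _ ((q : ℂ) ^ 2)) : IsUnit (poch (C (pb q) * C (pc q)) P n) := by
  rw [← C_mul, pb, pc, qexp₂_mul]
  exact isUnit_poch_C hP (isUnit_poch_left h0 h1 (.inl rfl) _ n)

theorem isUnit_poch_pb_pd (h0 : 0 < q) (h1 : q < 1) (n : ℕ) (r : ℤ) {P : (Mer ⊗[ℂ] Mer)[X]}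
    (hP : P = algebraMap ℂ _ ((q : ℂ) ^ 2)) : IsUnit (poch (C (pb q) * C (pd q r)) P n) := by
  rw [← C_mul, pb, pd, qexp₂_mul]
  exact isUnit_poch_C hP (isUnit_poch_right h0 h1 (.inr rfl) _ n)

theorem C_pa_mul_C_pb (h0 : 0 < q) (s : ℕ) :
    C (pa q s) * C (pb q) = algebraMap ℂ (Mer ⊗[ℂ] Mer)[X] (((q : ℂ) ^ 2) ^ (s + 1)) := by
  rw [← C_mul, pa_mul_pb, Polynomial.algebraMap_apply, map_pow, algebraMap_pow_eq h0]
  push_cast; rfl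

theorem C_pc_mul_C_pd (h0 : 0 < q) (r : ℕ) :
    C (pc q) * C (pd q r) = algebraMap ℂ (Mer ⊗[ℂ] Mer)[X] (((q : ℂ) ^ 2) ^ (r + 1)) := by
  rw [← C_mul, pc_mul_pd, Polynomial.algebraMap_apply, map_pow, algebraMap_pow_eq h0]
  push_cast; rfl

/-- The recursion for the matrix elements `γ^s δ^r P_n` on the level of polynomials, which is
`awQ_contiguous_bc`; the denominators of its coefficients are cleared. -/
theorem pPoly_recurrence_γδ (h0 : 0 < q) (h1 : q < 1) {n r s j N : ℕ} (hj : j = n + s)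
    (hN : N = n + r + j + 1) :
    C (brkR q 1) * C (brkR q (-r)) * pPoly q (n + 1) (N + 1) (n + 1) (j + 1) =
      C (brkR q 1) * C (brkR q (-r)) * daPoly q * sftP 1 1 (pPoly q n N n j) +
        C (brkR q (2 + j)) * C (brkR q 0) * cbPoly q * sftP 1 (-1) (pPoly q n N n (j + 1)) := by
  obtain ⟨P, hP⟩ : ∃ P, P = algebraMap ℂ (Mer ⊗[ℂ] Mer)[X] ((q : ℂ) ^ 2) := ⟨_, rfl⟩
  have hp := q_sq_pow_ne_one h0 h1
  have S := pPoly_spec h0 h1 (n + 1) (N + 1) (n + 1) (j +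
    1) s r (by subst hj; push_cast; ring_nf; simp)
    (by subst hN; push_cast; ring_nf; simp) hP
  have S1 := sftP_one_one_pPoly_spec h0 h1 n N n j s r (by subst hj; push_cast; ring_nf; simp)
    (by subst hN; push_cast; ring_nf; exact abs_of_nonneg (by positivity)) hP
  have S2 := sftP_one_neg_one_pPoly_spec h0 h1 n N n (j + 1) s r
    (by subst hj; push_cast; ring_nf; exact abs_of_nonneg (by positivity))
    (by subst hN; push_cast; ring_nf; simp) hP
  have R :=
    awQ_contiguous_bc (q_sq_ne_zero h0) hp n (C (pa q s)) (C (pb q)) (C (pc q)) (C (pd q r)) X hP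
  have k1 := congrArg (algebraMap ℂ (Mer ⊗[ℂ] Mer)[X]) (pConst_γδ_left h0 h1 n r j)
  have k2 := congrArg (algebraMap ℂ (Mer ⊗[ℂ] Mer)[X]) (pConst_γδ_right h0 h1 n r (j + 1))
  have hab : P ^ n * (C (pa q s) * C (pb q)) = algebraMap ℂ _ (((q : ℂ) ^ 2) ^ (j + 1)) := by
    rw [C_pa_mul_C_pb h0, hP, ← map_pow, ← map_mul, ← pow_add, show n + (s + 1) = j + 1 by omega]
  have hcd : P ^ n * (C (pc q) * C (pd q r)) = algebraMap ℂ _ (((q : ℂ) ^ 2) ^ (n + r + 1)) := by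
    rw [C_pc_mul_C_pd h0, hP, ← map_pow, ← map_mul, ← pow_add, add_assoc]
  have B1 := congrArg C (brk_γδ_right h0 n s r (j + 1) (by omega))
  have B2 := congrArg C (brk_γδ_left h0)
  have hC (z : ℂ) : C (algebraMap ℂ (Mer ⊗[ℂ] Mer) z) = algebraMap ℂ (Mer ⊗[ℂ] Mer)[X] z := rfl
  simp only [C_mul, C_sub, C_neg, C_1, C_pow, hC, ← hP] at B1 B2
  have hD := daPoly_spec h0 h1
  have hB := cbPoly_spec h0 h1
  have e0 : ((1 : ℤ) + ((j + 1 : ℕ) : ℤ)) = 2 + j := by push_cast; ring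
  rw [e0] at B1
  have u1 := isUnit_poch_pb_pc h0 h1 (n + 1) hP
  have u2 := isUnit_poch_pb_pd h0 h1 (n + 1) r hP
  rw [poch_succ'] at u1 u2
  have u3 : IsUnit P := by rw [hP]; exact isUnit_const h0 2
  rw [poch_succ', poch_succ', pow_succ' _ n, pow_succ' _ n] at S
  have hq := poch_succ' (C (pb q) * C (pd q r)) P n
  rw [poch_succ] at hq
  refine recurrence_of_contiguous_bc (Pn := P ^ n) (A := C (pa q s) ^ n) (B := C (pb q) ^ n)
    (D := poch (P * (C (pb q) * C (pc q))) P n * poch (P * (C (pb q) * C (pd q r))) P n)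
    (X1 := 1 - C (pb q) * C (pc q)) (X2 := 1 - C (pb q) * C (pd q r)) (L := C (brkL q 2))
    (pj := P ^ (j + 1)) (v := algebraMap ℂ _ ((q : ℂ) ^ (1 + (j + 1) + r)))
    (κ := algebraMap ℂ _ (pConst q (n + 1) (N + 1) (j + 1) r))
    (κ1 := algebraMap ℂ _ (pConst q n N j (r + 1))) (κ2 := algebraMap ℂ _ (pConst q n N (j + 1) r))
    R ?_ ?_ ?_ ?_ ?_ ?_ B2 hD hB ?_
  · linear_combination S
  · rw [mul_left_comm (C (pb q)) P] at S1
    linear_combination (1 - P ^ n * (C (pb q) * C (pd q r))) * S1 -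
      (poch (P * (C (pb q) * C (pc q))) P n * C (pa q s) ^ n * sftP 1 1 (pPoly q n N n j)) * hq
  · rw [mul_assoc P, mul_assoc P, mul_pow] at S2
    linear_combination S2
  · rw [hab, hN, k1, map_mul, map_sub, map_one]
  · rw [show n + r + (j + 1) = N by omega] at k2
    simp only [map_mul, map_sub, map_one] at k2
    rw [hcd, hP, ← map_pow, ← map_pow]
    exact k2
  · linear_combination B1
  · have := isUnit_of_mul_isUnit_right u1
    have v1 := isUnit_of_mul_isUnit_right u2
    have v2 := isUnit_of_mul_isUnit_left u2
    have ua := (isUnit_pa q s).map C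
    exact ((((((((isUnit_pb q).map C).mul ((isUnit_pc q).map C)).mul
      ((isUnit_brkL h0 h1 2).map C)).mul (u3.pow (j + 1))).mul v2).mul (this.mul v1)).mul ua).mul
      (ua.pow n)

theorem isUnit_one_sub_C_mul {y z : ℂ} (h : y ≠ 1) (hz : z = y) :
    IsUnit (1 - algebraMap ℂ (Mer ⊗[ℂ] Mer)[X] z) := by
  rw [← map_one (algebraMap ℂ (Mer ⊗[ℂ] Mer)[X]), ← map_sub, hz]
  exact (IsUnit.mk0 _ (sub_ne_zero.2 h.symm)).map _

/-- The recursion for the matrix elements `γ^s P_n α^r` on the level of polynomials, which is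
`awQ_contiguous_bd`; the denominators of its coefficients are cleared. -/
theorem pPoly_recurrence_γα (h0 : 0 < q) (h1 : q < 1) {n r s k j N : ℕ} (hk : k = r + n + 1)
    (hj : j + 1 = r + n + s + 2) (hN : N = n + (r + n + s + 2)) :
    C (brkR q (-r)) * C (brkR q (-r - 1)) * pPoly q (n + 1) (N + 1) (k + 1) (j + 1) =
      C (brkR q (-r)) * C (brkR q (-r - 1)) * pPoly q (n + 1) N k j +
        C (brkR q (n + s + 2)) * C (brkR q 0) * cbPoly q *
          sftP 1 (-1) (pPoly q n N k (j + 1)) := by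
  obtain ⟨P, hP⟩ : ∃ P, P = algebraMap ℂ (Mer ⊗[ℂ] Mer)[X] ((q : ℂ) ^ 2) := ⟨_, rfl⟩
  have hp := q_sq_pow_ne_one h0 h1
  have hj' : j = r + n + s + 1 := by omega
  have S := pPoly_spec h0 h1 (n + 1) (N + 1) (k + 1) (j + 1) s (r + 1)
    (by subst hj' hk; push_cast; ring_nf; simp)
    (by subst hN hk hj'; push_cast; ring_nf; rw [abs_of_nonpos] <;> [ring; linarith]) hP
  have S1 := pPoly_spec h0 h1 (n + 1) N k j s r (by subst hj' hk; push_cast; ring_nf; simp)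
    (by subst hN hk hj'; push_cast; ring_nf; simp) hP
  have S2 := sftP_one_neg_one_pPoly_spec h0 h1 n N k (j + 1) s (r + 1)
    (by subst hj' hk; push_cast; ring_nf; exact abs_of_nonneg (by positivity))
    (by subst hN hk hj'; push_cast; ring_nf; rw [abs_of_nonpos] <;> [ring; linarith]) hP
  have R :=
    awQ_contiguous_bd (q_sq_ne_zero h0) hp n (C (pa q s)) (C (pb q)) (C (pc q)) (C (pd q r)) X hP
  have k1 := congrArg (algebraMap ℂ (Mer ⊗[ℂ] Mer)[X]) (pConst_γα_left h0 h1 n r s)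
  have k2 := congrArg (algebraMap ℂ (Mer ⊗[ℂ] Mer)[X]) (pConst_γα_right h0 h1 n r s)
  have B1 := congrArg C (brk_γα h0 n s r)
  have hC (z : ℂ) : C (algebraMap ℂ (Mer ⊗[ℂ] Mer) z) = algebraMap ℂ (Mer ⊗[ℂ] Mer)[X] z := rfl
  simp only [C_mul, C_sub, C_1, C_pow, hC, ← hP] at B1
  have hd : C (pd q ((r + 1 : ℕ) : ℤ)) = P * C (pd q r) := by
    push_cast; rw [pd_succ h0, C_mul, hC, hP]
  rw [hd] at S S2
  have u1 := isUnit_poch_pb_pc h0 h1 (n + 1) hP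
  have u2 := isUnit_poch_pb_pd h0 h1 (n + 2) r hP
  rw [poch_succ'] at u1
  rw [poch_succ', poch_succ'] at u2
  have u3 : IsUnit P := by rw [hP]; exact isUnit_const h0 2
  rw [poch_succ', poch_succ', pow_succ' _ n, pow_succ' _ n] at S
  rw [poch_succ', pow_succ' _ n, pow_succ' _ n] at S1
  have hq := poch_succ' (C (pb q) * C (pd q r)) P (n + 1)
  rw [poch_succ' (P * _), poch_succ _ _ (n + 1), pow_succ' P n] at hq
  rw [mul_left_comm (C (pb q)) P] at S
  refine recurrence_of_contiguous_bd (a := C (pa q s)) (b := C (pb q)) (c := C (pc q))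
    (d := C (pd q r)) (P := P) (Pn := P ^ n) (A := C (pa q s) ^ n) (B := C (pb q) ^ n)
    (D := poch (P * (C (pb q) * C (pc q))) P n * poch (P * (P * (C (pb q) * C (pd q r)))) P n)
    (X1 := 1 - C (pb q) * C (pc q)) (Y0 := 1 - C (pb q) * C (pd q r))
    (Y1 := 1 - P * (C (pb q) * C (pd q r))) (L := C (brkL q 2))
    (v := algebraMap ℂ _ ((q : ℂ) ^ (n + s + 4 + 2 * r)))
    (κ := algebraMap ℂ _ (pConst q (n + 1) (N + 1) (j + 1) (r + 1)))
    (κ1 := algebraMap ℂ _ (pConst q (n + 1) N j r))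
    (κ2 := algebraMap ℂ _ (pConst q n N (j + 1) (r + 1)))
    R ?_ ?_ ?_ ?_ ?_ B1 (cbPoly_spec h0 h1) ?_
  · linear_combination S
  · linear_combination (1 - P * P ^ n * (C (pb q) * C (pd q r))) * S1 -
      ((1 - C (pb q) * C (pc q)) * poch (P * (C (pb q) * C (pc q))) P n * (C (pa q s) *
        C (pa q s) ^ n)
        * pPoly q (n + 1) N k j) * hq
  · rw [mul_assoc P, mul_assoc P, mul_pow, mul_left_comm (C (pb q)) P] at S2
    linear_combination S2
  · rw [hN, hj', k1]
  · rw [← hN, ← hj] at k2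
    simp only [map_mul, map_sub, map_one, map_pow] at k2
    have e1 := C_pa_mul_C_pb h0 (q := q) s
    have e2 := C_pc_mul_C_pd h0 (q := q) r
    simp only [map_pow] at e1 e2
    have : C (pa q s) * C (pb q) * C (pc q) * C (pd q r) = P ^ (s + 2 + r) := by
      rw [mul_assoc _ (C (pc q)), e1, e2, hP, map_pow, ← pow_add]; congr 1; omega
    rw [this, hP, map_pow, ← pow_succ', map_pow]
    exact k2
  · have v0 := isUnit_of_mul_isUnit_left u1
    have v1 := isUnit_of_mul_isUnit_right u1
    have v2 := isUnit_of_mul_isUnit_left u2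
    have v3 := isUnit_of_mul_isUnit_left (isUnit_of_mul_isUnit_right u2)
    have v4 := isUnit_of_mul_isUnit_right (isUnit_of_mul_isUnit_right u2)
    have ua := (isUnit_pa q s).map C
    exact (((((((ua.mul ((isUnit_pc q).map C)).mul (u3.pow n)).mul v0).mul v2).mul v3).mul
      (v1.mul v4)).mul ua).mul (ua.pow n)

/-- The recursion for the matrix elements `δ^r P_n β^s` on the level of polynomials, which is
`awQ_contiguous_ac`; the denominators of its coefficients are cleared. -/
theorem pPoly_recurrence_δβ (h0 : 0 < q) (h1 : q < 1) {m r s k N : ℕ} (hk : k = m + 1 + s)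
    (hN : N = 2 * m + s + r + 2) :
    C (brkR q (s + 2)) * pPoly q (m + 1) (N + 1) (k + 1) (m + 1) =
      C (brkR q 1) * daPoly q * sftP 1 1 (pPoly q m N k m) +
        C (brkR q (3 + m + s)) * pPoly q (m + 1) N k (m + 1) := by
  obtain ⟨P, hP⟩ : ∃ P, P = algebraMap ℂ (Mer ⊗[ℂ] Mer)[X] ((q : ℂ) ^ 2) := ⟨_, rfl⟩
  have hp := q_sq_pow_ne_one h0 h1
  have S := pPoly_spec h0 h1 (m + 1) (N + 1) (k + 1) (m + 1) (s + 1) r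
    (by subst hk; push_cast; ring_nf; rw [abs_of_nonpos] <;> [ring; linarith])
    (by subst hN hk; push_cast; ring_nf; simp) hP
  have S1 := sftP_one_one_pPoly_spec h0 h1 m N k m (s + 1) r
    (by subst hk; push_cast; ring_nf; rw [abs_of_nonpos] <;> [ring; linarith])
    (by subst hN hk; push_cast; ring_nf; exact abs_of_nonneg (by positivity)) hP
  have S2 := pPoly_spec h0 h1 (m + 1) N k (m + 1) s r
    (by subst hk; push_cast; ring_nf; simp)
    (by subst hN hk; push_cast; ring_nf; simp) hP
  have R :=
    awQ_contiguous_ac (q_sq_ne_zero h0) hp m (C (pa q s)) (C (pb q)) (C (pc q)) (C (pd q r)) X hP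
  have k1 := congrArg (algebraMap ℂ (Mer ⊗[ℂ] Mer)[X]) (pConst_δβ_left h0 h1 m r s)
  have k2 := congrArg (algebraMap ℂ (Mer ⊗[ℂ] Mer)[X]) (pConst_δβ_right h0 h1 (m + 1) r s)
  have B1 := congrArg C (brk_δβ_sub h0 s)
  have B2 := congrArg C (brk_δβ_right h0 (m + 1) s)
  have hC (z : ℂ) : C (algebraMap ℂ (Mer ⊗[ℂ] Mer) z) = algebraMap ℂ (Mer ⊗[ℂ] Mer)[X] z := rfl
  simp only [C_mul, C_sub, C_1, C_pow, hC, ← hP] at B1 B2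
  have hd : C (pa q ((s + 1 : ℕ) : ℤ)) = P * C (pa q s) := by
    push_cast; rw [pa_succ h0, C_mul, hC, hP]
  rw [hd] at S S1
  have u1 := isUnit_poch_pb_pc h0 h1 (m + 1) hP
  have u2 := isUnit_poch_pb_pd h0 h1 (m + 1) r hP
  rw [poch_succ'] at u1
  have u3 : IsUnit P := by rw [hP]; exact isUnit_const h0 2
  rw [poch_succ' (C (pb q) * C (pc q)), pow_succ' _ m, pow_succ' (C (pb q)) m] at S
  rw [poch_succ' (C (pb q) * C (pc q)), pow_succ' (C (pb q)) m] at S2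
  have hq := poch_succ (C (pb q) * C (pd q r)) P m
  rw [← pow_succ' P m] at R
  rw [show (2 + ((m + 1 : ℕ) : ℤ) + s) = 3 + m + s by push_cast; ring] at B2
  refine recurrence_of_contiguous_ac (a := C (pa q s)) (b := C (pb q)) (c := C (pc q))
    (d := C (pd q r)) (P := P) (Pm := P ^ m) (P1 := P ^ (m + 1)) (A := (P * C (pa q s)) ^ m)
    (A' := C (pa q s) ^ (m + 1)) (B := C (pb q) ^ m)
    (D := poch (P * (C (pb q) * C (pc q))) P m * poch (C (pb q) * C (pd q r)) P (m + 1))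
    (X1 := 1 - C (pb q) * C (pc q)) (L := C (brkL q 2))
    (v := algebraMap ℂ _ ((q : ℂ) ^ (s + 1))) (w := algebraMap ℂ _ ((q : ℂ) ^ (m + 1)))
    (κ := algebraMap ℂ _ (pConst q (m + 1) (N + 1) (m + 1) r))
    (κ1 := algebraMap ℂ _ (pConst q m N m (r + 1)))
    (κ2 := algebraMap ℂ _ (pConst q (m + 1) N (m + 1) r))
    R ?_ ?_ ?_ ?_ ?_ ?_ ?_ B1 B2 (daPoly_spec h0 h1) ?_
  · linear_combination S
  · rw [mul_left_comm (C (pb q)) P] at S1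
    linear_combination (1 - P ^ m * (C (pb q) * C (pd q r))) * S1 +
      (poch (P * (C (pb q) * C (pc q))) P m * (P * C (pa q s)) ^ m
        * sftP 1 1 (pPoly q m N k m)) * hq
  · linear_combination S2
  · ring
  · rw [C_pa_mul_C_pb h0, ← map_mul, ← pow_mul, ← pow_add]; congr 2; omega
  · rw [hN, k1]; simp only [map_mul, map_sub, map_one, map_pow, hP]
  · rw [← map_mul, hN, show 2 * m + s + r + 2 = 2 * (m + 1) + s + r by omega]; exact k2
  · have v1 := isUnit_of_mul_isUnit_right u1
    have ua := (isUnit_pa q s).map C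
    exact ((((((((isUnit_const h0 _).mul (isUnit_const h0 _)).mul ((isUnit_pc q).map C)).mul
      ((isUnit_brkL h0 h1 2).map C)).mul (v1.mul u2)).mul u3).mul ua).mul ((u3.mul ua).pow m))

/-- The recursion for the matrix elements `P_n α^r β^s` on the level of polynomials, which is
`awQ_contiguous_ad`; the denominators of its coefficients are cleared. -/
theorem pPoly_recurrence_αβ (h0 : 0 < q) (h1 : q < 1) {n r s k j N : ℕ} (hk : k = n + s + r + 1)
    (hj : j = n + r) (hN : N = 2 * n + s + r + 1) :
    C (brkR q (s + 1 - r)) * pPoly q n (N + 1) (k + 1) (j + 1) =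
      C (brkR q (-r)) * pPoly q n N k j +
        C (brkR q (2 + n + s)) * pPoly q n N k (j + 1) := by
  obtain ⟨P, hP⟩ : ∃ P, P = algebraMap ℂ (Mer ⊗[ℂ] Mer)[X] ((q : ℂ) ^ 2) := ⟨_, rfl⟩
  have hp := q_sq_pow_ne_one h0 h1
  have S := pPoly_spec h0 h1 n (N + 1) (k + 1) (j + 1) (s + 1) (r + 1)
    (by subst hk hj; push_cast; ring_nf; rw [abs_of_nonpos] <;> [ring; linarith])
    (by subst hN hk hj; push_cast; ring_nf; rw [abs_of_nonpos] <;> [ring; linarith]) hP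
  have S1 := pPoly_spec h0 h1 n N k j (s + 1) r
    (by subst hk hj; push_cast; ring_nf; rw [abs_of_nonpos] <;> [ring; linarith])
    (by subst hN hk hj; push_cast; ring_nf; simp) hP
  have S2 := pPoly_spec h0 h1 n N k (j + 1) s (r + 1)
    (by subst hk hj; push_cast; ring_nf; simp)
    (by subst hN hk hj; push_cast; ring_nf; rw [abs_of_nonpos] <;> [ring; linarith]) hP
  have R :=
    awQ_contiguous_ad (q_sq_ne_zero h0) hp n (C (pa q s)) (C (pb q)) (C (pc q)) (C (pd q r)) X hP
  have k1 := congrArg (algebraMap ℂ (Mer ⊗[ℂ] Mer)[X]) (pConst_αβ_left h0 h1 n r s)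
  have k2 := congrArg (algebraMap ℂ (Mer ⊗[ℂ] Mer)[X]) (pConst_αβ_right h0 h1 n r s)
  have B1 := congrArg C (brk_αβ_sub h0 s r)
  have B2 := congrArg C (brk_αβ_left h0 s r)
  have B3 := congrArg C (brk_αβ_right h0 n s r)
  have hC (z : ℂ) : C (algebraMap ℂ (Mer ⊗[ℂ] Mer) z) = algebraMap ℂ (Mer ⊗[ℂ] Mer)[X] z := rfl
  simp only [C_mul, C_sub, C_neg, C_1, C_pow, hC, ← hP] at B1 B2 B3
  have ha : C (pa q ((s + 1 : ℕ) : ℤ)) = P * C (pa q s) := by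
    push_cast; rw [pa_succ h0, C_mul, hC, hP]
  have hd : C (pd q ((r + 1 : ℕ) : ℤ)) = P * C (pd q r) := by
    push_cast; rw [pd_succ h0, C_mul, hC, hP]
  rw [hd] at S S2
  rw [ha] at S S1
  rw [mul_left_comm (C (pb q)) P] at S S2
  have u1 := isUnit_poch_pb_pc h0 h1 n hP
  have u2 := isUnit_poch_pb_pd h0 h1 (n + 1) r hP
  have hq := poch_succ' (C (pb q) * C (pd q r)) P n
  rw [poch_succ'] at u2
  rw [poch_succ] at hq
  have u3 : IsUnit P := by rw [hP]; exact isUnit_const h0 2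
  have e1 := C_pa_mul_C_pb h0 (q := q) s
  have e2 := C_pc_mul_C_pd h0 (q := q) r
  have f1 : P ^ n * (C (pa q s) * C (pb q)) = algebraMap ℂ _ (((q : ℂ) ^ 2) ^ (n + s + 1)) := by
    rw [e1, hP, ← map_pow, ← map_mul, ← pow_add, add_assoc]
  have f2 : P ^ n * (C (pc q) * C (pd q r)) = algebraMap ℂ _ (((q : ℂ) ^ 2) ^ (n + r + 1)) := by
    rw [e2, hP, ← map_pow, ← map_mul, ← pow_add, add_assoc]
  have f3 : P ^ n * (C (pa q s) * C (pb q) * C (pc q) * C (pd q r)) =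
      algebraMap ℂ _ (((q : ℂ) ^ 2) ^ (n + s + r + 2)) := by
    rw [mul_assoc _ (C (pc q)), e1, e2, hP, ← map_pow, ← map_mul, ← map_mul, ← pow_add, ← pow_add]
    congr 2; omega
  refine recurrence_of_contiguous_ad (a := C (pa q s)) (b := C (pb q)) (c := C (pc q))
    (d := C (pd q r)) (Pn := P ^ n) (A := (P * C (pa q s)) ^ n)
    (A' := C (pa q s) ^ n) (B := C (pb q) ^ n)
    (D := poch (C (pb q) * C (pc q)) P n * poch (P * (C (pb q) * C (pd q r))) P n)
    (v := algebraMap ℂ _ ((q : ℂ) ^ (s + 1))) (w := algebraMap ℂ _ ((q : ℂ) ^ (n + 1 + r)))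
    (u := C (qexp₂ q 0 1 (s + 1 - r)))
    (κ := algebraMap ℂ _ (pConst q n (N + 1) (j + 1) (r + 1)))
    (κ1 := algebraMap ℂ _ (pConst q n N j r))
    (κ2 := algebraMap ℂ _ (pConst q n N (j + 1) (r + 1)))
    R ?_ ?_ ?_ ?_ ?_ ?_ B1 B2 B3 ?_
  · linear_combination S
  · linear_combination (1 - P ^ n * (C (pb q) * C (pd q r))) * S1 -
      (poch (C (pb q) * C (pc q)) P n * (P * C (pa q s)) ^ n * pPoly q n N k j) * hq
  · linear_combination S2
  · rw [mul_pow]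
  · rw [f3, f2, hN, hj]
    simp only [map_mul, map_sub, map_one] at k1
    exact k1
  · rw [f3, mul_comm (C (pc q) * C (pd q r)), f2, f1, hN, hj]
    simp only [map_mul, map_sub, map_one] at k2
    exact k2
  · have v1 := isUnit_of_mul_isUnit_right u2
    have ua := (isUnit_pa q s).map C
    rw [f3]
    exact (((((ua.mul (isUnit_const h0 _)).mul ((isUnit_pc q).map C)).mul (u3.pow n)).mul
      (isUnit_one_sub_C_mul (q_sq_pow_ne_one h0 h1 (n + s + r + 1)) rfl)).mul (u1.mul v1)).mul
      ((u3.mul ua).pow n)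

theorem pPoly_zero_eq_one (h0 : 0 < q) (h1 : q < 1) {N k j : ℕ} (hj : j = 0 ∨ j = N) :
    pPoly q 0 N k j = 1 := by
  have hF := poch_self_ne_zero (q_sq_pow_ne_one h0 h1)
  have S := pPoly_spec h0 h1 0 N k j _ _ (Int.natCast_natAbs _).symm (Int.natCast_natAbs _).symm
    (P := algebraMap ℂ _ ((q : ℂ) ^ 2)) rfl
  have hc : pConst q 0 N j ((N : ℤ) - k - j).natAbs = 1 := by
    have hN := hF N
    rcases hj with rfl | rfl <;> simp [pConst, hN]
  rw [hc] at S
  simp only [awQ, awSum, awTerm, awRow, zero_add, Finset.sum_range_one, poch_zero, awBasis_zero,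
    pow_zero, div_one, map_one, one_mul, mul_one, Nat.sub_zero] at S
  exact S

end Recurrences

/-! ### Functions and homogeneous elements -/

section Shift

theorem shift_shift (a b : ℂ) (f : Mer) : Mer.shift a (Mer.shift b f) = Mer.shift (a + b) f := by
  obtain ⟨f, rfl⟩ := Ideal.Quotient.mk_surjective f
  refine congrArg Mer.mk (Subtype.ext (funext fun z => ?_))
  change (f : ℂ → ℂ) (z + a + b) = (f : ℂ → ℂ) (z + (a + b))
  rw [add_assoc]

theorem shift_zero (f : Mer) : Mer.shift 0 f = f := by
  obtain ⟨f, rfl⟩ := Ideal.Quotient.mk_surjective f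
  refine congrArg Mer.mk (Subtype.ext (funext fun z => ?_))
  change (f : ℂ → ℂ) (z + 0) = (f : ℂ → ℂ) z
  rw [add_zero]

theorem sft_sft (i j i' j' : ℤ) (F : Mer ⊗[ℂ] Mer) :
    sft i j (sft i' j' F) = sft (i + i') (j + j') F := by
  induction F with
  | zero => simp only [map_zero]
  | add x y hx hy => simp only [map_add, hx, hy]
  | tmul f g => simp only [sft_tmul, shift_shift]; push_cast; rfl

theorem sft_zero (F : Mer ⊗[ℂ] Mer) : sft 0 0 F = F := by
  induction F with
  | zero => simp only [map_zero]
  | add x y hx hy => simp only [map_add, hx, hy]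
  | tmul f g => simp only [sft_tmul, Int.cast_zero, shift_zero]

end Shift

namespace FRSL2
open Polynomial
variable {q : ℝ}

theorem coef_tmul (f g : Mer) : coef q (f ⊗ₜ g) = μl q f * μr q g :=
  Algebra.TensorProduct.lift_tmul _ _ _ _ _

theorem coef_tmul_one (f : Mer) : coef q (f ⊗ₜ 1) = μl q f := by
  rw [coef_tmul, map_one, mul_one]

theorem coef_one_tmul (f : Mer) : coef q (1 ⊗ₜ f) = μr q f := by
  rw [coef_tmul, map_one, one_mul]

theorem coef_brkL (d : ℤ) : coef q (brkL q d) = μl q (brk q d) := coef_tmul_one _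

theorem coef_brkR (d : ℤ) : coef q (brkR q d) = μr q (brk q d) := coef_one_tmul _

theorem coef_commute (F G : Mer ⊗[ℂ] Mer) : coef q F * coef q G = coef q G * coef q F := by
  rw [← map_mul, mul_comm, map_mul]

theorem coef_mul_of {x : FRSL2 q} {m n : ℤ} (hl : ∀ f, μl q f * x = x * μl q (Mer.shift m f))
    (hr : ∀ f, μr q f * x = x * μr q (Mer.shift n f)) (F : Mer ⊗[ℂ] Mer) :
    coef q F * x = x * coef q (sft m n F) := by
  induction F with
  | zero => simp only [map_zero, zero_mul, mul_zero]
  | add F G hF hG => rw [map_add, map_add, map_add, add_mul, mul_add, hF, hG]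
  | tmul f g => rw [sft_tmul, coef_tmul, coef_tmul, mul_assoc, hr, ← mul_assoc, hl, mul_assoc]

/-- A function of `λ`, `μ` is moved past an element of bidegree `(m, n)` by the translation of its
arguments by `m`, `n`. -/
theorem IsHomog.coef_mul {m n : ℤ} {x : FRSL2 q} (h : IsHomog q m n x) (F : Mer ⊗[ℂ] Mer) :
    coef q F * x = x * coef q (sft m n F) := by
  have P {u v w : FreeAlgebra ℂ Gen}
      (h : Rel q (u * v) (v * w)) : proj q u * proj q v = proj q v * proj q w := by
    rw [← map_mul, ← map_mul]; exact proj_rel h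
  have h1 : ((1 : ℤ) : ℂ) = 1 := Int.cast_one
  have h2 : ((-1 : ℤ) : ℂ) = -1 := by rw [Int.cast_neg, Int.cast_one]
  induction h generalizing F with
  | zero m n => rw [mul_zero, zero_mul]
  | one => rw [mul_one, one_mul, sft_zero]
  | a => exact coef_mul_of (fun f => h1 ▸ P (Rel.l_a f)) (fun f => h1 ▸ P (Rel.r_a f)) F
  | b => exact coef_mul_of (fun f => h1 ▸ P (Rel.l_b f)) (fun f => h2 ▸ P (Rel.r_b f)) F
  | c => exact coef_mul_of (fun f => h2 ▸ P (Rel.l_c f)) (fun f => h1 ▸ P (Rel.r_c f)) F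
  | d => exact coef_mul_of (fun f => h2 ▸ P (Rel.l_d f)) (fun f => h2 ▸ P (Rel.r_d f)) F
  | l f => rw [sft_zero, ← coef_tmul_one, coef_commute]
  | r f => rw [sft_zero, ← coef_one_tmul, coef_commute]
  | add _ _ hx hy => rw [mul_add, add_mul, hx, hy]
  | @mul m n m' n' x y _ _ ihx ihy =>
    rw [← mul_assoc, ihx, mul_assoc, ihy, sft_sft, mul_assoc, add_comm m', add_comm n']

theorem IsHomog.μl_mul {m n : ℤ} {x : FRSL2 q} (h : IsHomog q m n x) (d : ℤ) :
    μl q (brk q d) * x = x * μl q (brk q (d + m)) := by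
  rw [← coef_tmul_one, h.coef_mul, sft_tmul, map_one, shift_brk, coef_tmul_one]

theorem IsHomog.μr_mul {m n : ℤ} {x : FRSL2 q} (h : IsHomog q m n x) (d : ℤ) :
    μr q (brk q d) * x = x * μr q (brk q (d + n)) := by
  rw [← coef_one_tmul, h.coef_mul, sft_tmul, map_one, shift_brk, coef_one_tmul]

theorem isHomog_coef (F : Mer ⊗[ℂ] Mer) : IsHomog q 0 0 (coef q F) := by
  induction F with
  | zero => rw [map_zero]; exact .zero 0 0
  | add F G hF hG => rw [map_add]; exact .add hF hG
  | tmul f g => rw [coef_tmul]; exact (IsHomog.l f).mul (.r g)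

section Relations

/-- A relation `X = f Y` with `f` the image of a quotient `u / v`, cleared of its denominator. -/
theorem mul_eq_of_eq_div {g : Mer →ₐ[ℂ] FRSL2 q} {f u v : Mer} {X Y : FRSL2 q} (hv : v ≠ 0)
    (hf : f = u / v) (h : X = g f * Y) : g v * X = g u * Y := by
  rw [h, ← mul_assoc, ← map_mul, hf, mul_div_cancel₀ _ hv]

theorem brk_mul_α_γ (h0 : 0 < q) (h1 : q < 1) :
    μl q (brk q 1) * (α q * γ q) = μl q (brk q 2) * (γ q * α q) :=
  mul_eq_of_eq_div (brk_ne_zero h0 h1 1) (cf_eq_brk h0 h1) (good q h0 h1).A1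

theorem brk_mul_β_δ (h0 : 0 < q) (h1 : q < 1) :
    μl q (brk q 1) * (β q * δ q) = μl q (brk q 2) * (δ q * β q) :=
  mul_eq_of_eq_div (brk_ne_zero h0 h1 1) (cf_eq_brk h0 h1) (good q h0 h1).A2

theorem brk_mul_β_α (h0 : 0 < q) (h1 : q < 1) :
    μr q (brk q 1) * (β q * α q) = μr q (brk q 0) * (α q * β q) :=
  mul_eq_of_eq_div (brk_ne_zero h0 h1 1) (ce_eq_brk h0 h1) (good q h0 h1).A3

theorem brk_mul_δ_γ (h0 : 0 < q) (h1 : q < 1) :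
    μr q (brk q 1) * (δ q * γ q) = μr q (brk q 0) * (γ q * δ q) :=
  mul_eq_of_eq_div (brk_ne_zero h0 h1 1) (ce_eq_brk h0 h1) (good q h0 h1).A4

theorem brk_mul_δ_α (h0 : 0 < q) (h1 : q < 1) :
    μr q (brk q 1) * (δ q * α q) = μr q (brk q 0) * (γ q * β q) + μr q (brk q 1) := by
  have h := (good q h0 h1).A8
  rw [h, mul_add, mul_one, AlgHom.coe_toRingHom, ← mul_assoc, ← map_mul, ce_eq_brk h0 h1,
    mul_div_cancel₀ _ (brk_ne_zero h0 h1 1)]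

end Relations

/-! ### The central element -/

section Central

/-- With `[z] = q^z - q^{-z}`, `Ξ = q^{λ-μ+1} + q^{μ-λ-1} - [λ + 2] [μ] γβ`. -/
theorem Ξ_eq_γ_β (h0 : 0 < q) :
    Ξ q = coef q (pb q + qexp₂ q (-1) 1 (-1)) -
      μl q (brk q 2) * (μr q (brk q 0) * (γ q * β q)) := by
  have : qexp₂ q (-1) (-1) (-2) * (1 - qexp₂ q 2 0 4) * (1 - qexp₂ q 0 2 0) =
      brkL q 2 * brkR q 0 := by
    simp only [brkL_eq, brkR_eq h0, mul_sub, sub_mul, qexp₂_mul, mul_one]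
    ring_nf
  rw [Ξ, this, map_mul, coef_brkL, coef_brkR, mul_assoc, pb]

/-- With `[z] = q^z - q^{-z}`, `Ξ = q^{λ+μ+3} + q^{-λ-μ-3} - [λ + 2] [μ + 1] δα`, by the rule for
`δα` in terms of `γβ`. -/
theorem Ξ_eq_δ_α (h0 : 0 < q) (h1 : q < 1) :
    Ξ q = coef q (pc q + qexp₂ q (-1) (-1) (-3)) -
      μl q (brk q 2) * (μr q (brk q 1) * (δ q * α q)) := by
  have e : pc q + qexp₂ q (-1) (-1) (-3) = pb q + qexp₂ q (-1) 1 (-1) + brkL q 2 * brkR q 1 := by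
    simp only [brkL_eq, brkR_eq h0, mul_sub, sub_mul, qexp₂_mul, pb, pc]
    ring_nf
  rw [Ξ_eq_γ_β h0, brk_mul_δ_α h0 h1, e, map_add (coef q) (_ + _), map_mul, coef_brkL, coef_brkR]
  noncomm_ring

/-- If a function `B(λ, μ)` is invariant under the translation that moving past `x` causes, `x`
commutes with `Ξ = B - P` as soon as it commutes with `P`. In the form `Ξ_eq_γ_β` this applies to
`α` and `δ`, in the form `Ξ_eq_δ_α` to `β` and `γ`. -/
theorem commute_Ξ_of {x P : FRSL2 q} {m n : ℤ} {B : Mer ⊗[ℂ] Mer} (h : Ξ q = coef q B - P)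
    (hx : IsHomog q m n x) (hB : sft m n B = B) (hP : P * x = x * P) : Ξ q * x = x * Ξ q := by
  rw [h, sub_mul, mul_sub, hx.coef_mul, hB, hP]

theorem Ξ_mul_α (h0 : 0 < q) (h1 : q < 1) : Ξ q * α q = α q * Ξ q := by
  refine commute_Ξ_of (Ξ_eq_γ_β h0) .a ?_ ?_
  · rw [map_add, pb, sft_qexp₂ h0, sft_qexp₂ h0]; congr 2
  have e1 := IsHomog.c.μr_mul (q := q) 0
  have e2 := IsHomog.c.μr_mul (q := q) (-1)
  have e3 := IsHomog.a.μl_mul (q := q) 1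
  have e4 := IsHomog.a.μr_mul (q := q) (-1)
  norm_num at e1 e2 e3 e4
  calc μl q (brk q 2) * (μr q (brk q 0) * (γ q * β q)) * α q
      = μl q (brk q 2) * (μr q (brk q 0) * γ q) * (β q * α q) := by simp only [mul_assoc]
    _ = μl q (brk q 2) * γ q * (μr q (brk q 1) * (β q * α q)) := by rw [e1]; simp only [mul_assoc]
    _ = μl q (brk q 2) * (γ q * μr q (brk q 0)) * (α q * β q) := by
        rw [brk_mul_β_α h0 h1]; simp only [mul_assoc]
    _ = (μl q (brk q 2) * μr q (brk q (-1))) * γ q * (α q * β q) := by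
        rw [← e2]; simp only [mul_assoc]
    _ = μr q (brk q (-1)) * (μl q (brk q 2) * (γ q * α q)) * β q := by
        rw [(μl_μr_commute q _ _).eq]; simp only [mul_assoc]
    _ = (μr q (brk q (-1)) * μl q (brk q 1)) * α q * γ q * β q := by
        rw [← brk_mul_α_γ h0 h1]; simp only [mul_assoc]
    _ = μl q (brk q 1) * (μr q (brk q (-1)) * α q) * γ q * β q := by
        rw [← (μl_μr_commute q _ _).eq]; simp only [mul_assoc]
    _ = (μl q (brk q 1) * α q) * μr q (brk q 0) * γ q * β q := by
        rw [e4]; simp only [mul_assoc]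
    _ = _ := by rw [e3]; simp only [mul_assoc]

theorem Ξ_mul_δ (h0 : 0 < q) (h1 : q < 1) : Ξ q * δ q = δ q * Ξ q := by
  refine commute_Ξ_of (Ξ_eq_γ_β h0) .d ?_ ?_
  · rw [map_add, pb, sft_qexp₂ h0, sft_qexp₂ h0]; congr 2
  have e1 := IsHomog.c.μl_mul (q := q) 2
  have e2 := IsHomog.c.μl_mul (q := q) 3
  have e3 := IsHomog.d.μl_mul (q := q) 3
  have e4 := IsHomog.d.μr_mul (q := q) 1
  norm_num at e1 e2 e3 e4
  calc μl q (brk q 2) * (μr q (brk q 0) * (γ q * β q)) * δ q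
      = (μl q (brk q 2) * μr q (brk q 0)) * γ q * (β q * δ q) := by simp only [mul_assoc]
    _ = μr q (brk q 0) * (μl q (brk q 2) * γ q) * (β q * δ q) := by
        rw [(μl_μr_commute q _ _).eq]; simp only [mul_assoc]
    _ = μr q (brk q 0) * γ q * (μl q (brk q 1) * (β q * δ q)) := by rw [e1]; simp only [mul_assoc]
    _ = μr q (brk q 0) * (γ q * μl q (brk q 2)) * (δ q * β q) := by
        rw [brk_mul_β_δ h0 h1]; simp only [mul_assoc]
    _ = (μr q (brk q 0) * μl q (brk q 3)) * γ q * (δ q * β q) := by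
        rw [← e2]; simp only [mul_assoc]
    _ = μl q (brk q 3) * (μr q (brk q 0) * (γ q * δ q)) * β q := by
        rw [← (μl_μr_commute q _ _).eq]; simp only [mul_assoc]
    _ = μl q (brk q 3) * (μr q (brk q 1) * δ q) * γ q * β q := by
        rw [← brk_mul_δ_γ h0 h1]; simp only [mul_assoc]
    _ = (μl q (brk q 3) * δ q) * μr q (brk q 0) * γ q * β q := by
        rw [e4]; simp only [mul_assoc]
    _ = _ := by rw [e3]; simp only [mul_assoc]

theorem Ξ_mul_β (h0 : 0 < q) (h1 : q < 1) : Ξ q * β q = β q * Ξ q := by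
  refine commute_Ξ_of (Ξ_eq_δ_α h0 h1) .b ?_ ?_
  · rw [map_add, pc, sft_qexp₂ h0, sft_qexp₂ h0]; congr 2
  have e1 := IsHomog.d.μr_mul (q := q) 1
  have e2 := IsHomog.d.μr_mul (q := q) 2
  have e3 := IsHomog.b.μl_mul (q := q) 1
  have e4 := IsHomog.b.μr_mul (q := q) 2
  norm_num at e1 e2 e3 e4
  calc μl q (brk q 2) * (μr q (brk q 1) * (δ q * α q)) * β q
      = μl q (brk q 2) * (μr q (brk q 1) * δ q) * (α q * β q) := by simp only [mul_assoc]
    _ = μl q (brk q 2) * δ q * (μr q (brk q 0) * (α q * β q)) := by rw [e1]; simp only [mul_assoc]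
    _ = μl q (brk q 2) * (δ q * μr q (brk q 1)) * (β q * α q) := by
        rw [← brk_mul_β_α h0 h1]; simp only [mul_assoc]
    _ = (μl q (brk q 2) * μr q (brk q 2)) * δ q * (β q * α q) := by
        rw [← e2]; simp only [mul_assoc]
    _ = μr q (brk q 2) * (μl q (brk q 2) * (δ q * β q)) * α q := by
        rw [(μl_μr_commute q _ _).eq]; simp only [mul_assoc]
    _ = (μr q (brk q 2) * μl q (brk q 1)) * β q * δ q * α q := by
        rw [← brk_mul_β_δ h0 h1]; simp only [mul_assoc]
    _ = μl q (brk q 1) * (μr q (brk q 2) * β q) * δ q * α q := by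
        rw [← (μl_μr_commute q _ _).eq]; simp only [mul_assoc]
    _ = (μl q (brk q 1) * β q) * μr q (brk q 1) * δ q * α q := by
        rw [e4]; simp only [mul_assoc]
    _ = _ := by rw [e3]; simp only [mul_assoc]

theorem Ξ_mul_γ (h0 : 0 < q) (h1 : q < 1) : Ξ q * γ q = γ q * Ξ q := by
  refine commute_Ξ_of (Ξ_eq_δ_α h0 h1) .c ?_ ?_
  · rw [map_add, pc, sft_qexp₂ h0, sft_qexp₂ h0]; congr 2
  have e1 := IsHomog.d.μl_mul (q := q) 2
  have e2 := IsHomog.d.μl_mul (q := q) 3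
  have e3 := IsHomog.c.μl_mul (q := q) 3
  have e4 := IsHomog.c.μr_mul (q := q) 0
  norm_num at e1 e2 e3 e4
  calc μl q (brk q 2) * (μr q (brk q 1) * (δ q * α q)) * γ q
      = (μl q (brk q 2) * μr q (brk q 1)) * δ q * (α q * γ q) := by simp only [mul_assoc]
    _ = μr q (brk q 1) * (μl q (brk q 2) * δ q) * (α q * γ q) := by
        rw [(μl_μr_commute q _ _).eq]; simp only [mul_assoc]
    _ = μr q (brk q 1) * δ q * (μl q (brk q 1) * (α q * γ q)) := by rw [e1]; simp only [mul_assoc]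
    _ = μr q (brk q 1) * (δ q * μl q (brk q 2)) * (γ q * α q) := by
        rw [brk_mul_α_γ h0 h1]; simp only [mul_assoc]
    _ = (μr q (brk q 1) * μl q (brk q 3)) * δ q * (γ q * α q) := by
        rw [← e2]; simp only [mul_assoc]
    _ = μl q (brk q 3) * (μr q (brk q 1) * (δ q * γ q)) * α q := by
        rw [← (μl_μr_commute q _ _).eq]; simp only [mul_assoc]
    _ = μl q (brk q 3) * (μr q (brk q 0) * γ q) * δ q * α q := by
        rw [brk_mul_δ_γ h0 h1]; simp only [mul_assoc]
    _ = (μl q (brk q 3) * γ q) * μr q (brk q 1) * δ q * α q := by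
        rw [e4]; simp only [mul_assoc]
    _ = _ := by rw [e3]; simp only [mul_assoc]

theorem isHomog_Ξ (h0 : 0 < q) : IsHomog q 0 0 (Ξ q) := by
  have : IsHomog q 0 0 (coef q (-1) * (μl q (brk q 2) * (μr q (brk q 0) * (γ q * β q)))) :=
    (isHomog_coef _).mul ((IsHomog.l _).mul ((IsHomog.r _).mul (.mul .c .b)))
  rw [Ξ_eq_γ_β h0, sub_eq_add_neg, ← neg_one_mul (μl q (brk q 2) * _), ← map_one (coef q),
    ← map_neg]
  exact (isHomog_coef _).add this

theorem coef_mul_Ξ (h0 : 0 < q) (F : Mer ⊗[ℂ] Mer) : coef q F * Ξ q = Ξ q * coef q F := by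
  rw [(isHomog_Ξ h0).coef_mul, sft_zero]

theorem Ξ_central (h0 : 0 < q) (h1 : q < 1) (x : FRSL2 q) : Ξ q * x = x * Ξ q := by
  obtain ⟨y, rfl⟩ := RingQuot.mkAlgHom_surjective ℂ (Rel q) x
  change Ξ q * proj q y = proj q y * Ξ q
  induction y with
  | grade0 z => rw [AlgHom.commutes, Algebra.commutes]
  | grade1 g =>
    cases g with
    | a => exact Ξ_mul_α h0 h1
    | b => exact Ξ_mul_β h0 h1
    | c => exact Ξ_mul_γ h0 h1
    | d => exact Ξ_mul_δ h0 h1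
    | l f => have := coef_mul_Ξ h0 (f ⊗ₜ 1); rw [coef_tmul_one] at this; exact this.symm
    | r f => have := coef_mul_Ξ h0 (1 ⊗ₜ f); rw [coef_one_tmul] at this; exact this.symm
  | mul a b ha hb => rw [map_mul, ← mul_assoc, ha, mul_assoc, hb, mul_assoc]
  | add a b ha hb => rw [map_add, mul_add, add_mul, ha, hb]

end Central

/-! ### Polynomials in the central element -/

section Eval

variable (q) in
/-- The value at `x = Ξ / 2` of a polynomial with coefficients functions of `λ` and `μ`. -/
def Φ (h0 : 0 < q) : (Mer ⊗[ℂ] Mer)[X] →+* FRSL2 q :=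
  eval₂RingHom' (coef q : Mer ⊗[ℂ] Mer →+* FRSL2 q) ((1 / 2 : ℂ) • Ξ q) fun F =>
    (show Commute (coef q F) (Ξ q) from coef_mul_Ξ h0 F).smul_right _

theorem Φ_C (h0 : 0 < q) (F : Mer ⊗[ℂ] Mer) : Φ q h0 (C F) = coef q F := eval₂_C _ _

theorem Φ_X (h0 : 0 < q) : Φ q h0 X = (1 / 2 : ℂ) • Ξ q := eval₂_X _ _

theorem Φ_pPoly (h0 : 0 < q) (n N k j : ℕ) : Φ q h0 (pPoly q n N k j) = Pelt q n N k j := by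
  rw [pPoly, map_mul, Φ_C]; rfl

theorem Φ_mul (h0 : 0 < q) (h1 : q < 1) {m n : ℤ} {x : FRSL2 q} (hx : IsHomog q m n x)
    (P : (Mer ⊗[ℂ] Mer)[X]) : Φ q h0 P * x = x * Φ q h0 (sftP m n P) := by
  induction P using Polynomial.induction_on' with
  | add P Q hP hQ => simp only [map_add, add_mul, mul_add, hP, hQ]
  | monomial k F =>
    have hc : Commute (((1 / 2 : ℂ) • Ξ q) ^ k) x :=
      (Commute.smul_left (show Commute (Ξ q) x from Ξ_central h0 h1 x) _).pow_left k
    rw [← C_mul_X_pow_eq_monomial, map_mul, map_mul, map_mul, map_pow, map_pow, map_pow, sftP_C,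
      sftP_X, Φ_C, Φ_C, Φ_X, mul_assoc, hc.eq, ← mul_assoc, hx.coef_mul, mul_assoc]

theorem isHomog_Φ (h0 : 0 < q) (P : (Mer ⊗[ℂ] Mer)[X]) : IsHomog q 0 0 (Φ q h0 P) := by
  induction P using Polynomial.induction_on' with
  | add P Q hP hQ => rw [map_add]; exact hP.add hQ
  | monomial k F =>
    rw [← C_mul_X_pow_eq_monomial, map_mul, map_pow, Φ_C, Φ_X]
    have h : IsHomog q 0 0 (((1 / 2 : ℂ) • Ξ q) ^ k) := by
      have := IsHomog.pow ((grade q 0 0).smul_mem (1 / 2) (isHomog_Ξ h0)) k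
      simpa using this
    exact (isHomog_coef F).mul h

theorem Φ_awFactor (h0 : 0 < q) (F : Mer ⊗[ℂ] Mer) :
    Φ q h0 (awFactor X (C F)) = 1 - coef q F * Ξ q + coef q (F ^ 2) := by
  rw [awFactor, map_add, map_sub, map_one, map_mul, map_mul, Φ_C, Φ_X, ← C_pow, Φ_C,
    map_ofNat, mul_smul_comm, mul_assoc, two_mul, ← two_smul ℂ (coef q F * Ξ q), smul_smul]
  norm_num

theorem Φ_cbPoly (h0 : 0 < q) (h1 : q < 1) : Φ q h0 (cbPoly q) = γ q * β q := by
  have e : pb q * qexp₂ q (-1) 1 (-1) = 1 := by rw [pb, qexp₂_mul]; exact qexp₂_zero q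
  have hu := Ring.inverse_mul_cancel _
    (((isUnit_pb q).mul (isUnit_brkL h0 h1 2)).mul (isUnit_brkR h0 h1 0))
  have : 1 - coef q (pb q) * Ξ q + coef q (pb q ^ 2) =
      coef q (pb q * brkL q 2 * brkR q 0) * (γ q * β q) := by
    have e' : (1 : FRSL2 q) = coef q (pb q) * coef q (qexp₂ q (-1) 1 (-1)) := by
      rw [← map_mul, e, map_one]
    rw [Ξ_eq_γ_β h0, e', pow_two, map_mul, map_mul, map_mul, coef_brkL, coef_brkR, map_add]
    noncomm_ring
  rw [cbPoly, map_mul, Φ_C, Φ_awFactor, this, ← mul_assoc, ← map_mul, hu, map_one, one_mul]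

theorem Φ_daPoly (h0 : 0 < q) (h1 : q < 1) : Φ q h0 (daPoly q) = δ q * α q := by
  have e : pc q * qexp₂ q (-1) (-1) (-3) = 1 := by rw [pc, qexp₂_mul]; exact qexp₂_zero q
  have hu := Ring.inverse_mul_cancel _
    (((isUnit_pc q).mul (isUnit_brkL h0 h1 2)).mul (isUnit_brkR h0 h1 1))
  have : 1 - coef q (pc q) * Ξ q + coef q (pc q ^ 2) =
      coef q (pc q * brkL q 2 * brkR q 1) * (δ q * α q) := by
    have e' : (1 : FRSL2 q) = coef q (pc q) * coef q (qexp₂ q (-1) (-1) (-3)) := by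
      rw [← map_mul, e, map_one]
    rw [Ξ_eq_δ_α h0 h1, e', pow_two, map_mul, map_mul, map_mul, coef_brkL, coef_brkR, map_add]
    noncomm_ring
  rw [daPoly, map_mul, Φ_C, Φ_awFactor, this, ← mul_assoc, ← map_mul, hu, map_one, one_mul]

end Eval
end FRSL2

/-! ### Powers of the generators -/

namespace FRSL2
open Polynomial
variable {q : ℝ}

section Quotients

variable (q) in
/-- The quotient `(q^{μ+d} - q^{-μ-d}) / (q^{μ+e} - q^{-μ-e})`. -/
def qtR (d e : ℤ) : Mer ⊗[ℂ] Mer := 1 ⊗ₜ (brk q d / brk q e)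

theorem coef_qtR (d e : ℤ) : coef q (qtR q d e) = μr q (brk q d / brk q e) := coef_one_tmul _

theorem brkR_mul_qtR (h0 : 0 < q) (h1 : q < 1) (d e : ℤ) : brkR q e * qtR q d e = brkR q d := by
  rw [brkR, qtR, Algebra.TensorProduct.tmul_mul_tmul, one_mul,
    mul_div_cancel₀ _ (brk_ne_zero h0 h1 e)]
  rfl

theorem qtR_mul_qtR (h0 : 0 < q) (h1 : q < 1) (d e f : ℤ) : qtR q d e * qtR q e f = qtR q d f := by
  rw [qtR, qtR, qtR, Algebra.TensorProduct.tmul_mul_tmul, one_mul,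
    div_mul_div_cancel₀ (brk_ne_zero h0 h1 e)]

theorem qtR_self (h0 : 0 < q) (h1 : q < 1) (d : ℤ) : qtR q d d = 1 := by
  rw [qtR, div_self (brk_ne_zero h0 h1 d)]; rfl

theorem sft_qtR (i j d e : ℤ) : sft i j (qtR q d e) = qtR q (d + j) (e + j) := by
  rw [qtR, sft_tmul, map_one, map_div₀, shift_brk, shift_brk]; rfl

theorem IsHomog.qtR_mul {m n : ℤ} {x : FRSL2 q} (h : IsHomog q m n x) (d e : ℤ) :
    coef q (qtR q d e) * x = x * coef q (qtR q (d + n) (e + n)) := by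
  rw [h.coef_mul, sft_qtR]

theorem δ_mul_γ (h0 : 0 < q) (h1 : q < 1) : δ q * γ q = coef q (qtR q 0 1) * (γ q * δ q) := by
  rw [coef_qtR, ← ce_eq_brk h0 h1]; exact (good q h0 h1).A4

theorem β_mul_α (h0 : 0 < q) (h1 : q < 1) : β q * α q = coef q (qtR q 0 1) * (α q * β q) := by
  rw [coef_qtR, ← ce_eq_brk h0 h1]; exact (good q h0 h1).A3

theorem γ_mul_δ (h0 : 0 < q) (h1 : q < 1) : γ q * δ q = coef q (qtR q 1 0) * (δ q * γ q) := by
  rw [δ_mul_γ h0 h1, ← mul_assoc, ← map_mul, qtR_mul_qtR h0 h1, qtR_self h0 h1, map_one, one_mul]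

theorem α_mul_β (h0 : 0 < q) (h1 : q < 1) : α q * β q = coef q (qtR q 1 0) * (β q * α q) := by
  rw [β_mul_α h0 h1, ← mul_assoc, ← map_mul, qtR_mul_qtR h0 h1, qtR_self h0 h1, map_one, one_mul]

/-- In these rules for powers the quotients `[μ + d] / [μ + e]` that arise from the single steps
telescope. -/
theorem γ_mul_δ_pow (h0 : 0 < q) (h1 : q < 1) (r : ℕ) :
    γ q * δ q ^ r = δ q ^ r * (coef q (qtR q 0 (-r)) * γ q) := by
  induction r with
  | zero => simp [qtR_self h0 h1]
  | succ r ih =>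
    have e : γ q * δ q = δ q * (coef q (qtR q 0 (-1)) * γ q) := by
      rw [γ_mul_δ h0 h1, ← mul_assoc, IsHomog.d.qtR_mul, mul_assoc]; norm_num
    have e2 : coef q (qtR q 0 (-r)) * δ q = δ q * coef q (qtR q (-1) (-(r + 1 : ℕ))) := by
      rw [IsHomog.d.qtR_mul]; push_cast; ring_nf
    rw [pow_succ, ← mul_assoc, ih, mul_assoc, mul_assoc, e, ← mul_assoc (coef q _), e2]
    simp only [mul_assoc]
    rw [← mul_assoc (coef q _) (coef q _), ← map_mul, mul_comm (qtR q _ _), qtR_mul_qtR h0 h1]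

theorem δ_pow_mul_γ (h0 : 0 < q) (h1 : q < 1) (r : ℕ) :
    δ q ^ r * γ q = coef q (qtR q 0 r) * (γ q * δ q ^ r) := by
  rw [γ_mul_δ_pow h0 h1, ← mul_assoc, (IsHomog.d.pow r).qtR_mul, mul_assoc, ← mul_assoc (coef q _),
    ← map_mul]
  simp only [mul_neg, mul_one, zero_add, add_neg_cancel]
  rw [qtR_mul_qtR h0 h1, qtR_self h0 h1, map_one, one_mul]

theorem α_pow_mul_β (h0 : 0 < q) (h1 : q < 1) (r : ℕ) :
    α q ^ r * β q = coef q (qtR q 1 (1 - r)) * (β q * α q ^ r) := by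
  induction r with
  | zero => simp [qtR_self h0 h1]
  | succ r ih =>
    have e : α q * coef q (qtR q 1 (1 - r)) = coef q (qtR q 0 (1 - (r + 1 : ℕ))) * α q := by
      rw [IsHomog.a.qtR_mul]; push_cast; ring_nf
    rw [pow_succ', mul_assoc, ih, ← mul_assoc, e, mul_assoc, ← mul_assoc (α q), α_mul_β h0 h1,
      mul_assoc, ← mul_assoc, ← map_mul, mul_comm (qtR q _ _), qtR_mul_qtR h0 h1, mul_assoc]

theorem β_pow_mul_α (h0 : 0 < q) (h1 : q < 1) (m : ℕ) :
    β q ^ m * α q = coef q (qtR q 0 m) * (α q * β q ^ m) := by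
  induction m with
  | zero => simp [qtR_self h0 h1]
  | succ r ih =>
    have e : β q * coef q (qtR q 0 r) = coef q (qtR q 1 (r + 1 : ℕ)) * β q := by
      rw [IsHomog.b.qtR_mul]; push_cast; ring_nf
    rw [pow_succ', mul_assoc, ih, ← mul_assoc, e, mul_assoc, ← mul_assoc (β q), β_mul_α h0 h1,
      mul_assoc, ← mul_assoc, ← map_mul, mul_comm (qtR q _ _), qtR_mul_qtR h0 h1, mul_assoc]

theorem C_qtR_mul_cancel (h0 : 0 < q) (h1 : q < 1) (d e : ℤ) :
    C (brkR q e) * C (qtR q d e) = C (brkR q d) := by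
  rw [← C_mul, brkR_mul_qtR h0 h1]

theorem isUnit_C_brkR (h0 : 0 < q) (h1 : q < 1) (e : ℤ) : IsUnit (C (brkR q e)) :=
  (isUnit_brkR h0 h1 e).map C

theorem pPoly_eq_γδ (h0 : 0 < q) (h1 : q < 1) {n r s j N : ℕ} (hj : j = n + s)
    (hN : N = n + r + j + 1) :
    pPoly q (n + 1) (N + 1) (n + 1) (j + 1) =
      daPoly q * sftP 1 1 (pPoly q n N n j) +
        C (qtR q (2 + j) 1) * C (qtR q 0 (-r)) * cbPoly q * sftP 1 (-1) (pPoly q n N n (j +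
          1)) := by
  refine ((isUnit_C_brkR h0 h1 1).mul (isUnit_C_brkR h0 h1 (-r))).mul_left_cancel ?_
  rw [pPoly_recurrence_γδ h0 h1 hj hN, ← C_qtR_mul_cancel h0 h1 (2 + j) 1,
    ← C_qtR_mul_cancel h0 h1 0 (-r)]
  ring

theorem pPoly_eq_γα (h0 : 0 < q) (h1 : q < 1) {n r s k j N : ℕ} (hk : k = r + n + 1)
    (hj : j + 1 = r + n + s + 2) (hN : N = n + (r + n + s + 2)) :
    pPoly q (n + 1) (N + 1) (k + 1) (j + 1) = pPoly q (n + 1) N k j +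
        C (qtR q (n + s + 2) (-r)) * C (qtR q 0 (-r - 1)) * cbPoly q *
          sftP 1 (-1) (pPoly q n N k (j + 1)) := by
  refine ((isUnit_C_brkR h0 h1 (-r)).mul (isUnit_C_brkR h0 h1 (-r - 1))).mul_left_cancel ?_
  rw [pPoly_recurrence_γα h0 h1 hk hj hN, ← C_qtR_mul_cancel h0 h1 (n + s + 2) (-r),
    ← C_qtR_mul_cancel h0 h1 0 (-r - 1)]
  ring

theorem pPoly_eq_δβ (h0 : 0 < q) (h1 : q < 1) {m r s k N : ℕ} (hk : k = m + 1 + s)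
    (hN : N = 2 * m + s + r + 2) :
    pPoly q (m + 1) (N + 1) (k + 1) (m + 1) =
      C (qtR q 1 (s + 2)) * daPoly q * sftP 1 1 (pPoly q m N k m) +
        C (qtR q (3 + m + s) (s + 2)) * pPoly q (m + 1) N k (m + 1) := by
  refine (isUnit_C_brkR h0 h1 (s + 2)).mul_left_cancel ?_
  rw [pPoly_recurrence_δβ h0 h1 hk hN, ← C_qtR_mul_cancel h0 h1 1 (s + 2),
    ← C_qtR_mul_cancel h0 h1 (3 + m + s) (s + 2)]
  ring

theorem pPoly_eq_αβ (h0 : 0 < q) (h1 : q < 1) {n r s k j N : ℕ} (hk : k = n + s + r + 1)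
    (hj : j = n + r) (hN : N = 2 * n + s + r + 1) :
    pPoly q n (N + 1) (k + 1) (j + 1) =
      C (qtR q (-r) (s + 1 - r)) * pPoly q n N k j +
        C (qtR q (2 + n + s) (s + 1 - r)) * pPoly q n N k (j + 1) := by
  refine (isUnit_C_brkR h0 h1 (s + 1 - r)).mul_left_cancel ?_
  rw [pPoly_recurrence_αβ h0 h1 hk hj hN, ← C_qtR_mul_cancel h0 h1 (-r) (s + 1 - r),
    ← C_qtR_mul_cancel h0 h1 (2 + n + s) (s + 1 - r)]
  ring

end Quotients

/-! ### The recursion for the matrix elements -/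

section Recursion

variable (q) in
/-- The matrix elements of `V_N`, computed from those of `V_{N-1}` by
`γ^{N-k} α^{k+1} = (γ^{N-k} α^k) α` and `γ^{N+1} = γ^N γ`. The value is `0` for `j > N`. The
coefficient in front of the element with index `j` is `[μ + 2 + N - j] / [μ + 2 + N - 2j]`, where
`[z] = q^z - q^{-z}`; for `j = 0` it is `1`. -/
def matElt : ℕ → ℕ → ℕ → FRSL2 q
  | 0, _, 0 => 1
  | 0, _, _ + 1 => 0
  | N + 1, 0, 0 => coef q (qtR q (2 + N) (2 + N)) * matElt N 0 0 * δ q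
  | N + 1, 0, j + 1 => matElt N 0 j * γ q +
      coef q (qtR q (1 + N - j) (N - 2 * j)) * matElt N 0 (j + 1) * δ q
  | N + 1, k + 1, 0 => coef q (qtR q (2 + N) (2 + N)) * matElt N k 0 * β q
  | N + 1, k + 1, j + 1 => matElt N k j * α q +
      coef q (qtR q (1 + N - j) (N - 2 * j)) * matElt N k (j + 1) * β q

theorem matElt_of_lt {N k j : ℕ} (h : N < j) : matElt q N k j = 0 := by
  induction N generalizing k j with
  | zero => cases j with
    | zero => omega
    | succ j => rw [matElt]
  | succ N ih =>
    cases j with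
    | zero => omega
    | succ j =>
      cases k <;> rw [matElt, ih (by omega), ih (by omega)] <;> simp

theorem isHomog_matElt {N k j : ℕ} (hk : k ≤ N) :
    IsHomog q (2 * k - N) (2 * j - N) (matElt q N k j) := by
  induction N generalizing k j with
  | zero =>
    obtain rfl : k = 0 := by omega
    cases j with
    | zero => exact .one
    | succ j => rw [matElt]; exact .zero _ _
  | succ N ih =>
    have c {m n m' n' M M' : ℤ} {x y : FRSL2 q} (F : Mer ⊗[ℂ] Mer) (hx : IsHomog q m n x)
        (hy : IsHomog q m' n' y) (h : m + m' = M) (h' : n + n' = M') :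
        IsHomog q M M' (coef q F * x * y) := by
      subst h h'; exact .mul' ((isHomog_coef F).mul hx) hy (by ring) (by ring)
    cases k with
    | zero => cases j with
      | zero => exact c _ (ih (Nat.zero_le _)) .d (by push_cast; ring) (by push_cast; ring)
      | succ j =>
        exact .add (.mul' (ih (Nat.zero_le _)) .c (by push_cast; ring) (by push_cast; ring))
          (c _ (ih (Nat.zero_le _)) .d (by push_cast; ring) (by push_cast; ring))
    | succ k => cases j with
      | zero => exact c _ (ih (by omega)) .b (by push_cast; ring) (by push_cast; ring)
      | succ j =>
        exact .add (.mul' (ih (by omega)) .a (by push_cast; ring) (by push_cast; ring))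
          (c _ (ih (by omega)) .b (by push_cast; ring) (by push_cast; ring))

end Recursion

end FRSL2

/-! ### The coproduct of the basis vectors -/

namespace FRSL2
variable {q : ℝ}

section Coproduct
open Finset

theorem α_mul_γ (h0 : 0 < q) (h1 : q < 1) :
    α q * γ q = μl q (brk q 2 / brk q 1) * (γ q * α q) := by
  rw [← cf_eq_brk h0 h1]; exact (good q h0 h1).A1

theorem μl_mul_div {m n : ℤ} {x : FRSL2 q} (h : IsHomog q m n x) (d e : ℤ) :
    μl q (brk q d / brk q e) * x = x * μl q (brk q (d + m) / brk q (e + m)) := by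
  rw [← coef_tmul_one, h.coef_mul, sft_tmul, map_one, map_div₀, shift_brk, shift_brk, coef_tmul_one]

theorem α_pow_mul_γ (h0 : 0 < q) (h1 : q < 1) (j : ℕ) :
    α q ^ j * γ q = μl q (brk q 2 / brk q (2 - j)) * (γ q * α q ^ j) := by
  induction j with
  | zero => simp [div_self (brk_ne_zero h0 h1 2)]
  | succ j ih =>
    have e : α q * μl q (brk q 2 / brk q (2 - j)) =
        μl q (brk q 1 / brk q (2 - (j + 1 : ℕ))) * α q := by
      rw [μl_mul_div .a]; push_cast; ring_nf
    rw [pow_succ', mul_assoc, ih, ← mul_assoc, e, mul_assoc, ← mul_assoc (α q), α_mul_γ h0 h1,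
      mul_assoc, ← mul_assoc, ← map_mul, mul_comm (_ / _),
        div_mul_div_cancel₀ (brk_ne_zero h0 h1 1),
      mul_assoc]

theorem vec_mul_α {N j : ℕ} : vec q N j * α q = vec q (N + 1) (j + 1) := by
  rw [vec, vec, Nat.add_sub_add_right, mul_assoc, ← pow_succ]

theorem vec_mul_γ (h0 : 0 < q) (h1 : q < 1) {N j : ℕ} (hj : j ≤ N) :
    vec q N j * γ q = μl q (brk q (2 + N - j) / brk q (2 + N - 2 * j)) * vec q (N + 1) j := by
  obtain ⟨m, rfl⟩ := Nat.exists_eq_add_of_le hj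
  have e1 : j + m - j = m := by omega
  have e2 : j + m + 1 - j = m + 1 := by omega
  have e : γ q ^ m * μl q (brk q 2 / brk q (2 - j)) =
      μl q (brk q (2 + (j + m : ℕ) - j) / brk q (2 + (j + m : ℕ) - 2 * j)) * γ q ^ m := by
    rw [μl_mul_div (IsHomog.c.pow m)]; push_cast; ring_nf
  rw [vec, vec, e1, e2, mul_assoc, α_pow_mul_γ h0 h1, ← mul_assoc, e, mul_assoc, pow_succ,
    mul_assoc]

theorem isHomog_vec {N j : ℕ} (hj : j ≤ N) : IsHomog q (2 * (j : ℤ) - N) N (vec q N j) :=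
  vec_mem q N ⟨j, Nat.lt_succ_of_le hj⟩

theorem pt_zero_left {b : FRSL2 q} {n p : ℤ} (hb : IsHomog q n p b) : pt 0 b = 0 := by
  have := pt_sub_left (hmem (.zero 0 n) hb) (hmem (.zero 0 n) hb)
  rwa [sub_self, sub_self] at this

theorem comul_generator (h0 : 0 < q) (h1 : q < 1) (g : Gen) :
    comul q h0 h1 (proj q (FreeAlgebra.ι ℂ g)) = comulGen q g :=
  (RingQuot.liftAlgHom_mkAlgHom_apply _ _ _ _).trans (FreeAlgebra.lift_ι_apply _ _)

theorem comul_α (h0 : 0 < q) (h1 : q < 1) :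
    comul q h0 h1 (α q) = pt (α q) (α q) + pt (β q) (γ q) :=
  (comul_generator h0 h1 .a).trans comulGen_a

theorem comul_γ (h0 : 0 < q) (h1 : q < 1) :
    comul q h0 h1 (γ q) = pt (γ q) (α q) + pt (δ q) (γ q) :=
  (comul_generator h0 h1 .c).trans comulGen_c

/-- Multiplication of `∑_j t_j ⊗ γ^{N-j} α^j` by `x ⊗ α + y ⊗ γ`, where `(x, y)` stands for `(α, β)`
or `(γ, δ)`: the functions of `λ` produced by `γ^{N-j} α^j γ` pass to the left factor as functions
of `μ`. -/
theorem sum_pt_mul (h0 : 0 < q) (h1 : q < 1) {N : ℕ} {l m : ℤ} {t u : ℕ → FRSL2 q} {x y : FRSL2 q}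
    (ht : ∀ j : ℕ, IsHomog q l (2 * j - N) (t j)) (hx : IsHomog q m 1 x) (hy : IsHomog q m (-1) y)
    (htN : t (N + 1) = 0) (hu0 : u 0 = coef q (qtR q (2 + N) (2 + N)) * t 0 * y)
    (hu : ∀ j : ℕ, u (j + 1) = t j * x + coef q (qtR q (1 + N - j) (N - 2 * j)) * t (j + 1) * y) :
    (∑ j ∈ range (N + 1), pt (t j) (vec q N j)) * (pt x (α q) + pt y (γ q)) =
      ∑ j ∈ range (N + 2), pt (u j) (vec q (N + 1) j) := by
  set B : ℕ → Mat q := fun j =>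
    pt (coef q (qtR q (2 + N - j) (2 + N - 2 * j)) * t j * y) (vec q (N + 1) j) with hB
  have hty (j : ℕ) : IsHomog q (l + m) (2 * j - (N + 1 : ℕ)) (t j * y) :=
    .mul' (ht j) hy rfl (by push_cast; ring)
  have htx (j : ℕ) : IsHomog q (l + m) (2 * (j + 1 : ℕ) - (N + 1 : ℕ)) (t j * x) :=
    .mul' (ht j) hx rfl (by push_cast; ring)
  have step (j : ℕ) (hj : j ≤ N) : pt (t j) (vec q N j) * (pt x (α q) + pt y (γ q)) =
      pt (t j * x) (vec q (N + 1) (j + 1)) + B j := by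
    have hv := isHomog_vec (q := q) hj
    rw [mul_add, pt_mul (hmem (ht j) hv) (hmem hx .a), pt_mul (hmem (ht j) hv) (hmem hy .c),
      vec_mul_α, vec_mul_γ h0 h1 hj, ← pt_swap _ (hmem (hty j) (isHomog_vec (by omega))),
      ← coef_qtR, ← mul_assoc]
  have hBN : B (N + 1) = 0 := by
    simp only [hB]
    rw [htN, mul_zero, zero_mul, pt_zero_left (isHomog_vec le_rfl)]
  have hB0 : pt (u 0) (vec q (N + 1) 0) = B 0 := by
    simp only [hB]
    rw [hu0]; push_cast; simp only [sub_zero]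
  have hBs (j : ℕ) (hj : j ≤ N) : pt (u (j + 1)) (vec q (N + 1) (j + 1)) =
      pt (t j * x) (vec q (N + 1) (j + 1)) + B (j + 1) := by
    have e1 : (2 + (N : ℤ) - (j + 1 : ℕ)) = 1 + N - j := by push_cast; ring
    have e2 : (2 + (N : ℤ) - 2 * (j + 1 : ℕ)) = N - 2 * j := by push_cast; ring
    have hv := isHomog_vec (q := q) (show j + 1 ≤ N + 1 by omega)
    simp only [hB]
    rw [hu, e1, e2, pt_add_left (hmem (htx j) hv)]
    refine hmem (m := l + m) ?_ hv
    rw [mul_assoc]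
    exact .mul' (isHomog_coef _) (hty (j + 1)) (zero_add _) (zero_add _)
  rw [sum_mul, sum_congr rfl fun j hj => step j (by simpa [Nat.lt_succ_iff] using hj),
    sum_range_succ' _ (N + 1), hB0,
      sum_congr rfl fun j hj => hBs j (by simpa [Nat.lt_succ_iff] using hj),
    sum_add_distrib, sum_add_distrib, add_assoc, ← sum_range_succ' B, sum_range_succ B (N + 1), hBN,
    add_zero]

theorem comul_vec (h0 : 0 < q) (h1 : q < 1) {N k : ℕ} (hk : k ≤ N) :
    comul q h0 h1 (vec q N k) = ∑ j ∈ range (N + 1), pt (matElt q N k j) (vec q N j) := by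
  induction N generalizing k with
  | zero =>
    obtain rfl : k = 0 := by omega
    simp [vec, matElt, pt_one_one]
  | succ N ih =>
    cases k with
    | zero =>
      have e : vec q (N + 1) 0 = vec q N 0 * γ q := by
        rw [vec_mul_γ h0 h1 (Nat.zero_le N)]
        simp [div_self (brk_ne_zero h0 h1 _)]
      rw [e, map_mul, ih (Nat.zero_le _), comul_γ]
      exact sum_pt_mul h0 h1 (fun j => isHomog_matElt (Nat.zero_le N)) .c .d
        (matElt_of_lt N.lt_succ_self) rfl fun j => rfl
    | succ k =>
      rw [← vec_mul_α, map_mul, ih (by omega), comul_α]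
      exact sum_pt_mul h0 h1 (fun j => isHomog_matElt (by omega)) .a .b
        (matElt_of_lt N.lt_succ_self) rfl fun j => rfl

theorem isMatrixElements_matElt (h0 : 0 < q) (h1 : q < 1) (N : ℕ) :
    IsMatrixElements q h0 h1 N fun k j => matElt q N k j where
  mem k j := Submodule.mem_iSup_of_mem (2 * ((k : ℕ) : ℤ) - N)
    (isHomog_matElt (Nat.lt_succ_iff.1 k.2))
  comul_eq k := by
    rw [comul_vec h0 h1 (Nat.lt_succ_iff.1 k.2), ← Fin.sum_univ_eq_sum_range
      (fun j => pt (matElt q N k j) (vec q N j))]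
    exact sum_congr rfl fun j _ => (pt_eq _).symm

end Coproduct

end FRSL2

/-! ### The closed form of the matrix elements -/

namespace FRSL2
open Polynomial
variable {q : ℝ}

section ClosedForm

/-- The recursion of `matElt` turns into `pPoly_eq_γδ` when the generators are collected on the
outside of the polynomials in `Ξ`. -/
theorem matElt_γδ_step (h0 : 0 < q) (h1 : q < 1) {n r s j N : ℕ} (hj : j = n + s)
    (hN : N = n + r + j + 1)
    (t1 : matElt q N n j = γ q ^ s * δ q ^ (r + 1) * Φ q h0 (pPoly q n N n j))
    (t2 : matElt q N n (j + 1) = γ q ^ (s + 1) * δ q ^ r * Φ q h0 (pPoly q n N n (j + 1))) :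
    matElt q (N + 1) (n + 1) (j + 1) =
      γ q ^ s * δ q ^ r * Φ q h0 (pPoly q (n + 1) (N + 1) (n + 1) (j + 1)) := by
  have c : coef q (qtR q (1 + N - j) (N - 2 * j)) * (γ q ^ s * δ q ^ r) =
      γ q ^ s * δ q ^ r * coef q (qtR q (2 + j) 1) := by
    rw [((IsHomog.c.pow s).mul (IsHomog.d.pow r)).qtR_mul]
    congr 3 <;> subst hN hj <;> push_cast <;> ring
  have e2 : γ q ^ (s + 1) * δ q ^ r = γ q ^ s * δ q ^ r * (coef q (qtR q 0 (-r)) * γ q) := by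
    rw [pow_succ, mul_assoc, γ_mul_δ_pow h0 h1, mul_assoc]
  rw [matElt, t1, t2, pPoly_eq_γδ h0 h1 hj hN, map_add, map_mul, map_mul, map_mul, map_mul, Φ_C,
    Φ_C,
    Φ_daPoly h0 h1, Φ_cbPoly h0 h1, e2, pow_succ, mul_add]
  congr 1
  · rw [mul_assoc (_ * _) (Φ q h0 _), Φ_mul h0 h1 .a]; simp only [mul_assoc]
  · rw [mul_assoc _ _ (Φ q h0 _), ← mul_assoc (coef q _), c, mul_assoc (_ * _ * _),
      mul_assoc (_ * _) (Φ q h0 _), Φ_mul h0 h1 .b]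
    simp only [mul_assoc]

/-- The recursion of `matElt` turns into `pPoly_eq_γα` when the generators are collected on the
outside of the polynomials in `Ξ`. -/
theorem matElt_γα_step (h0 : 0 < q) (h1 : q < 1) {n r s k j N : ℕ} (hk : k = r + n + 1)
    (hj : j + 1 = r + n + s + 2) (hN : N = n + (r + n + s + 2))
    (t1 : matElt q N k j = γ q ^ s * Φ q h0 (pPoly q (n + 1) N k j) * α q ^ r)
    (t2 : matElt q N k (j + 1) =
      γ q ^ (s + 1) * Φ q h0 (pPoly q n N k (j + 1)) * α q ^ (r + 1)) :
    matElt q (N + 1) (k + 1) (j + 1) =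
      γ q ^ s * Φ q h0 (pPoly q (n + 1) (N + 1) (k + 1) (j + 1)) * α q ^ (r + 1) := by
  have c : coef q (qtR q (1 + N - j) (N - 2 * j)) * γ q ^ s =
      γ q ^ s * coef q (qtR q (n + s + 2) (-r)) := by
    have hj' : j = r + n + s + 1 := by omega
    rw [(IsHomog.c.pow s).qtR_mul]
    congr 3 <;> subst hN hj' <;> push_cast <;> ring
  have e1 : α q ^ (r + 1) * β q = β q * coef q (qtR q 0 (-r - 1)) * α q ^ (r + 1) := by
    have := IsHomog.b.qtR_mul (q := q) 1 (-r)
    rw [α_pow_mul_β h0 h1, ← mul_assoc,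
      show (1 : ℤ) - (r + 1 : ℕ) = -r by push_cast; ring, this]
    congr 4
  rw [matElt, t1, t2, pPoly_eq_γα h0 h1 hk hj hN, map_add, map_mul, map_mul, map_mul, Φ_C, Φ_C,
    Φ_cbPoly h0 h1, mul_add, add_mul]
  congr 1
  · rw [mul_assoc, pow_succ]
  · have e2 := Φ_mul h0 h1 (IsHomog.b (q := q)) (pPoly q n N k (j + 1))
    calc _ = coef q (qtR q (1 + N - j) (N - 2 * j)) * γ q ^ s *
          (γ q * Φ q h0 (pPoly q n N k (j + 1)) * (α q ^ (r + 1) * β q)) := by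
          rw [pow_succ]; simp only [mul_assoc]
      _ = γ q ^ s * coef q (qtR q (n + s + 2) (-r)) *
          (γ q * (Φ q h0 (pPoly q n N k (j + 1)) * β q) * coef q (qtR q 0 (-r - 1)) *
            α q ^ (r + 1)) := by rw [c, e1]; simp only [mul_assoc]
      _ = γ q ^ s * coef q (qtR q (n + s + 2) (-r)) *
          ((γ q * β q) * (Φ q h0 (sftP 1 (-1) (pPoly q n N k (j + 1))) *
            coef q (qtR q 0 (-r - 1))) *
            α q ^ (r + 1)) := by rw [e2]; simp only [mul_assoc]
      _ = γ q ^ s * coef q (qtR q (n + s + 2) (-r)) *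
          ((γ q * β q * coef q (qtR q 0 (-r - 1))) *
            Φ q h0 (sftP 1 (-1) (pPoly q n N k (j + 1))) *
            α q ^ (r + 1)) := by
            rw [← Φ_C h0 (qtR q 0 (-r - 1)), ← map_mul, mul_comm _ (C _), map_mul]
            simp only [mul_assoc]
      _ = _ := by
            rw [← Φ_cbPoly h0 h1, ← Φ_C h0 (qtR q 0 (-r - 1)), ← map_mul, mul_comm _ (C _), map_mul]
            simp only [mul_assoc]

/-- The recursion of `matElt` turns into `pPoly_eq_δβ` when the generators are collected on the
outside of the polynomials in `Ξ`. -/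
theorem matElt_δβ_step (h0 : 0 < q) (h1 : q < 1) {m r s k N : ℕ} (hk : k = m + 1 + s)
    (hN : N = 2 * m + s + r + 2)
    (t1 : matElt q N k m = δ q ^ (r + 1) * Φ q h0 (pPoly q m N k m) * β q ^ (s + 1))
    (t2 : matElt q N k (m + 1) = δ q ^ r * Φ q h0 (pPoly q (m + 1) N k (m + 1)) * β q ^ s) :
    matElt q (N + 1) (k + 1) (m + 1) =
      δ q ^ r * Φ q h0 (pPoly q (m + 1) (N + 1) (k + 1) (m + 1)) * β q ^ (s + 1) := by
  have c : coef q (qtR q (1 + N - m) (N - 2 * m)) * δ q ^ r =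
      δ q ^ r * coef q (qtR q (3 + m + s) (s + 2)) := by
    rw [(IsHomog.d.pow r).qtR_mul]
    congr 3 <;> subst hN <;> push_cast <;> ring
  have e1 : β q ^ (s + 1) * α q = α q * coef q (qtR q 1 (s + 2)) * β q ^ (s + 1) := by
    rw [β_pow_mul_α h0 h1, ← mul_assoc, IsHomog.a.qtR_mul]; push_cast; ring_nf
  rw [matElt, t1, t2, pPoly_eq_δβ h0 h1 hk hN, map_add, map_mul, map_mul, map_mul, Φ_C, Φ_C,
    Φ_daPoly h0 h1, mul_add, add_mul]
  congr 1
  · have e2 := Φ_mul h0 h1 (IsHomog.a (q := q)) (pPoly q m N k m)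
    calc _ = δ q ^ (r + 1) * Φ q h0 (pPoly q m N k m) * (β q ^ (s + 1) * α q) := by
          simp only [mul_assoc]
      _ = δ q ^ r * (δ q * (Φ q h0 (pPoly q m N k m) * α q) * coef q (qtR q 1 (s + 2)) *
            β q ^ (s + 1)) := by rw [e1, pow_succ]; simp only [mul_assoc]
      _ = δ q ^ r * (Φ q h0 (daPoly q * sftP 1 1 (pPoly q m N k m) * C (qtR q 1 (s + 2))) *
            β q ^ (s + 1)) := by
            rw [e2, map_mul, map_mul, Φ_C, Φ_daPoly h0 h1]; simp only [mul_assoc]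
      _ = _ := by
            rw [mul_comm _ (C _), map_mul, map_mul, Φ_C, Φ_daPoly h0 h1]; simp only [mul_assoc]
  · rw [← mul_assoc, ← mul_assoc, c, pow_succ]; simp only [mul_assoc]

/-- The recursion of `matElt` turns into `pPoly_eq_αβ` when the generators are collected on the
outside of the polynomials in `Ξ`. -/
theorem matElt_αβ_step (h0 : 0 < q) (h1 : q < 1) {n r s k j N : ℕ} (hk : k = n + s + r + 1)
    (hj : j = n + r) (hN : N = 2 * n + s + r + 1)
    (t1 : matElt q N k j = Φ q h0 (pPoly q n N k j) * α q ^ r * β q ^ (s + 1))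
    (t2 : matElt q N k (j + 1) = Φ q h0 (pPoly q n N k (j + 1)) * α q ^ (r + 1) * β q ^ s) :
    matElt q (N + 1) (k + 1) (j + 1) =
      Φ q h0 (pPoly q n (N + 1) (k + 1) (j + 1)) * α q ^ (r + 1) * β q ^ (s + 1) := by
  have c : qtR q (1 + N - j) (N - 2 * j) = qtR q (2 + n + s) (s + 1 - r) := by
    congr 1 <;> subst hN hj <;> push_cast <;> ring
  have e1 : α q ^ r * (β q ^ (s + 1) * α q) =
      coef q (qtR q (-r) (s + 1 - r)) * (α q ^ (r + 1) * β q ^ (s + 1)) := by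
    rw [β_pow_mul_α h0 h1, ← mul_assoc, pow_succ (α q)]
    have := (IsHomog.a.pow r).qtR_mul (q := q) (-r) (s + 1 - r)
    push_cast at this ⊢
    simp only [mul_one, neg_add_cancel, sub_add_cancel] at this
    rw [← this]; simp only [mul_assoc]
  rw [matElt, t1, t2, pPoly_eq_αβ h0 h1 hk hj hN, map_add, map_mul, map_mul, Φ_C, Φ_C,
    add_mul, add_mul, c]
  congr 1
  · calc _ = Φ q h0 (pPoly q n N k j) * (α q ^ r * (β q ^ (s + 1) * α q)) := by
          simp only [mul_assoc]
      _ = (Φ q h0 (pPoly q n N k j) * Φ q h0 (C (qtR q (-r) (s + 1 - r)))) *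
          (α q ^ (r + 1) * β q ^ (s + 1)) := by rw [e1, Φ_C]; simp only [mul_assoc]
      _ = _ := by rw [← map_mul, mul_comm _ (C _), map_mul, Φ_C]; simp only [mul_assoc]
  · rw [pow_succ (β q)]; simp only [mul_assoc]

/-- For `n = 0` the constants are powers of `q` times `q`-binomial coefficients; the three entries
of the Pascal rule have a common factor `c`. -/
theorem pConst_zero_pascal (h0 : 0 < q) (h1 : q < 1) (r j : ℕ) :
    ∃ c : ℂ, pConst q 0 (r + 1 + j + 1) (j + 1) (r + 1) = c * (1 - ((q : ℂ) ^ 2) ^ (r + 1 + j +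
      1)) ∧
      pConst q 0 (r + 1 + j) j (r + 1) = c * (q : ℂ) ^ (r + 1) * (1 - ((q : ℂ) ^ 2) ^ (j + 1)) ∧
      pConst q 0 (r + 1 + j) (j + 1) r = c * (q : ℂ) ^ (j + 1) * (1 - ((q : ℂ) ^ 2) ^ (r + 1)) := by
  have hq := q_ne_zero q h0
  have hF := poch_self_ne_zero (q_sq_pow_ne_one h0 h1)
  have hs (n : ℕ) : poch ((q : ℂ) ^ 2) ((q : ℂ) ^ 2) (n + 1) =
      poch ((q : ℂ) ^ 2) ((q : ℂ) ^ 2) n * (1 - ((q : ℂ) ^ 2) ^ (n + 1)) := by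
    rw [poch_succ, ← pow_succ]
  have hn (n : ℕ) : 1 - ((q : ℂ) ^ 2) ^ (n + 1) ≠ 0 := fun h =>
    q_sq_pow_ne_one h0 h1 n (sub_eq_zero.1 h).symm
  refine ⟨(q : ℂ) ^ (-((j + 1) * (r + 1) : ℤ)) * (poch ((q : ℂ) ^ 2) ((q : ℂ) ^ 2) (r + 1 + j) /
    (poch ((q : ℂ) ^ 2) ((q : ℂ) ^ 2) (j + 1) * poch ((q : ℂ) ^ 2) ((q : ℂ) ^ 2) (r + 1))), ?_, ?_,
      ?_⟩
  · rw [pConst_eq (x := r + 1 + j + 1) (y := r + 1) (by ring) (by ring), hs (r + 1 + j)]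
    have e : ((0 : ℕ) * ((0 : ℕ) + (r + 1 : ℕ)) - (j + 1 : ℕ) * (r + 1 : ℕ) : ℤ) =
      -((j + 1) * (r + 1)) := by push_cast; ring
    rw [e, mul_assoc, div_mul_eq_mul_div]
  · rw [pConst_eq (x := r + 1 + j) (y := r + 1) (by ring) (by ring), hs j]
    have e : (q : ℂ) ^ ((0 : ℕ) * ((0 : ℕ) + (r + 1 : ℕ)) - j * (r + 1 : ℕ) : ℤ) =
        (q : ℂ) ^ (-((j + 1) * (r + 1) : ℤ)) * (q : ℂ) ^ (r + 1) := by
      simp only [← zpow_natCast, ← zpow_add₀ hq]; congr 1; push_cast; ring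
    have a1 := hF j
    have a2 := hF (r + 1)
    have a3 := hn j
    rw [e, mul_right_comm _ _ ((q : ℂ) ^ (r + 1))]
    generalize (q : ℂ) ^ (-((j + 1) * (r + 1) : ℤ)) * (q : ℂ) ^ (r + 1) = z
    field_simp
  · rw [pConst_eq (x := r + 1 + j) (y := r) (by ring) (by ring), hs r]
    have e : (q : ℂ) ^ ((0 : ℕ) * ((0 : ℕ) + (r : ℕ)) - (j + 1 : ℕ) * (r : ℕ) : ℤ) =
        (q : ℂ) ^ (-((j + 1) * (r + 1) : ℤ)) * (q : ℂ) ^ (j + 1) := by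
      simp only [← zpow_natCast, ← zpow_add₀ hq]; congr 1; push_cast; ring
    have a1 := hF r
    have a2 := hF (j + 1)
    have a3 := hn r
    rw [e, mul_right_comm _ _ ((q : ℂ) ^ (j + 1))]
    generalize (q : ℂ) ^ (-((j + 1) * (r + 1) : ℤ)) * (q : ℂ) ^ (j + 1) = z
    field_simp

/-- The Pascal rule for the constants with `n = 0`, with coefficients that depend on `μ`. -/
theorem algebraMap_pConst_zero (h0 : 0 < q) (h1 : q < 1) (r j : ℕ) :
    algebraMap ℂ _ (pConst q 0 (r + 1 + j + 1) (j + 1) (r + 1)) =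
      qtR q (1 - (r + 1 : ℕ)) 1 * algebraMap ℂ _ (pConst q 0 (r + 1 + j) j (r + 1)) +
        qtR q (2 + j) 1 * algebraMap ℂ _ (pConst q 0 (r + 1 + j) (j + 1) r) := by
  obtain ⟨c, e1, e2, e3⟩ := pConst_zero_pascal h0 h1 r j
  refine (isUnit_brkR h0 h1 1).mul_left_cancel ?_
  rw [mul_add, ← mul_assoc, ← mul_assoc, brkR_mul_qtR h0 h1, brkR_mul_qtR h0 h1, e1, e2, e3]
  have key : brkR q 1 * (1 - qexp₂ q 0 0 (2 * (r + 1 + j + 1 : ℕ))) =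
      brkR q (1 - (r + 1 : ℕ)) * (qexp₂ q 0 0 (r + 1 : ℕ) * (1 - qexp₂ q 0 0 (2 * (j + 1 : ℕ)))) +
      brkR q (2 + j) * (qexp₂ q 0 0 (j + 1 : ℕ) * (1 - qexp₂ q 0 0 (2 * (r + 1 : ℕ)))) := by
    simp only [brkR_eq h0, mul_sub, sub_mul, qexp₂_mul, mul_one]
    push_cast
    ring_nf
  simp only [map_mul, map_sub, map_one, map_pow _ ((q : ℂ) ^ 2), algebraMap_pow_eq h0]
  simp only [← zpow_natCast (q : ℂ), algebraMap_zpow_eq h0]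
  linear_combination algebraMap ℂ _ c * key

/-- For `k = 0` the polynomials `p_n` are constants, and the recursion is a Pascal rule for
`q`-binomial coefficients. -/
theorem matElt_zero_step (h0 : 0 < q) (h1 : q < 1) {r j N : ℕ} (hN : N = r + j)
    (t1 : matElt q N 0 j = γ q ^ j * δ q ^ r * coef q (algebraMap ℂ _ (pConst q 0 N j r)))
    (t2 : ∀ r', r = r' + 1 → matElt q N 0 (j + 1) =
      γ q ^ (j + 1) * δ q ^ r' * coef q (algebraMap ℂ _ (pConst q 0 N (j + 1) r'))) :
    matElt q (N + 1) 0 (j + 1) =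
      γ q ^ (j + 1) * δ q ^ r * coef q (algebraMap ℂ _ (pConst q 0 (N + 1) (j + 1) r)) := by
  have e1 (z : ℂ) : γ q ^ j * δ q ^ r * coef q (algebraMap ℂ _ z) * γ q =
      γ q ^ (j + 1) * δ q ^ r * coef q (qtR q (1 - r) 1 * algebraMap ℂ _ z) := by
    have h : coef q (qtR q 0 r) * (γ q * δ q ^ r) =
        γ q * δ q ^ r * coef q (qtR q (1 - r) 1) := by
      rw [(IsHomog.c.mul (IsHomog.d.pow r)).qtR_mul]; congr 3 <;> ring
    rw [map_mul, AlgHom.commutes, mul_assoc, Algebra.commutes, mul_assoc, ← mul_assoc (δ q ^ r),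
      δ_pow_mul_γ h0 h1, h, pow_succ]
    simp only [mul_assoc]
  rw [matElt, t1, e1]
  cases r with
  | zero =>
    obtain rfl : N = j := by omega
    have hF := poch_self_ne_zero (q_sq_pow_ne_one h0 h1)
    have c (M : ℕ) : pConst q 0 M M 0 = 1 := by
      have hM := hF M
      simp [pConst, hM]
    rw [matElt_of_lt N.lt_succ_self, c, c, Nat.cast_zero, sub_zero, qtR_self h0 h1]
    simp
  | succ r =>
    have e2 (z : ℂ) : coef q (qtR q (1 + N - j) (N - 2 * j)) *
        (γ q ^ (j + 1) * δ q ^ r * coef q (algebraMap ℂ _ z)) * δ q =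
        γ q ^ (j + 1) * δ q ^ (r + 1) * coef q (qtR q (2 + j) 1 * algebraMap ℂ _ z) := by
      have h : coef q (qtR q (1 + N - j) (N - 2 * j)) * (γ q ^ (j + 1) * δ q ^ (r + 1)) =
          γ q ^ (j + 1) * δ q ^ (r + 1) * coef q (qtR q (2 + j) 1) := by
        rw [((IsHomog.c.pow (j + 1)).mul (IsHomog.d.pow (r + 1))).qtR_mul]
        congr 3 <;> subst hN <;> push_cast <;> ring
      rw [map_mul, ← mul_assoc _ (coef q (qtR q _ _)), ← h, AlgHom.commutes, pow_succ (δ q)]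
      simp only [mul_assoc]
      rw [Algebra.commutes z (δ q)]
    subst hN
    rw [t2 r rfl, e2, ← mul_add, ← map_add, ← algebraMap_pConst_zero h0 h1]

theorem Φ_pPoly_zero_row (h0 : 0 < q) (h1 : q < 1) {r j N : ℕ} (hN : N = r + j) :
    Φ q h0 (pPoly q 0 N 0 j) = coef q (algebraMap ℂ _ (pConst q 0 N j r)) := by
  have S := pPoly_spec h0 h1 0 N 0 j j r (by simp) (by subst hN; push_cast; ring_nf; simp)
    (P := algebraMap ℂ _ ((q : ℂ) ^ 2)) rfl
  simp only [awQ, awSum, awTerm, awRow, zero_add, Finset.sum_range_one, poch_zero, awBasis_zero,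
    pow_zero, div_one, map_one, one_mul, mul_one, Nat.sub_zero] at S
  rw [S, Polynomial.algebraMap_apply, Φ_C]

/-- The closed form of the matrix elements; in terms of `n`, `s = |j - k|` and `r = |N - k - j|` one
has `N = 2 n + r + s` in all four cases. -/
theorem matElt_eq (h0 : 0 < q) (h1 : q < 1) (N : ℕ) : ∀ n r s : ℕ, N = 2 * n + r + s →
    matElt q N n (n + s) = γ q ^ s * δ q ^ r * Φ q h0 (pPoly q n N n (n + s)) ∧
    matElt q N (n + r) (n + r + s) =
      γ q ^ s * Φ q h0 (pPoly q n N (n + r) (n + r + s)) * α q ^ r ∧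
    matElt q N (n + s) n = δ q ^ r * Φ q h0 (pPoly q n N (n + s) n) * β q ^ s ∧
    matElt q N (n + r + s) (n + r) =
      Φ q h0 (pPoly q n N (n + r + s) (n + r)) * α q ^ r * β q ^ s := by
  induction N with
  | zero =>
    intro n r s h
    obtain ⟨rfl, rfl, rfl⟩ : n = 0 ∧ r = 0 ∧ s = 0 := by omega
    simp [matElt, pPoly_zero_eq_one h0 h1]
  | succ N ih =>
    have hγδ (n r s : ℕ) (h : N + 1 = 2 * n + r + s) : matElt q (N + 1) n (n + s) =
        γ q ^ s * δ q ^ r * Φ q h0 (pPoly q n (N + 1) n (n + s)) := by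
      cases n with
      | succ n =>
        have t1 := (ih n (r + 1) s (by omega)).1
        have t2 := (ih n r (s + 1) (by omega)).1
        rw [show n + 1 + s = n + s + 1 by omega]
        exact matElt_γδ_step h0 h1 rfl (by omega) t1 t2
      | zero =>
        cases s with
        | zero =>
          obtain rfl : r = N + 1 := by omega
          have t := (ih 0 N 0 (by omega)).1
          rw [pPoly_zero_eq_one h0 h1 (.inl rfl)] at t ⊢
          simp only [add_zero, pow_zero, one_mul, map_one, mul_one] at t ⊢
          rw [matElt, t, qtR_self h0 h1, map_one, one_mul, pow_succ]
        | succ j =>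
          rw [Φ_pPoly_zero_row h0 h1 (r := r) (by omega), show 0 + (j + 1) = j + 1 by omega]
          refine matElt_zero_step h0 h1 (by omega) ?_ fun r' hr => ?_
          · have t := (ih 0 r j (by omega)).1
            rwa [Φ_pPoly_zero_row h0 h1 (r := r) (by omega), show 0 + j = j by omega] at t
          · have t := (ih 0 r' (j + 1) (by omega)).1
            rwa [Φ_pPoly_zero_row h0 h1 (r := r') (by omega),
              show 0 + (j + 1) = j + 1 by omega] at t
    have hγα (n r s : ℕ) (h : N + 1 = 2 * n + r + s) : matElt q (N + 1) (n + r) (n + r + s) =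
        γ q ^ s * Φ q h0 (pPoly q n (N + 1) (n + r) (n + r + s)) * α q ^ r := by
      cases r with
      | zero => simpa using hγδ n 0 s h
      | succ r =>
        have t1 := (ih n r s (by omega)).2.1
        rw [← add_assoc, show n + r + 1 + s = n + r + s + 1 by omega]
        cases n with
        | zero =>
          rw [pPoly_zero_eq_one h0 h1 (by omega)] at t1 ⊢
          rw [matElt, t1, matElt_of_lt (by omega), pow_succ]
          simp [mul_assoc]
        | succ n =>
          have t2 := (ih n (r + 1) (s + 1) (by omega)).2.1
          rw [show n + (r + 1) = n + 1 + r by omega,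
            show n + 1 + r + (s + 1) = n + 1 + r + s + 1 by omega] at t2
          exact matElt_γα_step h0 h1 (by omega) (by omega) (by omega) t1 t2
    have hδβ (n r s : ℕ) (h : N + 1 = 2 * n + r + s) : matElt q (N + 1) (n + s) n =
        δ q ^ r * Φ q h0 (pPoly q n (N + 1) (n + s) n) * β q ^ s := by
      cases s with
      | zero => simpa using hγδ n r 0 h
      | succ s =>
        have t2 := (ih n r s (by omega)).2.2.1
        rw [← add_assoc]
        cases n with
        | zero =>
          rw [pPoly_zero_eq_one h0 h1 (.inl rfl)] at t2 ⊢
          rw [matElt, t2, qtR_self h0 h1, pow_succ]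
          simp [mul_assoc]
        | succ m =>
          have t1 := (ih m (r + 1) (s + 1) (by omega)).2.2.1
          rw [show m + (s + 1) = m + 1 + s by omega] at t1
          exact matElt_δβ_step h0 h1 rfl (by omega) t1 t2
    have hαβ (n r s : ℕ) (h : N + 1 = 2 * n + r + s) : matElt q (N + 1) (n + r + s) (n + r) =
        Φ q h0 (pPoly q n (N + 1) (n + r + s) (n + r)) * α q ^ r * β q ^ s := by
      cases r with
      | zero => simpa using hδβ n 0 s h
      | succ r =>
        cases s with
        | zero => simpa using hγα n (r + 1) 0 h
        | succ s =>
          have t1 := (ih n r (s + 1) (by omega)).2.2.2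
          have t2 := (ih n (r + 1) s (by omega)).2.2.2
          rw [show n + r + (s + 1) = n + (r + 1) + s by omega] at t1
          exact matElt_αβ_step h0 h1 (k := n + (r + 1) + s) (by omega) rfl (by omega) t1 t2
    exact fun n r s h => ⟨hγδ n r s h, hγα n r s h, hδβ n r s h, hαβ n r s h⟩

end ClosedForm

end FRSL2

/-! ### A representation on sequences of meromorphic functions -/

namespace FRSL2
variable {q : ℝ}

section Lift
variable {R : Type*} [Ring R] [Algebra ℂ R]

/-- Values in a ring of the generators `α, β, γ, δ, f(λ), f(μ)`. -/
def genVal (l r : Mer →ₐ[ℂ] R) (a b c d : R) : Gen → R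
  | .a => a
  | .b => b
  | .c => c
  | .d => d
  | .l f => l f
  | .r f => r f

/-- The compact relations `Good` and the commutation rules of the functions imply all defining
relations. -/
theorem lift_rel (h0 : 0 < q) (h1 : q < 1) {l r : Mer →ₐ[ℂ] R} {a b c d : R}
    (hlr : ∀ f g, Commute (l f) (r g))
    (G : Good (l : Mer →+* R) (r : Mer →+* R) (cf q) (ce q) a b c d)
    (la : ∀ f, l f * a = a * l (Mer.shift 1 f)) (ra : ∀ f, r f * a = a * r (Mer.shift 1 f))
    (lb : ∀ f, l f * b = b * l (Mer.shift 1 f)) (rb : ∀ f, r f * b = b * r (Mer.shift (-1) f))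
    (lc : ∀ f, l f * c = c * l (Mer.shift (-1) f)) (rc : ∀ f, r f * c = c * r (Mer.shift 1 f))
    (ld : ∀ f, l f * d = d * l (Mer.shift (-1) f)) (rd : ∀ f, r f * d = d * r (Mer.shift (-1) f))
    {x y : FreeAlgebra ℂ Gen} (h : Rel q x y) :
    FreeAlgebra.lift ℂ (genVal l r a b c d) x = FreeAlgebra.lift ℂ (genVal l r a b c d) y := by
  set F := FreeAlgebra.lift ℂ (genVal l r a b c d) with hF
  have hq := q_ne_zero q h0
  have va : F Gen.fa = a := FreeAlgebra.lift_ι_apply _ _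
  have vb : F Gen.fb = b := FreeAlgebra.lift_ι_apply _ _
  have vc : F Gen.fc = c := FreeAlgebra.lift_ι_apply _ _
  have vd : F Gen.fd = d := FreeAlgebra.lift_ι_apply _ _
  have vl : ∀ f, F (Gen.fl f) = l f := fun f => FreeAlgebra.lift_ι_apply _ _
  have vr : ∀ f, F (Gen.fr f) = r f := fun f => FreeAlgebra.lift_ι_apply _ _
  have hH : F (funH q Gen.fl Gen.fr) = l (cf q) - r (ce q) := by
    rw [← funH_eq q h0 h1 _ _ hlr]
    simp only [funH, map_smul, map_mul, map_sub, map_one, vl, vr]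
  have hI : F (funI q Gen.fl Gen.fr) = l (cf q) - r (cf q) := by
    rw [← funI_eq q h0 h1 _ _ hlr]
    simp only [funI, map_smul, map_mul, map_sub, vl, vr]
  have hF := shift_funF_ne_zero q h0 h1
  have hs := cf_add_ce q h0 h1
  have hs' : (l : Mer →+* R) (algebraMap ℂ Mer ((q : ℂ) + (q : ℂ)⁻¹)) =
      (r : Mer →+* R) (algebraMap ℂ Mer ((q : ℂ) + (q : ℂ)⁻¹)) :=
    (l.commutes _).trans (r.commutes _).symm
  have hf : ∀ Y : R, (q : ℂ) • (l (funF q) * Y) = l (cf q) * Y := by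
    intro Y; rw [cf, map_smul, smul_mul_assoc]
  have hE : ∀ V Y : R, Y = r (ce q) * V → V = (q : ℂ) • (r (Mer.shift (-1) (funF q)) * Y) := by
    rintro V Y rfl
    rw [ce, map_smul, smul_mul_assoc, mul_smul_comm, smul_smul, mul_inv_cancel₀ hq, one_smul,
      ← mul_assoc, ← map_mul, mul_inv_cancel₀ hF, map_one, one_mul]
  induction h with
  | l_const z => rw [vl, AlgHom.commutes, AlgHom.commutes]
  | l_add f g => rw [map_add, vl, vl, vl, map_add]
  | l_mul f g => rw [map_mul, vl, vl, vl, map_mul]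
  | r_const z => rw [vr, AlgHom.commutes, AlgHom.commutes]
  | r_add f g => rw [map_add, vr, vr, vr, map_add]
  | r_mul f g => rw [map_mul, vr, vr, vr, map_mul]
  | lr_comm f g => rw [map_mul, map_mul, vl, vr]; exact hlr f g
  | l_a f => rw [map_mul, map_mul, vl, vl, va, la]
  | l_b f => rw [map_mul, map_mul, vl, vl, vb, lb]
  | l_c f => rw [map_mul, map_mul, vl, vl, vc, lc]
  | l_d f => rw [map_mul, map_mul, vl, vl, vd, ld]
  | r_a f => rw [map_mul, map_mul, vr, vr, va, ra]
  | r_b f => rw [map_mul, map_mul, vr, vr, vb, rb]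
  | r_c f => rw [map_mul, map_mul, vr, vr, vc, rc]
  | r_d f => rw [map_mul, map_mul, vr, vr, vd, rd]
  | ab => simp only [map_smul, map_mul, va, vb, vr]; exact hE _ _ G.A3
  | ac => simp only [map_smul, map_mul, va, vc, vl, hf]; exact G.A1
  | bd => simp only [map_smul, map_mul, vb, vd, vl, hf]; exact G.A2
  | cd => simp only [map_smul, map_mul, vc, vd, vr]; exact hE _ _ G.A4
  | ad₁ => simp only [map_sub, map_mul, va, vb, vc, vd, hH]; exact G.ad1
  | ad₂ =>
    simp only [map_sub, map_mul, va, vb, vc, vd, vl, vr, hH, funG_eq q h0 h1]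
    have := G.ad2 hlr hs hs'
    simp only [map_mul] at this; exact this
  | bc₁ =>
    simp only [map_sub, map_mul, va, vb, vc, vd, vr, hI, funG_eq q h0 h1]
    have := G.bc1
    simp only [map_mul] at this; exact this
  | bc₂ =>
    simp only [map_sub, map_mul, va, vb, vc, vd, vl, hI, funG_eq q h0 h1]
    have := G.bc2 hs hs'
    simp only [map_mul] at this; exact this
  | det =>
    simp only [map_sub, map_smul, map_mul, map_one, va, vb, vc, vd, vl, hf]
    rw [G.A5]; exact add_sub_cancel_left _ _

end Lift

section Representation

/-- The operator `(w · g)(n) = w(n) T_s g(n + k)` on sequences of meromorphic functions. -/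
def diffOp (w : ℤ → Mer) (s k : ℤ) : Module.End ℂ (ℤ → Mer) :=
  LinearMap.pi fun n => LinearMap.mulLeft ℂ (w n) ∘ₗ (Mer.shift s).toLinearMap ∘ₗ
    LinearMap.proj (n + k)

theorem diffOp_apply (w : ℤ → Mer) (s k : ℤ) (g : ℤ → Mer) (n : ℤ) :
    diffOp w s k g n = w n * Mer.shift s (g (n + k)) := rfl

theorem diffOp_congr {w w' : ℤ → Mer} {s s' k k' : ℤ} (hw : ∀ n, w n = w' n) (hs : s = s')
    (hk : k = k') : diffOp w s k = diffOp w' s' k' := by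
  rw [funext hw, hs, hk]

theorem diffOp_mul (w w' : ℤ → Mer) (s k s' k' : ℤ) : diffOp w s k * diffOp w' s' k' =
    diffOp (fun n => w n * Mer.shift s (w' (n + k))) (s + s') (k + k') := by
  ext g n
  rw [Module.End.mul_apply, diffOp_apply, diffOp_apply, diffOp_apply, map_mul, shift_shift,
    mul_assoc, add_assoc]
  push_cast; rfl

theorem diffOp_one : diffOp 1 0 0 = 1 := by
  ext g n
  rw [diffOp_apply, Int.cast_zero, shift_zero, add_zero, Pi.one_apply, one_mul]; rfl

theorem diffOp_add (w w' : ℤ → Mer) (s k : ℤ) :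
    diffOp w s k + diffOp w' s k = diffOp (w + w') s k := by
  ext g n
  exact (add_mul _ _ _).symm

theorem diffOp_sub (w w' : ℤ → Mer) (s k : ℤ) :
    diffOp w s k - diffOp w' s k = diffOp (w - w') s k := by
  ext g n
  exact (sub_mul _ _ _).symm

theorem lmul_eq_diffOp (w : ℤ → Mer) : Algebra.lmul ℂ (ℤ → Mer) w = diffOp w 0 0 := by
  ext g n
  rw [diffOp_apply, Int.cast_zero, shift_zero, add_zero]; rfl

/-- `f(λ)` acts on all components as multiplication by `f`. -/
def repL : Mer →ₐ[ℂ] Module.End ℂ (ℤ → Mer) :=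
  (Algebra.lmul ℂ (ℤ → Mer)).comp (AlgHom.pi fun _ => AlgHom.id ℂ Mer)

/-- `f(μ)` acts on the component of index `n` as multiplication by `f(· + n)`, so that `μ = λ + n`
there. -/
def repR : Mer →ₐ[ℂ] Module.End ℂ (ℤ → Mer) :=
  (Algebra.lmul ℂ (ℤ → Mer)).comp (AlgHom.pi fun n : ℤ => Mer.shift n)

theorem repL_apply (f : Mer) : repL f = diffOp (fun _ => f) 0 0 := lmul_eq_diffOp _

theorem repR_apply (f : Mer) : repR f = diffOp (fun n => Mer.shift n f) 0 0 := lmul_eq_diffOp _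

variable (q) in
/-- The function `q^{az+d} + q^{-az-d}`. -/
def csh (a d : ℤ) : Mer := qexp q a d + qexp q (-a) (-d)

theorem shift_csh (s a d : ℤ) : Mer.shift s (csh q a d) = csh q a (d + a * s) := by
  rw [csh, map_add, shift_qexp, shift_qexp, csh]; congr 2; ring

/-- The addition formula `q^{2z+d+e} + q^{-2z-d-e} = q^{d-e} + q^{e-d} + [z + d] [z + e]`. -/
theorem csh_eq_add_brk_mul_brk (d e : ℤ) :
    csh q 2 (d + e) = csh q 0 (d - e) + brk q d * brk q e := by
  simp only [csh, brk, mul_sub, sub_mul, qexp_mul]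
  ring_nf

variable (q) in
/-- The action of `α`. -/
def repα : Module.End ℂ (ℤ → Mer) := diffOp 1 (-1) 0
variable (q) in
/-- The action of `β`. -/
def repβ : Module.End ℂ (ℤ → Mer) := diffOp (fun n => csh q 0 (n + 1) / brk q (n + 1)) (-1) 2
variable (q) in
/-- The action of `γ`. -/
def repγ : Module.End ℂ (ℤ → Mer) := diffOp (fun _ => (brk q 2)⁻¹) 1 (-2)
variable (q) in
/-- The action of `δ`. -/
def repδ : Module.End ℂ (ℤ → Mer) :=
  diffOp (fun n => csh q 2 (n + 3) / (brk q 2 * brk q (n + 1))) 1 0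

theorem good_rep (h0 : 0 < q) (h1 : q < 1) :
    Good (repL : Mer →+* Module.End ℂ (ℤ → Mer)) (repR : Mer →+* Module.End ℂ (ℤ → Mer))
      (cf q) (ce q) repα (repβ q) (repγ q) (repδ q) := by
  have hb := brk_ne_zero h0 h1
  constructor <;>
  simp only [AlgHom.coe_toRingHom, repL_apply, repR_apply, repα, repβ, repγ, repδ, diffOp_mul,
    cf_eq_brk h0 h1, ce_eq_brk h0 h1, ← diffOp_one, diffOp_add, diffOp_sub, add_zero, zero_add,
    Int.reduceAdd, Int.reduceNeg] <;>
  refine diffOp_congr (fun n => ?_) rfl rfl <;>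
  simp only [Pi.one_apply, map_one, map_div₀, map_mul, map_inv₀, shift_brk, shift_csh, Pi.add_apply,
    Pi.sub_apply]
  all_goals ring_nf
  all_goals have b0 := hb 0
  all_goals have b1 := hb 1
  all_goals have b2 := hb 2
  all_goals have b3 := hb 3
  all_goals have c0 := hb n
  all_goals have c1 := hb (1 + n)
  all_goals have c2 := hb (2 + n)
  all_goals have k1 := csh_eq_add_brk_mul_brk (q := q) n 1
  all_goals have k2 := csh_eq_add_brk_mul_brk (q := q) (2 + n) 1
  all_goals have k3 := csh_eq_add_brk_mul_brk (q := q) (1 + n) 0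
  all_goals have k4 := csh_eq_add_brk_mul_brk (q := q) (1 + n) 2
  all_goals ring_nf at k1 k2 k3 k4
  all_goals field_simp
  -- each relation with two terms on the right-hand side is an addition formula for `csh`
  · linear_combination k1
  · linear_combination -k2
  · linear_combination -k3
  · linear_combination k4

theorem one_eq_intCast : (1 : ℂ) = ((1 : ℤ) : ℂ) := Int.cast_one.symm

theorem neg_one_eq_intCast : (-1 : ℂ) = ((-1 : ℤ) : ℂ) := by rw [Int.cast_neg, Int.cast_one]

theorem repL_mul_diffOp (f : Mer) (w : ℤ → Mer) (s k : ℤ) :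
    repL f * diffOp w s k = diffOp w s k * repL (Mer.shift ((-s : ℤ) : ℂ) f) := by
  rw [repL_apply, repL_apply, diffOp_mul, diffOp_mul]
  refine diffOp_congr (fun n => ?_) (by ring) (by ring)
  rw [Int.cast_zero, shift_zero, add_zero, shift_shift, mul_comm]
  push_cast
  rw [add_neg_cancel, shift_zero]

theorem repR_mul_diffOp (f : Mer) (w : ℤ → Mer) (s k : ℤ) :
    repR f * diffOp w s k = diffOp w s k * repR (Mer.shift ((-s - k : ℤ) : ℂ) f) := by
  rw [repR_apply, repR_apply, diffOp_mul, diffOp_mul]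
  refine diffOp_congr (fun n => ?_) (by ring) (by ring)
  rw [Int.cast_zero, shift_zero, add_zero, shift_shift, shift_shift, mul_comm]
  push_cast
  ring_nf

variable (q) in
/-- A representation of `F_R(SL(2))` on sequences of meromorphic functions. With the given actions
  of
`α` and `γ`, those of `β` and `δ` are determined by the requirement that `Ξ` act by zero. -/
def rep (h0 : 0 < q) (h1 : q < 1) : FRSL2 q →ₐ[ℂ] Module.End ℂ (ℤ → Mer) :=
  RingQuot.liftAlgHom ℂ ⟨FreeAlgebra.lift ℂ (genVal repL repR repα (repβ q) (repγ q) (repδ q)),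
    fun _ _ h => lift_rel h0 h1
      (fun f g => by
        rw [repL_apply, repR_apply, Commute, SemiconjBy, diffOp_mul, diffOp_mul]
        exact diffOp_congr (fun n => by simp only [Int.cast_zero, shift_zero, add_zero, mul_comm])
          rfl rfl)
      (good_rep h0 h1)
      (fun f => by rw [one_eq_intCast]; exact repL_mul_diffOp f _ _ _)
      (fun f => by rw [one_eq_intCast]; exact repR_mul_diffOp f _ _ _)
      (fun f => by rw [one_eq_intCast]; exact repL_mul_diffOp f _ _ _)
      (fun f => by rw [neg_one_eq_intCast]; exact repR_mul_diffOp f _ _ _)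
      (fun f => by rw [neg_one_eq_intCast]; exact repL_mul_diffOp f _ _ _)
      (fun f => by rw [one_eq_intCast]; exact repR_mul_diffOp f _ _ _)
      (fun f => by rw [neg_one_eq_intCast]; exact repL_mul_diffOp f _ _ _)
      (fun f => by rw [neg_one_eq_intCast]; exact repR_mul_diffOp f _ _ _) h⟩

theorem rep_generator (h0 : 0 < q) (h1 : q < 1) (g : Gen) :
    rep q h0 h1 (proj q (FreeAlgebra.ι ℂ g)) = genVal repL repR repα (repβ q) (repγ q) (repδ q) g :=
  (RingQuot.liftAlgHom_mkAlgHom_apply _ _ _ _).trans (FreeAlgebra.lift_ι_apply _ _)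

theorem rep_α (h0 : 0 < q) (h1 : q < 1) : rep q h0 h1 (α q) = repα := rep_generator h0 h1 .a

theorem rep_γ (h0 : 0 < q) (h1 : q < 1) : rep q h0 h1 (γ q) = repγ q := rep_generator h0 h1 .c

theorem rep_μl (h0 : 0 < q) (h1 : q < 1) (f : Mer) : rep q h0 h1 (μl q f) = repL f :=
  rep_generator h0 h1 (.l f)

theorem repα_single : repα (Pi.single 0 1) = Pi.single 0 1 := by
  ext n
  rw [repα, diffOp_apply, add_zero, Pi.one_apply, one_mul]
  by_cases h : n = 0
  · subst h; rw [Pi.single_eq_same, map_one]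
  · rw [Pi.single_eq_of_ne h, map_zero]

theorem repγ_single (p : ℤ) (u : Mer) :
    repγ q (Pi.single p u) = Pi.single (p + 2) ((brk q 2)⁻¹ * Mer.shift 1 u) := by
  ext n
  rw [repγ, diffOp_apply, Int.cast_one]
  by_cases h : n = p + 2
  · subst h
    rw [Pi.single_eq_same, show p + 2 + -2 = p by ring, Pi.single_eq_same]
  · rw [Pi.single_eq_of_ne h, Pi.single_eq_of_ne (by omega), map_zero, mul_zero]

/-- The vectors `γ^m α^k e₀` with different `m` are concentrated in different components, `e₀` being
the sequence concentrated in `0` with value `1`. -/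
theorem rep_γ_pow_mul_α_pow (h0 : 0 < q) (h1 : q < 1) (m k : ℕ) :
    ∃ u : Mer, u ≠ 0 ∧ rep q h0 h1 (γ q ^ m * α q ^ k) (Pi.single 0 1) = Pi.single (2 *
      m : ℤ) u := by
  have ha (k : ℕ) : rep q h0 h1 (α q ^ k) (Pi.single 0 1) = Pi.single 0 1 := by
    induction k with
    | zero => rw [pow_zero, map_one]; rfl
    | succ k ih => rw [pow_succ, map_mul, Module.End.mul_apply, rep_α, repα_single, ih]
  induction m with
  | zero => exact ⟨1, one_ne_zero, by rw [pow_zero, one_mul, ha]; rfl⟩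
  | succ m ih =>
    obtain ⟨u, hu, h⟩ := ih
    refine ⟨_, mul_ne_zero (inv_ne_zero (brk_ne_zero h0 h1 2))
      ((map_ne_zero_iff (Mer.shift 1) (Mer.shift 1).toRingHom.injective).2 hu), ?_⟩
    rw [pow_succ', mul_assoc, map_mul, Module.End.mul_apply, h, rep_γ, repγ_single]
    congr 1

/-- The component of index `m` of `x e₀`, where `e₀` is the sequence concentrated in `0` with value
`1`. -/
def vacuumCoeff (h0 : 0 < q) (h1 : q < 1) (m : ℤ) : FRSL2 q →ₗ[ℂ] Mer :=
  LinearMap.proj m ∘ₗ LinearMap.applyₗ (Pi.single 0 1) ∘ₗ (rep q h0 h1).toLinearMap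

theorem vacuumCoeff_μl_mul (h0 : 0 < q) (h1 : q < 1) (m : ℤ) (f : Mer) (b : FRSL2 q) :
    vacuumCoeff h0 h1 m (μl q f * b) = f * vacuumCoeff h0 h1 m b := by
  change rep q h0 h1 (μl q f * b) _ m = f * rep q h0 h1 b _ m
  rw [map_mul, Module.End.mul_apply, rep_μl, repL_apply, diffOp_apply, Int.cast_zero, shift_zero,
    add_zero]

theorem vacuumCoeff_vec_self (h0 : 0 < q) (h1 : q < 1) (N j : ℕ) :
    vacuumCoeff h0 h1 (2 * (N - j : ℕ)) (vec q N j) ≠ 0 := by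
  obtain ⟨u, hu, h⟩ := rep_γ_pow_mul_α_pow h0 h1 (N - j) j
  change rep q h0 h1 (vec q N j) _ _ ≠ 0
  rw [vec, h, Pi.single_eq_same]
  exact hu

theorem vacuumCoeff_vec_of_ne (h0 : 0 < q) (h1 : q < 1) {N i j : ℕ} (hi : i ≤ N) (hj : j ≤ N)
    (hij : i ≠ j) : vacuumCoeff h0 h1 (2 * (N - i : ℕ)) (vec q N j) = 0 := by
  obtain ⟨u, hu, h⟩ := rep_γ_pow_mul_α_pow h0 h1 (N - j) j
  change rep q h0 h1 (vec q N j) _ _ = 0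
  rw [vec, h, Pi.single_eq_of_ne (by omega)]

end Representation

end FRSL2

/-! ### Uniqueness of the matrix elements -/

namespace FRSL2
variable {q : ℝ}

section Balanced

variable (q) in
/-- The span of the differences `f(μ) a ⊗ b - a ⊗ f(λ) b` in `A ⊗ A`. -/
def balanced : Submodule ℂ (FRSL2 q ⊗[ℂ] FRSL2 q) :=
  Submodule.span ℂ {x | ∃ (f : Mer) (a b : FRSL2 q), x = (μr q f * a) ⊗ₜ b - a ⊗ₜ (μl q f * b)}

/-- The submodule `balanced` is stable under left multiplication by `⊕ A_{mn} ⊗ A_{np}`, since `a`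
and `b` move past `f(μ)` and `f(λ)` with the same translation for `a ∈ A_{mn}`, `b ∈ A_{np}`. -/
theorem mul_mem_balanced {x y : FRSL2 q ⊗[ℂ] FRSL2 q} (hx : x ∈ matched q) (hy : y ∈ balanced q) :
    x * y ∈ balanced q := by
  induction hx using Algebra.adjoin_induction generalizing y with
  | mem x hx =>
    obtain ⟨m, n, p, a, ha, b, hb, rfl⟩ := hx
    have ha : IsHomog q m n a := ha
    have hb : IsHomog q n p b := hb
    induction hy using Submodule.span_induction with
    | mem y hy =>
      obtain ⟨f, a', b', rfl⟩ := hy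
      refine Submodule.subset_span ⟨Mer.shift ((-n : ℤ) : ℂ) f, a * a', b * b', ?_⟩
      have e1 : μr q (Mer.shift ((-n : ℤ) : ℂ) f) * a = a * μr q f := by
        rw [← coef_one_tmul, ha.coef_mul, sft_tmul, map_one, shift_shift, ← coef_one_tmul]
        push_cast; rw [add_neg_cancel, shift_zero]
      have e2 : μl q (Mer.shift ((-n : ℤ) : ℂ) f) * b = b * μl q f := by
        rw [← coef_tmul_one, hb.coef_mul, sft_tmul, map_one, shift_shift, ← coef_tmul_one]
        push_cast; rw [add_neg_cancel, shift_zero]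
      rw [mul_sub, Algebra.TensorProduct.tmul_mul_tmul, Algebra.TensorProduct.tmul_mul_tmul,
        ← mul_assoc, ← mul_assoc, ← mul_assoc, ← mul_assoc, e1, e2]
    | zero => rw [mul_zero]; exact zero_mem _
    | add y z _ _ hy hz => rw [mul_add]; exact add_mem hy hz
    | smul c y _ hy => rw [mul_smul_comm]; exact Submodule.smul_mem _ c hy
  | algebraMap c => rw [← Algebra.smul_def]; exact Submodule.smul_mem _ c hy
  | add x x' _ _ hx hx' => rw [add_mul]; exact add_mem (hx hy) (hx' hy)
  | mul x x' _ _ hx hx' => rw [mul_assoc]; exact hx (hx' hy)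

variable (q) in
/-- The action of `⊕ A_{mn} ⊗ A_{np}` on the quotient of `A ⊗ A` by `balanced`. -/
def matchedAct : matched q →ₐ[ℂ] Module.End ℂ ((FRSL2 q ⊗[ℂ] FRSL2 q) ⧸ balanced q) :=
  AlgHom.ofLinearMap
    { toFun :=
      fun x => (balanced q).mapQ (balanced q) (LinearMap.mulLeft ℂ (x : FRSL2 q ⊗[ℂ] FRSL2 q))
        fun _ hy => mul_mem_balanced x.2 hy
      map_add' := fun x y => by
        refine Submodule.linearMap_qext _ (LinearMap.ext fun z => ?_)
        exact congrArg (Submodule.Quotient.mk) (add_mul (x : FRSL2 q ⊗[ℂ] FRSL2 q) y z)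
      map_smul' := fun c x => by
        refine Submodule.linearMap_qext _ (LinearMap.ext fun z => ?_)
        exact congrArg (Submodule.Quotient.mk) (smul_mul_assoc c (x : FRSL2 q ⊗[ℂ] FRSL2 q) z) }
    (by
      refine Submodule.linearMap_qext _ (LinearMap.ext fun z => ?_)
      exact congrArg (Submodule.Quotient.mk) (one_mul z))
    (fun x y => by
      refine Submodule.linearMap_qext _ (LinearMap.ext fun z => ?_)
      exact congrArg (Submodule.Quotient.mk) (mul_assoc (x : FRSL2 q ⊗[ℂ] FRSL2 q) y z))

theorem matchedAct_mk (x : matched q) (y : FRSL2 q ⊗[ℂ] FRSL2 q) :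
    matchedAct q x (Submodule.Quotient.mk y) = Submodule.Quotient.mk ((x : FRSL2 q ⊗[ℂ] FRSL2 q) *
      y) :=
  rfl

theorem matchedAct_rel {x y : matched q} (h : MatRel q x y) : matchedAct q x = matchedAct q y := by
  obtain ⟨f⟩ := h
  refine Submodule.linearMap_qext _ (LinearMap.ext fun z => ?_)
  change matchedAct q _ (Submodule.Quotient.mk z) = matchedAct q _ (Submodule.Quotient.mk z)
  rw [matchedAct_mk, matchedAct_mk, Submodule.Quotient.eq]
  induction z with
  | zero => rw [mul_zero, mul_zero, sub_zero]; exact zero_mem _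
  | add z w hz hw =>
    rw [mul_add, mul_add, add_sub_add_comm]; exact add_mem hz hw
  | tmul a b =>
    rw [Algebra.TensorProduct.tmul_mul_tmul, Algebra.TensorProduct.tmul_mul_tmul, one_mul, one_mul]
    exact Submodule.subset_span ⟨f, a, b, rfl⟩

/-- The kernel of the projection onto the matrix tensor product is contained in `balanced`. -/
theorem mem_balanced_of_matProj_eq_zero {x : matched q} (h : matProj q x = 0) :
    (x : FRSL2 q ⊗[ℂ] FRSL2 q) ∈ balanced q := by
  have h1 := congrArg (RingQuot.liftAlgHom ℂ ⟨matchedAct q, fun _ _ h => matchedAct_rel h⟩) h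
  have h2 : matchedAct q x = 0 := by
    have h3 := RingQuot.liftAlgHom_mkAlgHom_apply ℂ (s := MatRel q) (matchedAct q)
      (fun _ _ h => matchedAct_rel h) x
    rw [← h3]
    exact h1.trans (map_zero _)
  have h4 := LinearMap.congr_fun h2 (Submodule.Quotient.mk 1)
  rw [matchedAct_mk, mul_one, LinearMap.zero_apply] at h4
  exact (Submodule.Quotient.mk_eq_zero _).1 h4

/-- The map `a ⊗ b ↦ φ(b)(μ) a`, for a linear functional `φ`. -/
def contract (φ : FRSL2 q →ₗ[ℂ] Mer) : FRSL2 q ⊗[ℂ] FRSL2 q →ₗ[ℂ] FRSL2 q :=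
  TensorProduct.lift ((LinearMap.mul ℂ (FRSL2 q)).flip.compl₂ ((μr q).toLinearMap ∘ₗ φ))

theorem contract_tmul (φ : FRSL2 q →ₗ[ℂ] Mer) (a b : FRSL2 q) :
    contract φ (a ⊗ₜ b) = μr q (φ b) * a := rfl

theorem contract_eq_zero {φ : FRSL2 q →ₗ[ℂ] Mer} (hφ : ∀ f b, φ (μl q f * b) = f * φ b)
    {x : FRSL2 q ⊗[ℂ] FRSL2 q} (hx : x ∈ balanced q) : contract φ x = 0 := by
  induction hx using Submodule.span_induction with
  | mem x hx =>
    obtain ⟨f, a, b, rfl⟩ := hx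
    rw [map_sub, contract_tmul, contract_tmul, hφ, ← mul_assoc, ← map_mul, mul_comm f, sub_self]
  | zero => exact map_zero _
  | add x y _ _ hx hy => rw [map_add, hx, hy, add_zero]
  | smul c x _ hx => rw [map_smul, hx, smul_zero]

/-- The matrix elements of `V_N` are determined by the coproduct: `t_{ki}` is recovered from
`∑_j t_{kj} ⊗ γ^{N-j} α^j` by contraction with a functional that is nonzero on `γ^{N-i} α^i` and
vanishes on the other basis vectors. -/
theorem isMatrixElements_unique (h0 : 0 < q) (h1 : q < 1) {N : ℕ}
    {t t' : Fin (N + 1) → Fin (N + 1) → FRSL2 q} (ht : IsMatrixElements q h0 h1 N t)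
    (ht' : IsMatrixElements q h0 h1 N t') : t = t' := by
  funext k i
  set X : ∀ t : Fin (N + 1) → Fin (N + 1) → FRSL2 q, IsMatrixElements q h0 h1 N t → matched q :=
    fun t ht => ∑ j, ⟨t k j ⊗ₜ vec q N j, tmul_mem_matched (ht.mem k j) (vec_mem q N j)⟩ with hX
  set φ := vacuumCoeff h0 h1 (2 * (N - i : ℕ)) with hφ
  have hproj (t) (ht : IsMatrixElements q h0 h1 N t) :
      matProj q (X t ht) = comul q h0 h1 (vec q N k) := by
    rw [ht.comul_eq k, hX, map_sum]; rfl
  have hcon (t) (ht : IsMatrixElements q h0 h1 N t) :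
      contract φ (X t ht) = μr q (φ (vec q N i)) * t k i := by
    rw [hX, AddSubmonoidClass.coe_finsetSum, map_sum, Finset.sum_eq_single i]
    · rfl
    · intro j _ hj
      change μr q (φ (vec q N j)) * t k j = 0
      rw [hφ, vacuumCoeff_vec_of_ne h0 h1 (by omega) (by omega) (fun h => hj (Fin.ext h.symm)),
        map_zero, zero_mul]
    · exact fun h => absurd (Finset.mem_univ i) h
  have hK : ((X t ht - X t' ht' : matched q) : FRSL2 q ⊗[ℂ] FRSL2 q) ∈ balanced q :=
    mem_balanced_of_matProj_eq_zero (by rw [map_sub, hproj t ht, hproj t' ht', sub_self])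
  have h := contract_eq_zero (φ := φ) (vacuumCoeff_μl_mul h0 h1 _) hK
  rw [AddSubgroupClass.coe_sub, map_sub, sub_eq_zero] at h
  have h' := (hcon t ht).symm.trans (h.trans (hcon t' ht'))
  have hu : IsUnit (μr q (φ (vec q N i))) :=
    (IsUnit.mk0 _ (vacuumCoeff_vec_self h0 h1 N i)).map (μr q)
  exact hu.mul_left_cancel h'

end Balanced

end FRSL2

end DynQG
end

theorem theorem3 (q : ℝ) (h0 : 0 < q) (h1 : q < 1) :
    (∀ x : FRSL2 q, Ξ q * x = x * Ξ q) ∧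
    ∀ N : ℕ,
      (∃! t : Fin (N + 1) → Fin (N + 1) → FRSL2 q, IsMatrixElements q h0 h1 N t) ∧
      ∀ t : Fin (N + 1) → Fin (N + 1) → FRSL2 q, IsMatrixElements q h0 h1 N t →
        ∀ k j : Fin (N + 1),
          (∀ n : ℕ, Pelt q n N k j ∈ grade q 0 0) ∧
          ((k : ℕ) ≤ j → (k : ℕ) + j ≤ N →
            t k j = γ q ^ ((j : ℕ) - k) * δ q ^ (N - k - j) * Pelt q k N k j) ∧
          ((k : ℕ) ≤ j → N ≤ (k : ℕ) + j →
            t k j = γ q ^ ((j : ℕ) - k) * Pelt q (N - j) N k j * α q ^ ((k : ℕ) + j - N)) ∧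
          ((j : ℕ) ≤ k → (k : ℕ) + j ≤ N →
            t k j = δ q ^ (N - k - j) * Pelt q j N k j * β q ^ ((k : ℕ) - j)) ∧
          ((j : ℕ) ≤ k → N ≤ (k : ℕ) + j →
            t k j = Pelt q (N - k) N k j * α q ^ ((k : ℕ) + j - N) * β q ^ ((k : ℕ) - j)) := by
  refine ⟨Ξ_central h0 h1, fun N => ⟨⟨_, isMatrixElements_matElt h0 h1 N, fun t ht =>
    isMatrixElements_unique h0 h1 ht (isMatrixElements_matElt h0 h1 N)⟩, fun t ht k j => ?_⟩⟩
  obtain rfl := isMatrixElements_unique h0 h1 ht (isMatrixElements_matElt h0 h1 N)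
  obtain ⟨k, hk⟩ := k
  obtain ⟨j, hj⟩ := j
  simp only [← Φ_pPoly h0]
  refine ⟨fun n => isHomog_Φ h0 _, fun hkj hN => ?_, fun hkj hN => ?_, fun hkj hN => ?_,
    fun hkj hN => ?_⟩
  · have h := (matElt_eq h0 h1 N k (N - k - j) (j - k) (by omega)).1
    rwa [Nat.add_sub_cancel' hkj] at h
  · have h := (matElt_eq h0 h1 N (N - j) (k + j - N) (j - k) (by omega)).2.1
    rwa [show N - j + (k + j - N) = k by omega, Nat.add_sub_cancel' hkj] at h
  · have h := (matElt_eq h0 h1 N j (N - k - j) (k - j) (by omega)).2.2.1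
    rwa [Nat.add_sub_cancel' hkj] at h
  · have h := (matElt_eq h0 h1 N (N - k) (k + j - N) (k - j) (by omega)).2.2.2
    rwa [show N - k + (k + j - N) = j by omega, Nat.add_sub_cancel' hkj] at h
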